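/- **Theorem 5.9.** Fix a constant $\delta$ with $0<\delta<1/2$. Let $G$ be a finite tree on $n$ nodes. Each node $v$ receives an independent private signal $X(v)\in\{0,1\}$ ($1$ is called Correct, $0$ Incorrect) with $\Pr[X(v)=1]=1/2+\delta$. In asynchronous majority dynamics on $G$, no node has announced an opinion at time $0$ (all announcements are $\bot$). In each step $t=1,2,\dots$ one node, chosen uniformly at random and independently of all other choices and of the signals, updates its announcement: it announces $1$ if strictly more of its neighbours currently announce $1$ than $0$, it announces $0$ if strictly more of its neighbours currently announce $0$ than $1$, and it announces its own signal $X(v)$ in case of a tie; all other announcements stay the same. The process *stabilizes in a Correct majority* if it reaches a state in which no node would change its announcement if selected and in which strictly more than $n/2$ nodes announce $1$. A tree is a *balanced $M$-ary tree* if it has a root such that every node with at least one child has exactly $M$ children, and all root–leaf paths have the same length, a leaf being a node without children. Then there is a function $f:\mathbb N\to\mathbb R$, depending only on $\delta$, with $f(n)\to 0$ as $n\to\infty$, such that for every $M$ and every balanced $M$-ary tree $G$ on $n$ nodes, asynchronous majority dynamics on $G$ stabilizes in a Correct majority with probability at least $1-f(n)$. -/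

import Mathlib

open MeasureTheory Filter Topology

namespace MajorityDynamics

/-- A profile of public announcements: `none` is `⊥` (no announcement yet), `some true` is
Correct, `some false` is Incorrect. -/
abbrev Profile (V : Type*) := V → Option Bool

/-- The number of neighbours of `v` whose current announcement is `b`. -/
noncomputable def nbrCount {V : Type*} (G : SimpleGraph V) (c : Profile V) (v : V) (b : Bool) : ℕ :=
  {u : V | G.Adj v u ∧ c u = some b}.ncard

/-- What `v` announces when selected: the strict majority among its neighbours' announcements,
and its private signal `X v` in case of a tie. -/
noncomputable def newAnnouncement {V : Type*} (G : SimpleGraph V) (X : V → Bool) (c : Profile V)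
    (v : V) : Bool :=
  if nbrCount G c v false < nbrCount G c v true then true
  else if nbrCount G c v true < nbrCount G c v false then false
  else X v

open Classical in
/-- One step of the dynamics: the selected node `v` updates, all others keep their announcement. -/
noncomputable def step {V : Type*} (G : SimpleGraph V) (X : V → Bool) (c : Profile V) (v : V) :
    Profile V :=
  Function.update c v (some (newAnnouncement G X c v))

/-- The announcements after `t` steps, for private signals `X` and the sequence `s` of selected
nodes (`s t` is the node selected in step `t + 1`). -/
noncomputable def announcement {V : Type*} (G : SimpleGraph V) (X : V → Bool) (s : ℕ → V) :
    ℕ → Profile V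
  | 0 => fun _ => none
  | t + 1 => step G X (announcement G X s t) (s t)

/-- No node would change its announcement if it were selected. -/
def IsStable {V : Type*} (G : SimpleGraph V) (X : V → Bool) (c : Profile V) : Prop :=
  ∀ v, step G X c v = c

/-- Strictly more than half of all nodes announce Correct. -/
def IsCorrectMajority {V : Type*} (c : Profile V) : Prop :=
  Nat.card V < 2 * {v : V | c v = some true}.ncard

/-- The process reaches a stable profile in which a majority of the nodes announce Correct. -/
def StabilizesInCorrectMajority {V : Type*} (G : SimpleGraph V) (X : V → Bool) (s : ℕ → V) : Prop :=
  ∃ t, IsStable G X (announcement G X s t) ∧ IsCorrectMajority (announcement G X s t)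

/-- The law of one private signal: Correct with probability `1/2 + δ`, else Incorrect. -/
noncomputable def signalLaw (δ : ℝ) : Measure Bool :=
  ENNReal.ofReal (1 / 2 + δ) • Measure.dirac true + ENNReal.ofReal (1 / 2 - δ) • Measure.dirac false

/-- The law of the randomness of the process: the private signals and the selected nodes are all
independent, the signals have law `signalLaw δ`, and each selected node is uniform on `V`. -/
noncomputable def processLaw (V : Type*) [Fintype V] [Nonempty V] [MeasurableSpace V]
    (δ : ℝ) : Measure ((V → Bool) × (ℕ → V)) :=
  (Measure.pi fun _ : V => signalLaw δ).prod
    (Measure.infinitePi fun _ : ℕ => (PMF.uniformOfFintype V).toMeasure)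

/-- The children of `v` in a tree rooted at `r`: the neighbours of `v` one step further from `r`. -/
def children {V : Type*} (G : SimpleGraph V) (r v : V) : Set V :=
  {u | G.Adj v u ∧ G.dist r u = G.dist r v + 1}

/-- `G` is a tree which can be rooted at some `r` so that every node with at least one child has
exactly `M` children, and all leaves (nodes without children) are at the same distance from `r`. -/
def IsBalancedTree {V : Type*} (G : SimpleGraph V) (M : ℕ) : Prop :=
  G.IsTree ∧ ∃ r : V,
    (∀ v, (children G r v).Nonempty → (children G r v).ncard = M) ∧
    (∀ v w, children G r v = ∅ → children G r w = ∅ → G.dist r v = G.dist r w)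

end MajorityDynamics

/-!
Write announcements and signals as spins `±1`, with `0` for no announcement. The announcements are
monotone functions of the signals, and flipping all signals flips all announcements. A monotone
event which holds for exactly one of any two opposite bit vectors is at least as likely as a single
bit being `true` (`le_bitMean_of_monotone_of_odd`). Hence at all times, every node that has
announced is Correct with probability at least `1/2 + δ`, whatever the selections.

*Bounded arity.* An energy drops with every change of an announcement, so only `O(n)` changes ever
occur (`sum_changes_le`). The process therefore stabilizes (`exists_stable`), and at some time of
order `n` only few nodes are unstable in the mean (`exists_time_few_unstable`). Until that time the
signal of a node influences `O(1)` nodes in mean square (`integral_card_cone_sq_le`), so the number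
of Correct nodes has variance `O(n)`. Thus with high probability there is a nearly stable profile in
which a proportion of nearly `1/2 + δ` of the nodes is Correct (`exists_time_nearly_stable`). It
remains to see that few of them are lost later on. For this we exhibit a set containing nearly all
nodes which protects itself against anything the other nodes may do (`IsPersistent`):

* for `M ≥ 2`, a Correct node can be turned by its parent alone only if at most `(M + 1) / 2` of its
  children are Correct. A loss spreading down from the top of the tree thus multiplies by at most
  `(M + 1) / 2 ≤ 3 M / 4` per level, while the levels grow by the factor `M`, so that it reaches
  only a small part of the bottom levels (`LevelTree.card_falling_le`);
* for `M = 1`, two adjacent stable nodes with Correct signals agree, and if they are Correct, they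
  support each other forever. Such pairs occur everywhere on a path and stop all losses
  (`LevelTree.isPersistent_isSealed`).

*Large arity.* Most parents of leaves are selected for the first time when a fair proportion of
their leaves, hence many, have announced their own signals; by then they see a clear Correct
majority among their children, and afterwards the children can only join them
(`LevelTree.IsLocked`). As almost all nodes are leaves, this gives a Correct majority
(`LevelTree.stabilizesInCorrectMajority_of_locked`), uniformly in all arities from some `M₀` on
(`eventually_correctMajority_of_large_arity`).

So for each `ε` there is a threshold for `n` which serves all arities
(`eventually_correctMajority`), and `f n` is the supremum of the failure
probabilities on `n` nodes.
-/

namespace MajorityDynamics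

section Dynamics

open scoped Classical

/-! ### The dynamics in terms of spins -/

/-- An announcement as a number: `1` for Correct, `-1` for Incorrect, `0` for no announcement. -/
def spin : Option Bool → ℤ
  | none => 0
  | some true => 1
  | some false => -1

/-- A private signal as a number `±1`. -/
def signalSpin (b : Bool) : ℤ := if b then 1 else -1

@[simp] lemma spin_none : spin none = 0 := rfl
@[simp] lemma spin_some (b : Bool) : spin (some b) = signalSpin b := by cases b <;> rfl
@[simp] lemma signalSpin_true : signalSpin true = 1 := rfl
@[simp] lemma signalSpin_false : signalSpin false = -1 := rfl

lemma signalSpin_not (b : Bool) : signalSpin (!b) = -signalSpin b := by cases b <;> rfl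

lemma spin_le_one (o : Option Bool) : spin o ≤ 1 := by
  rcases o with _ | _ | _ <;> simp

lemma neg_one_le_spin (o : Option Bool) : -1 ≤ spin o := by
  rcases o with _ | _ | _ <;> simp

lemma spin_eq_one_iff (o : Option Bool) : spin o = 1 ↔ o = some true := by
  rcases o with _ | _ | _ <;> simp

lemma eq_some_true_of_one_le {o : Option Bool} (h : 1 ≤ spin o) : o = some true :=
  (spin_eq_one_iff o).1 (le_antisymm (spin_le_one o) h)

variable {V : Type*}

lemma step_self (G : SimpleGraph V) (X : V → Bool) (c : Profile V) (v : V) :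
    step G X c v v = some (newAnnouncement G X c v) := by
  simp [step]

lemma step_of_ne (G : SimpleGraph V) (X : V → Bool) (c : Profile V) {v w : V} (h : w ≠ v) :
    step G X c v w = c w := by
  simp [step, h]

lemma step_eq_iff (G : SimpleGraph V) (X : V → Bool) (c : Profile V) (v : V) :
    step G X c v = c ↔ c v = some (newAnnouncement G X c v) := by
  simp [step, eq_comm]

lemma announcement_eq_none_iff (G : SimpleGraph V) (X : V → Bool) (s : ℕ → V) (t : ℕ) (v : V) :
    announcement G X s t v = none ↔ ∀ i < t, s i ≠ v := by
  induction t with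
  | zero => simp [announcement]
  | succ t ih =>
    simp only [announcement]
    by_cases hv : v = s t
    · subst hv
      rw [step_self]
      simp only [reduceCtorEq, false_iff, not_forall]
      exact ⟨t, Nat.lt_succ_self t, by simp⟩
    · rw [step_of_ne _ _ _ hv, ih]
      refine ⟨fun h i hi => ?_, fun h i hi => h i (Nat.lt_succ_of_lt hi)⟩
      rcases Nat.lt_succ_iff_lt_or_eq.1 hi with hi | rfl
      · exact h i hi
      · exact fun h' => hv h'.symm

/-- The announcements after `t` steps depend only on the first `t` selections. -/
lemma announcement_congr (G : SimpleGraph V) (X : V → Bool) {s s' : ℕ → V} {t : ℕ}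
    (h : ∀ i < t, s i = s' i) : announcement G X s t = announcement G X s' t := by
  induction t with
  | zero => rfl
  | succ t ih =>
    simp only [announcement]
    rw [ih fun i hi => h i (Nat.lt_succ_of_lt hi), h t (Nat.lt_succ_self t)]

variable [Fintype V]

/-- The sum of the spins of the neighbours of `v`. -/
noncomputable def field (G : SimpleGraph V) (c : Profile V) (v : V) : ℤ :=
  ∑ u, if G.Adj v u then spin (c u) else 0

/-- Twice the field plus the signal: an odd number whose sign is the next announcement of `v`. -/
noncomputable def pull (G : SimpleGraph V) (X : V → Bool) (c : Profile V) (v : V) : ℤ :=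
  2 * field G c v + signalSpin (X v)

lemma nbrCount_eq_sum (G : SimpleGraph V) (c : Profile V) (v : V) (b : Bool) :
    (nbrCount G c v b : ℤ) = ∑ u, if G.Adj v u ∧ c u = some b then 1 else 0 := by
  rw [nbrCount, Set.ncard_eq_toFinset_card', Finset.sum_boole]
  congr 2
  ext u
  simp

lemma field_eq (G : SimpleGraph V) (c : Profile V) (v : V) :
    field G c v = nbrCount G c v true - nbrCount G c v false := by
  rw [nbrCount_eq_sum, nbrCount_eq_sum, field, ← Finset.sum_sub_distrib]
  refine Finset.sum_congr rfl fun u _ => ?_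
  by_cases h : G.Adj v u
  · rcases hc : c u with _ | _ | _ <;> simp [h]
  · simp [h]

lemma newAnnouncement_eq (G : SimpleGraph V) (X : V → Bool) (c : Profile V) (v : V) :
    newAnnouncement G X c v = decide (0 < pull G X c v) := by
  have h := field_eq G c v
  unfold newAnnouncement pull
  split_ifs with h1 h2
  · symm
    have : signalSpin (X v) ≥ -1 := by cases X v <;> simp
    rw [decide_eq_true_iff]
    omega
  · symm
    have : signalSpin (X v) ≤ 1 := by cases X v <;> simp
    rw [decide_eq_false_iff_not]
    omega
  · have : field G c v = 0 := by omega
    rw [this]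
    cases X v <;> simp

lemma pull_ne_zero (G : SimpleGraph V) (X : V → Bool) (c : Profile V) (v : V) :
    pull G X c v ≠ 0 := by
  unfold pull
  cases X v <;> simp <;> omega

lemma field_mono (G : SimpleGraph V) {c c' : Profile V} (v : V)
    (h : ∀ u, G.Adj v u → spin (c u) ≤ spin (c' u)) : field G c v ≤ field G c' v := by
  refine Finset.sum_le_sum fun u _ => ?_
  split_ifs with hu
  · exact h u hu
  · exact le_rfl

lemma newAnnouncement_mono (G : SimpleGraph V) {X X' : V → Bool} {c c' : Profile V} (v : V)
    (hX : X v ≤ X' v) (h : ∀ u, G.Adj v u → spin (c u) ≤ spin (c' u)) :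
    newAnnouncement G X c v ≤ newAnnouncement G X' c' v := by
  have hf := field_mono G v h
  have hs : signalSpin (X v) ≤ signalSpin (X' v) := by
    revert hX; cases X v <;> cases X' v <;> simp
  rw [newAnnouncement_eq, newAnnouncement_eq]
  by_cases h0 : 0 < pull G X c v
  · have : 0 < pull G X' c' v := by unfold pull at *; omega
    simp [h0, this]
  · simp [h0]

lemma signalSpin_mono {a b : Bool} (h : a ≤ b) : signalSpin a ≤ signalSpin b := by
  revert h; cases a <;> cases b <;> simp

lemma newAnnouncement_congr (G : SimpleGraph V) {X X' : V → Bool} {c c' : Profile V} (v : V)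
    (hX : X v = X' v) (h : ∀ u, G.Adj v u → c u = c' u) :
    newAnnouncement G X c v = newAnnouncement G X' c' v := by
  rw [newAnnouncement_eq, newAnnouncement_eq]
  have : field G c v = field G c' v := by
    refine Finset.sum_congr rfl fun u _ => ?_
    split_ifs with hu
    · rw [h u hu]
    · rfl
  exact decide_eq_decide.2 (by rw [pull, pull, this, hX])

/-- With larger signals, all announcements at all times are larger. -/
lemma announcement_mono (G : SimpleGraph V) {X X' : V → Bool} (h : X ≤ X') (s : ℕ → V) (t : ℕ)
    (v : V) : spin (announcement G X s t v) ≤ spin (announcement G X' s t v) := by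
  induction t generalizing v with
  | zero => simp [announcement]
  | succ t ih =>
    simp only [announcement]
    by_cases hv : v = s t
    · subst hv
      rw [step_self, step_self, spin_some, spin_some]
      exact signalSpin_mono (newAnnouncement_mono G _ (h _) fun u _ => ih u)
    · rw [step_of_ne _ _ _ hv, step_of_ne _ _ _ hv]
      exact ih v

/-- Negating all signals negates all announcements. -/
lemma announcement_not (G : SimpleGraph V) (X : V → Bool) (s : ℕ → V) (t : ℕ) (v : V) :
    announcement G (fun u => !X u) s t v = (announcement G X s t v).map not := by
  induction t generalizing v with
  | zero => simp [announcement]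
  | succ t ih =>
    simp only [announcement]
    by_cases hv : v = s t
    · subst hv
      rw [step_self, step_self]
      have hs : ∀ o : Option Bool, spin (o.map not) = -spin o := by
        intro o; rcases o with _ | _ | _ <;> simp
      have hf : field G (announcement G (fun u => !X u) s t) (s t)
          = -field G (announcement G X s t) (s t) := by
        rw [field, field, ← Finset.sum_neg_distrib]
        refine Finset.sum_congr rfl fun u _ => ?_
        split_ifs
        · rw [ih, hs]
        · simp
      have hp : pull G (fun u => !X u) (announcement G (fun u => !X u) s t) (s t)
          = -pull G X (announcement G X s t) (s t) := by
        rw [pull, pull, hf, signalSpin_not]; ring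
      have h0 := pull_ne_zero G X (announcement G X s t) (s t)
      rw [newAnnouncement_eq, newAnnouncement_eq, hp]
      simp only [Option.map_some, Option.some.injEq]
      by_cases h1 : 0 < pull G X (announcement G X s t) (s t)
      · simp [h1, h1.le]
      · have : pull G X (announcement G X s t) (s t) < 0 := by omega
        simp [h1, this]
    · rw [step_of_ne _ _ _ hv, step_of_ne _ _ _ hv]
      exact ih v

/-! ### Energy and stabilization -/

/-- Minus the sum of the products of adjacent spins (over ordered pairs) and of the products of
spins with signals. Every change of an announcement lowers it by at least one. -/
noncomputable def energy (G : SimpleGraph V) (X : V → Bool) (c : Profile V) : ℤ :=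
  -(∑ v, spin (c v) * (field G c v + signalSpin (X v)))

lemma field_update (G : SimpleGraph V) (c : Profile V) (w v : V) (o : Option Bool) :
    field G (Function.update c w o) v
      = field G c v + if G.Adj v w then spin o - spin (c w) else 0 := by
  have : ∀ u, (if G.Adj v u then spin (Function.update c w o u) else 0)
      = (if G.Adj v u then spin (c u) else 0)
        + if u = w then (if G.Adj v w then spin o - spin (c w) else 0) else 0 := by
    intro u
    by_cases hu : u = w
    · subst hu; by_cases h : G.Adj v u <;> simp [h]
    · simp [hu]
  simp only [field, this, Finset.sum_add_distrib]
  simp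

lemma energy_update (G : SimpleGraph V) (X : V → Bool) (c : Profile V) (w : V) (o : Option Bool) :
    energy G X (Function.update c w o)
      = energy G X c - (spin o - spin (c w)) * pull G X c w := by
  have h1 : ∀ v, spin (Function.update c w o v)
      * (field G (Function.update c w o) v + signalSpin (X v))
      = spin (c v) * (field G c v + signalSpin (X v))
        + (spin o - spin (c w)) * (if G.Adj w v then spin (c v) else 0)
        + if v = w then (spin o - spin (c w)) * (field G c w + signalSpin (X w)) else 0 := by
    intro v
    rw [field_update]
    by_cases hv : v = w
    · subst hv; simp; ring
    · by_cases h : G.Adj v w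
      · simp [hv, h, h.symm]; ring
      · have h' : ¬G.Adj w v := fun h' => h h'.symm
        simp [hv, h, h']
  simp only [energy, h1, Finset.sum_add_distrib, ← Finset.mul_sum]
  simp only [Finset.sum_ite_eq', Finset.mem_univ, if_true, pull]
  rw [show (∑ i, if G.Adj w i then spin (c i) else 0) = field G c w from rfl]
  ring

/-- The nodes which would change their announcement if selected. -/
noncomputable def unstable (G : SimpleGraph V) (X : V → Bool) (c : Profile V) : Finset V :=
  Finset.univ.filter fun v => step G X c v ≠ c

lemma energy_step_le (G : SimpleGraph V) (X : V → Bool) (c : Profile V) (w : V) :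
    energy G X (step G X c w) ≤ energy G X c - if w ∈ unstable G X c then 1 else 0 := by
  by_cases h : step G X c w = c
  · have h' : w ∉ unstable G X c := by simpa [unstable] using h
    rw [h, if_neg h']; simp
  · have h' : w ∈ unstable G X c := by simpa [unstable] using h
    rw [if_pos h', step, energy_update]
    rw [step_eq_iff] at h
    have h0 := pull_ne_zero G X c w
    rw [newAnnouncement_eq] at h ⊢
    suffices 1 ≤ (spin (some (decide (0 < pull G X c w))) - spin (c w)) * pull G X c w by omega
    by_cases hp : 0 < pull G X c w
    · have : spin (c w) ≤ 0 := by
        rcases hc : c w with _ | _ | _ <;> simp_all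
      simp only [hp, decide_true, spin_some, signalSpin_true]
      nlinarith
    · have hp' : pull G X c w ≤ -1 := by omega
      have : 0 ≤ spin (c w) := by
        rcases hc : c w with _ | _ | _ <;> simp_all
      simp only [hp, decide_false, spin_some, signalSpin_false]
      nlinarith

lemma neg_energy_le (G : SimpleGraph V) (X : V → Bool) (c : Profile V) {Δ : ℕ}
    (hΔ : ∀ v, {u | G.Adj v u}.ncard ≤ Δ) : -energy G X c ≤ (Δ + 1) * Fintype.card V := by
  rw [energy, neg_neg]
  have : ∀ v ∈ Finset.univ, spin (c v) * (field G c v + signalSpin (X v)) ≤ (Δ + 1 : ℤ) := by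
    intro v _
    have hf : |field G c v| ≤ Δ := by
      calc |field G c v| ≤ ∑ u, |if G.Adj v u then spin (c u) else 0| :=
            Finset.abs_sum_le_sum_abs _ _
        _ ≤ ∑ u, if G.Adj v u then 1 else 0 := by
            refine Finset.sum_le_sum fun u _ => ?_
            split_ifs
            · exact abs_le.2 ⟨neg_one_le_spin _, spin_le_one _⟩
            · simp
        _ = ({u | G.Adj v u}.ncard : ℤ) := by
            rw [Set.ncard_eq_toFinset_card', Finset.sum_boole]
            congr 2; ext u; simp
        _ ≤ Δ := by exact_mod_cast hΔ v
    have hs : |signalSpin (X v)| = 1 := by cases X v <;> simp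
    have h1 : |spin (c v)| ≤ 1 := abs_le.2 ⟨neg_one_le_spin _, spin_le_one _⟩
    calc _ ≤ |spin (c v) * (field G c v + signalSpin (X v))| := le_abs_self _
      _ = |spin (c v)| * |field G c v + signalSpin (X v)| := abs_mul _ _
      _ ≤ 1 * (|field G c v| + |signalSpin (X v)|) :=
          mul_le_mul h1 (abs_add_le _ _) (abs_nonneg _) zero_le_one
      _ ≤ Δ + 1 := by rw [hs]; linarith
  refine (Finset.sum_le_sum this).trans ?_
  simp [mul_comm]

/-- The number of steps before time `T` in which an announcement changes is linear in the number
of nodes, whatever the signals and the selections. -/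
lemma sum_changes_le (G : SimpleGraph V) (X : V → Bool) (s : ℕ → V) {Δ : ℕ}
    (hΔ : ∀ v, {u | G.Adj v u}.ncard ≤ Δ) (T : ℕ) :
    (∑ t ∈ Finset.range T, if s t ∈ unstable G X (announcement G X s t) then 1 else 0)
      ≤ (Δ + 1) * Fintype.card V := by
  have h : ∀ T, ((∑ t ∈ Finset.range T,
      if s t ∈ unstable G X (announcement G X s t) then 1 else 0 : ℕ) : ℤ)
      ≤ -energy G X (announcement G X s T) := by
    intro T
    induction T with
    | zero => simp [energy, announcement]
    | succ T ih =>
      rw [Finset.sum_range_succ]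
      have := energy_step_le G X (announcement G X s T) (s T)
      simp only [announcement] at ih ⊢
      push_cast at ih ⊢
      linarith
  exact_mod_cast (h T).trans (neg_energy_le G X _ hΔ)

/-- The process is eventually constant, and its final profile is stable as soon as every node is
selected infinitely often. -/
lemma exists_stable (G : SimpleGraph V) (X : V → Bool) (s : ℕ → V)
    (hs : ∀ v, ∀ a, ∃ t ≥ a, s t = v) (a : ℕ) :
    ∃ t ≥ a, IsStable G X (announcement G X s t) := by
  by_contra! hcon
  have hchange : ∀ t ≥ a, ∃ t' ≥ t, announcement G X s (t' + 1) ≠ announcement G X s t' := by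
    intro t ht
    by_contra! hc
    have hconst : ∀ k, announcement G X s (t + k) = announcement G X s t := by
      intro k
      induction k with
      | zero => rfl
      | succ k ih => rw [← add_assoc, hc (t + k) (by omega), ih]
    apply hcon t ht
    intro v
    obtain ⟨i, hi, hiv⟩ := hs v t
    have h1 := hc i hi
    obtain ⟨k, rfl⟩ := Nat.exists_eq_add_of_le hi
    simp only [announcement] at h1
    rwa [hconst, hiv] at h1
  -- If the process never came to rest, the number of changes would be unbounded.
  have hunb : ∀ m, ∃ T ≥ a, m ≤ ∑ t ∈ Finset.range T,
      if s t ∈ unstable G X (announcement G X s t) then 1 else 0 := by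
    intro m
    induction m with
    | zero => exact ⟨a, le_rfl, Nat.zero_le _⟩
    | succ m ih =>
      obtain ⟨T, hT, hm⟩ := ih
      obtain ⟨t', ht', hne⟩ := hchange T hT
      refine ⟨t' + 1, by omega, ?_⟩
      have hmem : s t' ∈ unstable G X (announcement G X s t') := by
        simp only [unstable, Finset.mem_filter, Finset.mem_univ, true_and]
        exact hne
      rw [Finset.sum_range_succ, if_pos hmem]
      have : ∑ t ∈ Finset.range T,
          (if s t ∈ unstable G X (announcement G X s t) then 1 else 0)
          ≤ ∑ t ∈ Finset.range t',
          (if s t ∈ unstable G X (announcement G X s t) then 1 else 0) :=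
        Finset.sum_le_sum_of_subset (Finset.range_mono ht')
      omega
  obtain ⟨T, -, hT⟩ := hunb ((Fintype.card V + 1) * Fintype.card V + 1)
  have := sum_changes_le G X s (Δ := Fintype.card V)
    (fun v => by rw [← Nat.card_eq_fintype_card]; exact Set.ncard_le_card _) T
  omega

end Dynamics

open ProbabilityTheory

/-! ### Monotone events under biased signals -/

/-- The weight of one bit which equals `true` with probability `p`. -/
noncomputable def bitWeight (p : ℝ) (b : Bool) : ℝ := if b then p else 1 - p

/-- The expectation of `f` for independent bits which equal `true` with probability `p`. -/
noncomputable def bitMean {ι : Type*} [Fintype ι] [DecidableEq ι] (p : ℝ) (f :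
    (ι → Bool) → ℝ) : ℝ :=
  ∑ x : ι → Bool, (∏ i, bitWeight p (x i)) * f x

lemma bitMean_succ (p : ℝ) {n : ℕ} (f : (Fin (n + 1) → Bool) → ℝ) :
    bitMean p f = p * bitMean p (fun y => f (Fin.cons true y))
      + (1 - p) * bitMean p (fun y => f (Fin.cons false y)) := by
  unfold bitMean
  rw [← Equiv.sum_comp (Fin.consEquiv fun _ : Fin (n + 1) => Bool)
    (fun x => (∏ i, bitWeight p (x i)) * f x), Fintype.sum_prod_type]
  simp [Fin.consEquiv, Fin.prod_univ_succ, bitWeight, Finset.mul_sum, mul_assoc]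

lemma bitMean_nonneg {ι : Type*} [Fintype ι] [DecidableEq ι] {p : ℝ} (hp0 : 0 ≤ p) (hp1 : p ≤ 1)
    {f : (ι → Bool) → ℝ} (hf : ∀ x, 0 ≤ f x) : 0 ≤ bitMean p f := by
  refine Finset.sum_nonneg fun x _ => mul_nonneg (Finset.prod_nonneg fun i _ => ?_) (hf x)
  unfold bitWeight
  split_ifs <;> linarith

lemma bitMean_one {ι : Type*} [Fintype ι] [DecidableEq ι] (p : ℝ) : bitMean p
    (fun _ : ι → Bool => 1) = 1 := by
  unfold bitMean
  simp only [mul_one]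
  have h := Finset.prod_univ_sum (fun _ : ι => (Finset.univ : Finset Bool))
    (fun _ b => bitWeight p b)
  rw [Fintype.piFinset_univ] at h
  rw [← h]
  simp [bitWeight]

lemma bitMean_mono {ι : Type*} [Fintype ι] [DecidableEq ι] {p : ℝ} (hp0 : 0 ≤ p) (hp1 : p ≤ 1)
    {f g : (ι → Bool) → ℝ} (h : ∀ x, f x ≤ g x) : bitMean p f ≤ bitMean p g := by
  have := bitMean_nonneg hp0 hp1 (f := fun x => g x - f x) (fun x => sub_nonneg.2 (h x))
  unfold bitMean at *
  simp only [mul_sub, Finset.sum_sub_distrib] at this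
  linarith

/-- For a monotone event, the odds at bias `p ≥ 1/2` are at least `p / (1 - p)` times the odds for
fair bits. The induction splits off the first bit; with `a` and `b` the fair
probabilities of the event given that this bit is `true` or `false`, it remains to compare two
explicit functions of `a ≥ b`. -/
lemma bitMean_ge_of_monotone {p : ℝ} (hp0 : 1 / 2 ≤ p) (hp1 : p < 1) {n : ℕ}
    {f : (Fin n → Bool) → ℝ} (hf : Monotone f) (h01 : ∀ x, f x = 0 ∨ f x = 1) :
    p * bitMean (1 / 2) f ≤ bitMean p f * ((1 - p) + (2 * p - 1) * bitMean (1 / 2) f) := by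
  induction n with
  | zero =>
    have : ∀ p, bitMean p f = f default := by
      intro p
      simp only [bitMean, Finset.univ_eq_empty, Finset.prod_empty, one_mul]
      exact Fintype.sum_subsingleton f default
    rw [this, this]
    rcases h01 default with h | h <;> rw [h] <;> linarith
  | succ n ih =>
    have h1 := ih (f := fun y => f (Fin.cons true y))
      (fun x y h => hf (Fin.cons_le_cons.2 ⟨le_rfl, h⟩)) (fun x => h01 _)
    have h0 := ih (f := fun y => f (Fin.cons false y))
      (fun x y h => hf (Fin.cons_le_cons.2 ⟨le_rfl, h⟩)) (fun x => h01 _)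
    have hba : bitMean (1 / 2) (fun y => f (Fin.cons false y))
        ≤ bitMean (1 / 2) (fun y => f (Fin.cons true y)) :=
      bitMean_mono (by norm_num) (by norm_num)
        (fun x => hf (Fin.cons_le_cons.2 ⟨Bool.false_le true, le_rfl⟩))
    have hb0 : 0 ≤ bitMean (1 / 2) (fun y => f (Fin.cons false y)) :=
      bitMean_nonneg (f := fun y => f (Fin.cons false y)) (by norm_num) (by norm_num)
        (fun x => by rcases h01 (Fin.cons false x) with h | h <;> simp [h])
    have ha1 : bitMean (1 / 2) (fun y => f (Fin.cons true y)) ≤ 1 := by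
      refine le_trans ?_ (bitMean_one (ι := Fin n) (1 / 2)).le
      exact bitMean_mono (f := fun y => f (Fin.cons true y)) (by norm_num) (by norm_num)
        (fun x => by rcases h01 (Fin.cons true x) with h | h <;> simp [h])
    rw [bitMean_succ p f, bitMean_succ (1 / 2) f]
    generalize bitMean (1 / 2) (fun y => f (Fin.cons false y)) = b at *
    generalize bitMean (1 / 2) (fun y => f (Fin.cons true y)) = a at *
    generalize bitMean p (fun y => f (Fin.cons false y)) = v at *
    generalize bitMean p (fun y => f (Fin.cons true y)) = u at *
    have hDa : 0 < (1 - p) + (2 * p - 1) * a := by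
      have : 0 ≤ (2 * p - 1) * a := mul_nonneg (by linarith) (by linarith)
      linarith
    have hDb : 0 < (1 - p) + (2 * p - 1) * b := by
      have : 0 ≤ (2 * p - 1) * b := mul_nonneg (by linarith) (by linarith)
      linarith
    have hu : p * a / ((1 - p) + (2 * p - 1) * a) ≤ u := (div_le_iff₀ hDa).2 h1
    have hv : p * b / ((1 - p) + (2 * p - 1) * b) ≤ v := (div_le_iff₀ hDb).2 h0
    have key : p * ((a + b) / 2) ≤ (p * (p * a / ((1 - p) + (2 * p - 1) * a))
        + (1 - p) * (p * b / ((1 - p) + (2 * p - 1) * b)))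
        * ((1 - p) + (2 * p - 1) * ((a + b) / 2)) := by
      rw [← sub_nonneg]
      have hDa' := hDa.ne'
      have hDb' := hDb.ne'
      -- The difference of the two sides is a product of nonnegative factors, as `b ≤ a ≤ 1`.
      have hid : (p * (p * a / ((1 - p) + (2 * p - 1) * a))
        + (1 - p) * (p * b / ((1 - p) + (2 * p - 1) * b)))
        * ((1 - p) + (2 * p - 1) * ((a + b) / 2)) - p * ((a + b) / 2)
        = p * ((1 - p) * (2 * p - 1) * (a - b) * ((1 - p) * (1 - a) + p * b)) / 2
          / (((1 - p) + (2 * p - 1) * a) * ((1 - p) + (2 * p - 1) * b)) := by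
        have hD : (1 - p) + (2 * p - 1) * ((a + b) / 2)
            = (((1 - p) + (2 * p - 1) * a) + ((1 - p) + (2 * p - 1) * b)) / 2 := by ring
        rw [hD]
        generalize hA : (1 - p) + (2 * p - 1) * a = A at *
        generalize hB : (1 - p) + (2 * p - 1) * b = B at *
        field_simp
        rw [← hA, ← hB]
        ring
      rw [hid]
      refine div_nonneg (div_nonneg (mul_nonneg (by linarith) (mul_nonneg (mul_nonneg (mul_nonneg
        (by linarith) (by linarith)) (by linarith)) (add_nonneg (mul_nonneg (by linarith)
        (by linarith)) (mul_nonneg (by linarith) hb0)))) (by norm_num)) (mul_pos hDa hDb).le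
    have hD : 0 ≤ (1 - p) + (2 * p - 1) * ((a + b) / 2) := by nlinarith
    calc p * (1 / 2 * a + (1 - 1 / 2) * b) = p * ((a + b) / 2) := by ring
      _ ≤ _ := key
      _ ≤ (p * u + (1 - p) * v) * ((1 - p) + (2 * p - 1) * ((a + b) / 2)) := by
          refine mul_le_mul_of_nonneg_right (add_le_add ?_ ?_) hD
          · exact mul_le_mul_of_nonneg_left hu (by linarith)
          · exact mul_le_mul_of_nonneg_left hv (by linarith)
      _ = _ := by ring

lemma bitMean_comp_equiv {ι κ : Type*} [Fintype ι] [DecidableEq ι] [Fintype κ] [DecidableEq κ]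
    (e : ι ≃ κ) (p : ℝ)
    (f : (ι → Bool) → ℝ) : bitMean p (fun x : κ → Bool => f (x ∘ e)) = bitMean p f := by
  unfold bitMean
  rw [← (e.arrowCongr (Equiv.refl Bool)).sum_comp]
  refine Finset.sum_congr rfl fun x _ => ?_
  congr 1
  · rw [← e.prod_comp]
    simp
  · refine congrArg f (funext fun i => ?_)
    simp

lemma bitMean_half_of_odd {ι : Type*} [Fintype ι] [DecidableEq ι] {f : (ι → Bool) → ℝ}
    (hodd : ∀ x, f (fun i => !x i) = 1 - f x) : bitMean (1 / 2) f = 1 / 2 := by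
  have hw : ∀ b, bitWeight (1 / 2) b = 1 / 2 := by
    intro b; cases b <;> norm_num [bitWeight]
  have h1 : bitMean (1 / 2) f = bitMean (1 / 2) (fun x => f (fun i => !x i)) := by
    unfold bitMean
    simp only [hw]
    let e : (ι → Bool) ≃ (ι → Bool) := Equiv.piCongrRight fun _ => Equiv.boolNot
    rw [← e.sum_comp]
    rfl
  have h2 : bitMean (1 / 2) (fun x => f (fun i => !x i)) = 1 - bitMean (1 / 2) f := by
    have h := bitMean_one (ι := ι) (1 / 2)
    simp only [hodd]
    simp only [bitMean, mul_sub, Finset.sum_sub_distrib] at h ⊢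
    rw [h]
  linarith

/-- A monotone event which holds for exactly one of each pair of opposite bit vectors is at least
as likely as a single bit being `true`. -/
lemma le_bitMean_of_monotone_of_odd {ι : Type*} [Fintype ι] [DecidableEq ι] {p : ℝ}
    (hp0 : 1 / 2 ≤ p) (hp1 : p < 1)
    {f : (ι → Bool) → ℝ} (hf : Monotone f) (h01 : ∀ x, f x = 0 ∨ f x = 1)
    (hodd : ∀ x, f (fun i => !x i) = 1 - f x) : p ≤ bitMean p f := by
  have e := Fintype.equivFin ι
  have h := bitMean_ge_of_monotone hp0 hp1 (f := fun x => f (x ∘ e))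
    (fun x y h => hf fun i => h (e i)) (fun x => h01 _)
  rw [bitMean_comp_equiv, bitMean_comp_equiv, bitMean_half_of_odd hodd] at h
  linarith

/-! ### The law of the signals -/

section Signals

open scoped Classical

variable {V : Type*} [Fintype V] {δ : ℝ}

/-- The joint law of all signals. -/
noncomputable def signalsLaw (V : Type*) [Fintype V] (δ : ℝ) : Measure (V → Bool) :=
  Measure.pi fun _ : V => signalLaw δ

lemma isProbabilityMeasure_signalLaw (h0 : 0 ≤ δ) (h1 : δ ≤ 1 / 2) :
    IsProbabilityMeasure (signalLaw δ) := by
  constructor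
  simp only [signalLaw, Measure.coe_add, Measure.coe_smul, Pi.add_apply, Pi.smul_apply,
    measure_univ, smul_eq_mul, mul_one]
  rw [← ENNReal.ofReal_add (by linarith) (by linarith)]
  norm_num

lemma isProbabilityMeasure_signalsLaw (h0 : 0 ≤ δ) (h1 : δ ≤ 1 / 2) :
    IsProbabilityMeasure (signalsLaw V δ) := by
  have := isProbabilityMeasure_signalLaw h0 h1
  unfold signalsLaw
  infer_instance

lemma signalLaw_real_singleton (h0 : 0 ≤ δ) (h1 : δ ≤ 1 / 2) (b : Bool) :
    (signalLaw δ).real {b} = bitWeight (1 / 2 + δ) b := by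
  cases b
  · simp [signalLaw, Measure.real, bitWeight]
    rw [ENNReal.toReal_ofReal (by linarith)]; ring
  · simp [signalLaw, Measure.real, bitWeight]
    try linarith

lemma integral_signalsLaw (h0 : 0 ≤ δ) (h1 : δ ≤ 1 / 2) (f : (V → Bool) → ℝ) :
    ∫ x, f x ∂(signalsLaw V δ) = bitMean (1 / 2 + δ) f := by
  have := isProbabilityMeasure_signalLaw h0 h1
  have := isProbabilityMeasure_signalsLaw (V := V) h0 h1
  rw [integral_fintype Integrable.of_finite]
  unfold bitMean
  refine Finset.sum_congr rfl fun x _ => ?_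
  rw [smul_eq_mul]
  congr 1
  rw [Measure.real, signalsLaw, Measure.pi_singleton, ENNReal.toReal_prod]
  exact Finset.prod_congr rfl fun i _ => signalLaw_real_singleton h0 h1 _

/-- Functions of disjoint sets of signals are independent. -/
lemma indepFun_of_dependsOn (h0 : 0 ≤ δ) (h1 : δ ≤ 1 / 2) {S T : Finset V} (hST : Disjoint S T)
    {f g : (V → Bool) → ℝ} (hf : DependsOn f (S : Set V)) (hg : DependsOn g (T : Set V)) :
    IndepFun f g (signalsLaw V δ) := by
  have := isProbabilityMeasure_signalLaw h0 h1
  have hi : iIndepFun (fun (i : V) (x : V → Bool) => x i) (signalsLaw V δ) :=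
    iIndepFun_pi (μ := fun _ : V => signalLaw δ) (X := fun _ b => b) fun _ => aemeasurable_id
  have hST' := hi.indepFun_finset S T hST fun i => measurable_pi_apply i
  obtain ⟨f', hf'⟩ := dependsOn_iff_exists_comp.1 hf
  obtain ⟨g', hg'⟩ := dependsOn_iff_exists_comp.1 hg
  rw [hf', hg']
  exact hST'.comp (φ := f') (ψ := g') (measurable_of_finite _) (measurable_of_finite _)

/-- The variance of a sum of indicators is at most the number of pairs of indicators which share a
signal. -/
lemma variance_sum_le (h0 : 0 ≤ δ) (h1 : δ ≤ 1 / 2) {ι : Type*} [Fintype ι]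
    (f : ι → (V → Bool) → ℝ) (B : ι → Finset V) (hdep : ∀ i, DependsOn (f i) (B i : Set V))
    (hf0 : ∀ i x, 0 ≤ f i x) (hf1 : ∀ i x, f i x ≤ 1) :
    Var[∑ i, f i; signalsLaw V δ] ≤ ∑ i, ∑ j, if Disjoint (B i) (B j) then (0 : ℝ) else 1 := by
  have := isProbabilityMeasure_signalsLaw (V := V) h0 h1
  have hm : ∀ i, MemLp (f i) 2 (signalsLaw V δ) := fun i => MemLp.of_bound
    (measurable_of_finite _).aestronglyMeasurable 1
    (Eventually.of_forall fun x => by rw [Real.norm_eq_abs, abs_of_nonneg (hf0 i x)]; exact hf1 i x)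
  rw [variance_sum hm]
  refine Finset.sum_le_sum fun i _ => Finset.sum_le_sum fun j _ => ?_
  split_ifs with hd
  · exact ((indepFun_of_dependsOn h0 h1 hd (hdep i) (hdep j)).covariance_eq_zero (hm i) (hm j)).le
  · rw [covariance_eq_sub (hm i) (hm j)]
    have hE : ∀ i, 0 ≤ ∫ x, f i x ∂(signalsLaw V δ) := fun i => integral_nonneg (hf0 i)
    have : ∫ x, (f i * f j) x ∂(signalsLaw V δ) ≤ ∫ _, (1 : ℝ) ∂(signalsLaw V δ) :=
      integral_mono Integrable.of_finite Integrable.of_finite fun x =>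
        mul_le_one₀ (hf1 i x) (hf0 j x) (hf1 j x)
    simp only [integral_const, probReal_univ, smul_eq_mul, mul_one] at this
    have := mul_nonneg (hE i) (hE j)
    linarith

/-- A one-sided Chebyshev inequality for functions of the signals. -/
lemma signalsLaw_real_le_of_variance (h0 : 0 ≤ δ) (h1 : δ ≤ 1 / 2) (F : (V → Bool) → ℝ)
    {m r : ℝ} (hr : 0 < r) (hm : m + r ≤ ∫ x, F x ∂(signalsLaw V δ)) :
    (signalsLaw V δ).real {x | F x ≤ m} ≤ Var[F; signalsLaw V δ] / r ^ 2 := by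
  have := isProbabilityMeasure_signalsLaw (V := V) h0 h1
  have hF : MemLp F 2 (signalsLaw V δ) := by
    obtain ⟨C, hC⟩ := Finite.exists_le fun x => ‖F x‖
    exact MemLp.of_bound (measurable_of_finite _).aestronglyMeasurable C (Eventually.of_forall hC)
  have h := meas_ge_le_variance_div_sq hF hr
  refine ENNReal.toReal_le_of_le_ofReal (div_nonneg (variance_nonneg _ _) (sq_nonneg _)) ?_
  refine (measure_mono fun x hx => ?_).trans h
  simp only [Set.mem_ofPred_eq] at hx ⊢
  rw [abs_sub_comm]
  exact le_trans (by linarith) (le_abs_self _)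

end Signals

open scoped Classical

/-! ### The law of the selections -/

section Selections

variable {V : Type*} [Fintype V] [MeasurableSpace V] [DiscreteMeasurableSpace V]

lemma measurable_of_dependsOn_range {β : Type*} [MeasurableSpace β] [Nonempty β] {T : ℕ} {f :
    (ℕ → V) → β}
    (hf : DependsOn f (Finset.range T : Set ℕ)) : Measurable f := by
  obtain ⟨g, rfl⟩ := dependsOn_iff_exists_comp.1 hf
  exact (measurable_of_finite g).comp (Set.measurable_restrict _)

variable [Nonempty V]

/-- The joint law of all selected nodes. -/
noncomputable def selectionsLaw (V : Type*) [Fintype V] [Nonempty V] [MeasurableSpace V] :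
    Measure (ℕ → V) :=
  Measure.infinitePi fun _ : ℕ => (PMF.uniformOfFintype V).toMeasure

instance : IsProbabilityMeasure (selectionsLaw V) := by
  unfold selectionsLaw
  infer_instance

lemma integrable_of_dependsOn_range {T : ℕ} {f : (ℕ → V) → ℝ}
    (hf : DependsOn f (Finset.range T : Set ℕ)) : Integrable f (selectionsLaw V) := by
  obtain ⟨g, rfl⟩ := dependsOn_iff_exists_comp.1 hf
  have hm : Measurable ((Finset.range T : Set ℕ).domRestrict : (ℕ → V) → _) :=
    Set.measurable_restrict _
  have := Measure.isProbabilityMeasure_map (μ := selectionsLaw V) hm.aemeasurable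
  exact Integrable.comp_measurable Integrable.of_finite hm

lemma uniform_real_apply (A : Set V) :
    (PMF.uniformOfFintype V).toMeasure.real A = A.ncard / Fintype.card V := by
  rw [Measure.real, PMF.toMeasure_uniformOfFintype_apply A
      (DiscreteMeasurableSpace.forall_measurableSet A),
    ENNReal.toReal_div]
  simp [Set.ncard_eq_toFinset_card', Set.toFinset_card]

/-- The node selected in step `t + 1` is uniform and independent of the earlier selections. -/
lemma integral_selection {t : ℕ} (F : (ℕ → V) → V → ℝ)
    (hF : ∀ v, DependsOn (fun s => F s v) (Finset.range t : Set ℕ)) :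
    ∫ s, F s (s t) ∂(selectionsLaw V)
      = ∫ s, (∑ v, F s v) / Fintype.card V ∂(selectionsLaw V) := by
  have hi : iIndepFun (fun (i : ℕ) (s : ℕ → V) => s i) (selectionsLaw V) :=
    iIndepFun_infinitePi (P := fun _ : ℕ => (PMF.uniformOfFintype V).toMeasure)
      (X := fun _ b => b) fun _ => measurable_id
  have hd : Disjoint (Finset.range t) {t} := by simp
  have hind := hi.indepFun_finset _ _ hd fun i => measurable_pi_apply i
  have hone : ∀ v, DependsOn (fun s : ℕ → V => if s t = v then (1 : ℝ) else 0)
      (({t} : Finset ℕ) : Set ℕ) := fun v s s' h => by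
    have : s t = s' t := h t (by simp)
    simp [this]
  have hone' : ∀ v, DependsOn (fun s : ℕ → V => if s t = v then (1 : ℝ) else 0)
      ((Finset.range (t + 1)) : Set ℕ) := fun v s s' h => by
    have : s t = s' t := h t (by simp)
    simp [this]
  have hFi : ∀ v, Integrable (fun s => F s v) (selectionsLaw V) := fun v =>
    integrable_of_dependsOn_range (hF v)
  have hmean : ∀ v, ∫ s, (if s t = v then (1 : ℝ) else 0) ∂(selectionsLaw V)
      = 1 / Fintype.card V := by
    intro v
    have h1 : (fun s : ℕ → V => if s t = v then (1 : ℝ) else 0)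
        = ((fun s : ℕ → V => s t) ⁻¹' {v}).indicator 1 := by
      ext s; simp [Set.indicator_apply]
    have hmp := measurePreserving_eval_infinitePi
      (fun _ : ℕ => (PMF.uniformOfFintype V).toMeasure) t
    rw [h1, integral_indicator_one ((measurable_pi_apply t) (measurableSet_singleton v)),
      Measure.real, selectionsLaw]
    have := hmp.measure_preimage (measurableSet_singleton v).nullMeasurableSet
    change (Measure.infinitePi _ _).toReal = _
    rw [this]
    simp
  have hprod : ∀ v, ∫ s, (if s t = v then (1 : ℝ) else 0) * F s v ∂(selectionsLaw V)
      = 1 / Fintype.card V * ∫ s, F s v ∂(selectionsLaw V) := by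
    intro v
    obtain ⟨f', hf'⟩ := dependsOn_iff_exists_comp.1 (hF v)
    obtain ⟨g', hg'⟩ := dependsOn_iff_exists_comp.1 (hone v)
    have hI : IndepFun (fun s : ℕ → V => if s t = v then (1 : ℝ) else 0) (fun s => F s v)
        (selectionsLaw V) := by
      rw [hf', hg']
      exact (hind.comp (φ := f') (ψ := g') (measurable_of_finite _) (measurable_of_finite _)).symm
    have := hI.integral_mul_eq_mul_integral
      (measurable_of_dependsOn_range (hone' v)).aestronglyMeasurable
      (measurable_of_dependsOn_range (hF v)).aestronglyMeasurable
    rw [hmean] at this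
    exact this
  have hsum : ∀ s, F s (s t) = ∑ v, (if s t = v then (1 : ℝ) else 0) * F s v := by
    intro s; simp
  simp only [hsum, Finset.sum_div]
  rw [integral_finsetSum, integral_finsetSum]
  · refine Finset.sum_congr rfl fun v _ => ?_
    rw [hprod, integral_div]
    ring
  · exact fun v _ => (hFi v).div_const _
  · refine fun v _ => integrable_of_dependsOn_range (T := t + 1) fun s s' h => ?_
    have h1 : s t = s' t := h t (by simp)
    have h2 : F s v = F s' v := hF v fun i hi => h i (by
      simp only [Finset.coe_range, Set.mem_Iio] at hi ⊢; omega)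
    simp [h1, h2]

/-- The probability that the steps in `I` avoid the set `A` of nodes. -/
lemma selectionsLaw_avoid (I : Finset ℕ) (A : Set V) :
    (selectionsLaw V).real {s | ∀ i ∈ I, s i ∉ A} = (1 - A.ncard / Fintype.card V) ^ I.card := by
  have h := Measure.infinitePi_pi (fun _ : ℕ => (PMF.uniformOfFintype V).toMeasure) (s := I)
    (t := fun _ => Aᶜ) fun _ _ => DiscreteMeasurableSpace.forall_measurableSet _
  have hset : {s : ℕ → V | ∀ i ∈ I, s i ∉ A} = (I : Set ℕ).pi fun _ => Aᶜ := by
    ext s; simp [Set.mem_pi]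
  rw [hset, Measure.real, selectionsLaw, h, Finset.prod_const, ENNReal.toReal_pow]
  congr 1
  have := probReal_compl_eq_one_sub (μ := (PMF.uniformOfFintype V).toMeasure)
    (DiscreteMeasurableSpace.forall_measurableSet A)
  rw [uniform_real_apply A] at this
  exact this

/-- Almost surely every node is selected infinitely often. -/
lemma ae_selected_infinitely_often :
    ∀ᵐ s ∂(selectionsLaw V), ∀ v, ∀ a, ∃ t ≥ a, s t = v := by
  rw [ae_all_iff]
  intro v
  rw [ae_all_iff]
  intro a
  rw [ae_iff]
  have hn : (0 : ℝ) < Fintype.card V := by exact_mod_cast Fintype.card_pos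
  have hn1 : (1 : ℝ) ≤ Fintype.card V := by exact_mod_cast Nat.succ_le_of_lt Fintype.card_pos
  have hle : ∀ m, (selectionsLaw V).real {s | ¬∃ t ≥ a, s t = v}
      ≤ (1 - 1 / Fintype.card V : ℝ) ^ m := by
    intro m
    have h := selectionsLaw_avoid (Finset.Ico a (a + m)) ({v} : Set V)
    simp only [Set.ncard_singleton, Nat.card_Ico, Nat.cast_one, Nat.add_sub_cancel_left] at h
    rw [← h]
    refine measureReal_mono fun s hs i hi hiv => hs ⟨i, (Finset.mem_Ico.1 hi).1, hiv⟩
  have h0 : 0 ≤ 1 - 1 / (Fintype.card V : ℝ) := by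
    rw [sub_nonneg, div_le_one hn]; exact hn1
  have h1 : 1 - 1 / (Fintype.card V : ℝ) < 1 := by
    have : 0 < 1 / (Fintype.card V : ℝ) := by positivity
    linarith
  have hlim := ge_of_tendsto' (tendsto_pow_atTop_nhds_zero_of_lt_one h0 h1) hle
  have := le_antisymm hlim measureReal_nonneg
  exact (measureReal_eq_zero_iff).1 this

end Selections

section ProcessLaw

variable {V : Type*} [Fintype V] [Nonempty V] [MeasurableSpace V] {δ : ℝ}

lemma isProbabilityMeasure_processLaw (h0 : 0 ≤ δ) (h1 : δ ≤ 1 / 2) :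
    IsProbabilityMeasure (processLaw V δ) := by
  have := isProbabilityMeasure_signalsLaw (V := V) h0 h1
  rw [processLaw, ← signalsLaw, ← selectionsLaw]
  infer_instance

variable [DiscreteMeasurableSpace V]

/-- The probability of an event which depends on the signals and on finitely many selections is
the mean over the selections of its conditional probability. -/
lemma processLaw_real_eq (h0 : 0 ≤ δ) (h1 : δ ≤ 1 / 2) {T : ℕ} {E : Set ((V → Bool) × (ℕ → V))}
    (hE : ∀ X, DependsOn (fun s => (X, s) ∈ E) (Finset.range T : Set ℕ)) :
    (processLaw V δ).real E = ∫ s, (signalsLaw V δ).real {X | (X, s) ∈ E} ∂(selectionsLaw V) := by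
  have := isProbabilityMeasure_signalsLaw (V := V) h0 h1
  have hE' : E = ⋃ X : V → Bool, {X} ×ˢ {s | (X, s) ∈ E} := by
    ext ⟨X, s⟩; simp
  have hmeas : MeasurableSet E := by
    rw [hE']
    refine MeasurableSet.iUnion fun X => (measurableSet_singleton X).prod ?_
    exact measurableSet_setOfPred.2 (measurable_of_dependsOn_range (hE X))
  rw [Measure.real, processLaw, ← signalsLaw, ← selectionsLaw, Measure.prod_apply_symm hmeas,
    ← integral_toReal]
  · rfl
  · exact (measurable_measure_prodMk_right hmeas).aemeasurable
  · exact Eventually.of_forall fun s => measure_lt_top _ _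

/-- A lower bound on the probability of an event which almost surely implies another one. -/
lemma processLaw_real_mono (h0 : 0 ≤ δ) (h1 : δ ≤ 1 / 2) {E F : Set ((V → Bool) × (ℕ → V))}
    (h : ∀ X s, (∀ v, ∀ a, ∃ t ≥ a, s t = v) → (X, s) ∈ E → (X, s) ∈ F) :
    (processLaw V δ).real E ≤ (processLaw V δ).real F := by
  have := isProbabilityMeasure_processLaw (V := V) h0 h1
  have := isProbabilityMeasure_signalsLaw (V := V) h0 h1
  refine ENNReal.toReal_mono (measure_ne_top _ _) (measure_mono_ae ?_)
  have : ∀ᵐ ω ∂(processLaw V δ), ∀ v, ∀ a, ∃ t ≥ a, ω.2 t = v := by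
    rw [processLaw, ← signalsLaw, ← selectionsLaw]
    exact Measure.quasiMeasurePreserving_snd.ae ae_selected_infinitely_often
  filter_upwards [this] with ω hω hE
  exact h ω.1 ω.2 hω hE

end ProcessLaw

/-! ### Locality and concentration -/

section Cone

variable {V : Type*}

/-- The nodes whose announcement after `t` steps can have been influenced by the signal of `u`,
when the selected nodes are given by `s`. -/
noncomputable def cone (G : SimpleGraph V) (s : ℕ → V) (u : V) : ℕ → Finset V
  | 0 => {u}
  | t + 1 => if ∃ w ∈ cone G s u t, G.Adj w (s t) then insert (s t) (cone G s u t)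
      else cone G s u t

lemma cone_subset_succ (G : SimpleGraph V) (s : ℕ → V) (u : V) (t : ℕ) :
    cone G s u t ⊆ cone G s u (t + 1) := by
  rw [cone]
  split_ifs
  · exact Finset.subset_insert _ _
  · exact Finset.Subset.refl _

lemma self_mem_cone (G : SimpleGraph V) (s : ℕ → V) (u : V) (t : ℕ) : u ∈ cone G s u t := by
  induction t with
  | zero => simp [cone]
  | succ t ih => exact cone_subset_succ G s u t ih

lemma cone_congr (G : SimpleGraph V) {s s' : ℕ → V} (u : V) {t : ℕ} (h : ∀ i < t, s i = s' i) :
    cone G s u t = cone G s' u t := by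
  induction t with
  | zero => rfl
  | succ t ih =>
    rw [cone, cone, ih fun i hi => h i (Nat.lt_succ_of_lt hi), h t (Nat.lt_succ_self t)]

variable [Fintype V]

lemma announcement_eq_of_cone (G : SimpleGraph V) {X X' : V → Bool} (s : ℕ → V) (t : ℕ) (v : V)
    (h : ∀ u, v ∈ cone G s u t → X u = X' u) :
    announcement G X s t v = announcement G X' s t v := by
  induction t generalizing v with
  | zero => rfl
  | succ t ih =>
    simp only [announcement]
    by_cases hv : v = s t
    · subst hv
      rw [step_self, step_self]
      congr 1
      refine newAnnouncement_congr G _ (h _ (self_mem_cone G s _ _)) fun w hw => ih w fun u hu => ?_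
      refine h u ?_
      rw [cone, if_pos ⟨w, hu, hw.symm⟩]
      exact Finset.mem_insert_self _ _
    · rw [step_of_ne _ _ _ hv, step_of_ne _ _ _ hv]
      exact ih v fun u hu => h u (cone_subset_succ G s u t hu)

lemma card_nbrs_le (G : SimpleGraph V) {Δ : ℕ} (hΔ : ∀ v, {u | G.Adj v u}.ncard ≤ Δ)
    (A : Finset V) : (Finset.univ.filter fun v => ∃ w ∈ A, G.Adj w v).card ≤ A.card * Δ := by
  have : (Finset.univ.filter fun v => ∃ w ∈ A, G.Adj w v)
      ⊆ A.biUnion fun w => Finset.univ.filter fun v => G.Adj w v := by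
    intro v hv
    simpa using hv
  refine (Finset.card_le_card this).trans (Finset.card_biUnion_le_card_mul _ _ _ fun w _ => ?_)
  refine le_trans (le_of_eq ?_) (hΔ w)
  rw [Set.ncard_eq_toFinset_card']
  congr 1
  ext; simp

variable [Nonempty V] [MeasurableSpace V] [DiscreteMeasurableSpace V]

/-- In a graph of bounded degree, after a number of steps linear in the number of nodes, the mean
square of the number of nodes influenced by one signal is bounded. -/
lemma integral_card_cone_sq_le (G : SimpleGraph V) {Δ : ℕ} (hΔ : ∀ v, {u | G.Adj v u}.ncard ≤ Δ)
    (u : V) (t : ℕ) : ∫ s, ((cone G s u t).card : ℝ) ^ 2 ∂(selectionsLaw V)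
      ≤ (1 + 3 * Δ / Fintype.card V) ^ t := by
  have hn : (0 : ℝ) < Fintype.card V := by exact_mod_cast Fintype.card_pos
  induction t with
  | zero => simp [cone]
  | succ t ih =>
    -- When a node is added, the square of the size `c` grows by `2 * c + 1 ≤ 3 * c`, and at most
    -- `Δ * c` of the nodes are adjacent to the cone.
    let F : (ℕ → V) → V → ℝ := fun s v => ((cone G s u t).card : ℝ) ^ 2
      + if ∃ w ∈ cone G s u t, G.Adj w v then 3 * ((cone G s u t).card : ℝ) else 0
    have hdep : DependsOn (fun s => ((cone G s u t).card : ℝ) ^ 2)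
        (Finset.range t : Set ℕ) := fun s s' h => by
      simp only [cone_congr G u fun i hi => h i (by simpa using hi)]
    have hF : ∀ v, DependsOn (fun s => F s v) (Finset.range t : Set ℕ) := fun v s s' h => by
      simp only [F, cone_congr G u fun i hi => h i (by simpa using hi)]
    have hF' : DependsOn (fun s => F s (s t)) (Finset.range (t + 1) : Set ℕ) := fun s s' h => by
      have h1 : s t = s' t := h t (by simp)
      simp only [F, h1, cone_congr G (t := t) u fun i hi => h i (by simp; omega)]
    have hF2 : DependsOn (fun s => (∑ v, F s v) / Fintype.card V) (Finset.range t : Set ℕ) :=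
      fun s s' h => by
        have : ∀ v, F s v = F s' v := fun v => hF v h
        simp only [this]
    have hle : ∀ s, ((cone G s u (t + 1)).card : ℝ) ^ 2 ≤ F s (s t) := by
      intro s
      simp only [F]
      rw [cone]
      have h1 : (1 : ℝ) ≤ (cone G s u t).card := by
        exact_mod_cast Finset.card_pos.2 ⟨u, self_mem_cone G s u t⟩
      split_ifs with h
      · have : ((insert (s t) (cone G s u t)).card : ℝ) ≤ (cone G s u t).card + 1 := by
          exact_mod_cast Finset.card_insert_le _ _
        nlinarith
      · simp
    have hsum : ∀ s, (∑ v, F s v) / Fintype.card V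
        ≤ (1 + 3 * Δ / Fintype.card V) * ((cone G s u t).card : ℝ) ^ 2 := by
      intro s
      have hc : ((Finset.univ.filter fun v => ∃ w ∈ cone G s u t, G.Adj w v).card : ℝ)
          ≤ (cone G s u t).card * Δ := by exact_mod_cast card_nbrs_le G hΔ _
      have : ∑ v, F s v ≤ Fintype.card V * ((cone G s u t).card : ℝ) ^ 2
          + 3 * Δ * ((cone G s u t).card : ℝ) ^ 2 := by
        simp only [F, Finset.sum_add_distrib, Finset.sum_const, Finset.card_univ, nsmul_eq_mul,
          ← Finset.sum_filter]
        have h0 : (0 : ℝ) ≤ (cone G s u t).card := Nat.cast_nonneg _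
        nlinarith
      rw [div_le_iff₀ hn]
      calc _ ≤ _ := this
        _ = _ := by field_simp
    calc ∫ s, ((cone G s u (t + 1)).card : ℝ) ^ 2 ∂(selectionsLaw V)
        ≤ ∫ s, F s (s t) ∂(selectionsLaw V) := by
          refine integral_mono (integrable_of_dependsOn_range (T := t + 1) fun s s' h => ?_)
            (integrable_of_dependsOn_range hF') hle
          simp only [cone_congr G (t := t + 1) u fun i hi => h i (by simp; omega)]
      _ = ∫ s, (∑ v, F s v) / Fintype.card V ∂(selectionsLaw V) := integral_selection F hF
      _ ≤ ∫ s, (1 + 3 * Δ / Fintype.card V) * ((cone G s u t).card : ℝ) ^ 2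
            ∂(selectionsLaw V) :=
          integral_mono (integrable_of_dependsOn_range hF2)
            ((integrable_of_dependsOn_range hdep).const_mul _) hsum
      _ ≤ _ := by
          rw [integral_const_mul, pow_succ']
          exact mul_le_mul_of_nonneg_left ih (by positivity)

end Cone

section Core

variable {V : Type*} [Fintype V]

/-- The number of nodes announcing Correct. -/
noncomputable def numCorrect (c : Profile V) : ℕ :=
  (Finset.univ.filter fun v => c v = some true).card

lemma numCorrect_eq_sum (c : Profile V) :
    (numCorrect c : ℝ) = ∑ v, if c v = some true then (1 : ℝ) else 0 := by
  simp [numCorrect]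

/-- The indicator that `v` announces Correct after `t` steps. -/
noncomputable def correctInd (G : SimpleGraph V) (s : ℕ → V) (t : ℕ) (v : V) (X : V → Bool) : ℝ :=
  if announcement G X s t v = some true then 1 else 0

variable {δ : ℝ}

lemma sum_not_disjoint_le (G : SimpleGraph V) (s : ℕ → V) (t : ℕ) :
    (∑ v, ∑ w, if Disjoint (Finset.univ.filter fun u => v ∈ cone G s u t)
      (Finset.univ.filter fun u => w ∈ cone G s u t) then (0 : ℝ) else 1)
      ≤ ∑ u, ((cone G s u t).card : ℝ) ^ 2 := by
  have h : ∀ u, ((cone G s u t).card : ℝ) ^ 2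
      = ∑ v, ∑ w, if v ∈ cone G s u t ∧ w ∈ cone G s u t then (1 : ℝ) else 0 := by
    intro u
    have : ((cone G s u t).card : ℝ) = ∑ v, if v ∈ cone G s u t then (1 : ℝ) else 0 := by simp
    rw [sq, this, Finset.sum_mul_sum]
    refine Finset.sum_congr rfl fun v _ => Finset.sum_congr rfl fun w _ => ?_
    by_cases hv : v ∈ cone G s u t <;> by_cases hw : w ∈ cone G s u t <;> simp [hv, hw]
  have hcomm : ∑ u, ((cone G s u t).card : ℝ) ^ 2 = ∑ v, ∑ w, ∑ u,
      if v ∈ cone G s u t ∧ w ∈ cone G s u t then (1 : ℝ) else 0 := by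
    simp only [h]
    rw [Finset.sum_comm]
    exact Finset.sum_congr rfl fun v _ => Finset.sum_comm
  rw [hcomm]
  refine Finset.sum_le_sum fun v _ => Finset.sum_le_sum fun w _ => ?_
  split_ifs with hd
  · exact Finset.sum_nonneg fun u _ => by split_ifs <;> simp
  · rw [Finset.not_disjoint_iff] at hd
    obtain ⟨u, hu, hu'⟩ := hd
    simp only [Finset.mem_filter, Finset.mem_univ, true_and] at hu hu'
    refine le_trans (le_of_eq ?_) (Finset.single_le_sum
      (fun u _ => by split_ifs <;> simp) (Finset.mem_univ u))
    simp [hu, hu']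

/-- Given the selections, every node that has announced is Correct at least as likely as a single
signal. -/
lemma le_integral_correctInd (h0 : 0 ≤ δ) (h1 : δ < 1 / 2) (G : SimpleGraph V) (s : ℕ → V) (t : ℕ)
    (v : V) (hv : ∃ i < t, s i = v) :
    1 / 2 + δ ≤ ∫ X, correctInd G s t v X ∂(signalsLaw V δ) := by
  rw [integral_signalsLaw h0 h1.le]
  refine le_bitMean_of_monotone_of_odd (by linarith) (by linarith) ?_ ?_ ?_
  · intro X X' h
    have := announcement_mono G h s t v
    simp only [correctInd]
    split_ifs with h2 h3 h3
    · exact le_rfl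
    · rw [h2] at this
      exact absurd (eq_some_true_of_one_le (by simpa using this)) h3
    · simp
    · exact le_rfl
  · intro X
    simp only [correctInd]
    split_ifs <;> simp
  · intro X
    simp only [correctInd]
    rw [announcement_not]
    have hne : announcement G X s t v ≠ none := by
      rw [Ne, announcement_eq_none_iff]
      push Not
      exact hv
    rcases hc : announcement G X s t v with _ | _ | _
    · exact absurd hc hne
    · simp
    · simp

lemma variance_numCorrect_le (h0 : 0 ≤ δ) (h1 : δ ≤ 1 / 2) (G : SimpleGraph V) (s : ℕ → V)
    (t : ℕ) : Var[∑ v, correctInd G s t v; signalsLaw V δ]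
      ≤ ∑ u, ((cone G s u t).card : ℝ) ^ 2 := by
  refine (variance_sum_le h0 h1 (correctInd G s t)
    (fun v => Finset.univ.filter fun u => v ∈ cone G s u t) ?_ ?_ ?_).trans
    (sum_not_disjoint_le G s t)
  · intro v X X' h
    have := announcement_eq_of_cone G s t v fun u hu => h u (by simpa using hu)
    simp only [correctInd, this]
  · intro v X; simp only [correctInd]; split_ifs <;> simp
  · intro v X; simp only [correctInd]; split_ifs <;> simp

lemma card_not_selected_le_unstable (G : SimpleGraph V) (X : V → Bool) (s : ℕ → V) (t : ℕ) :
    (Finset.univ.filter fun v => ¬∃ i < t, s i = v).card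
      ≤ (unstable G X (announcement G X s t)).card := by
  refine Finset.card_le_card fun v hv => ?_
  simp only [unstable, Finset.mem_filter, Finset.mem_univ, true_and] at hv ⊢
  rw [Ne, step_eq_iff]
  have : announcement G X s t v = none := by
    rw [announcement_eq_none_iff]
    push Not at hv
    exact hv
  rw [this]
  simp

variable [Nonempty V] [MeasurableSpace V] [DiscreteMeasurableSpace V]

/-- The probability that the next selected node changes its announcement is the fraction of
unstable nodes. Hence the expected number of unstable nodes is small at some time. -/
lemma exists_time_few_unstable (h0 : 0 ≤ δ) (h1 : δ ≤ 1 / 2) (G : SimpleGraph V) {Δ : ℕ}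
    (hΔ : ∀ v, {u | G.Adj v u}.ncard ≤ Δ) {m : ℕ} (hm : 0 < m) :
    ∃ t < m * Fintype.card V,
      ∫ s, ∫ X, ((unstable G X (announcement G X s t)).card : ℝ) ∂(signalsLaw V δ)
        ∂(selectionsLaw V) ≤ (Δ + 1) * Fintype.card V / m := by
  have := isProbabilityMeasure_signalsLaw (V := V) h0 h1
  have hn : (0 : ℝ) < Fintype.card V := by exact_mod_cast Fintype.card_pos
  have hm' : (0 : ℝ) < m := by exact_mod_cast hm
  have hdep : ∀ X t, DependsOn (fun s => ((unstable G X (announcement G X s t)).card : ℝ))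
      (Finset.range t : Set ℕ) := fun X t s s' h => by
    simp only [announcement_congr G X fun i hi => h i (by simpa using hi)]
  have hdep' : ∀ X t v, DependsOn
      (fun s => if v ∈ unstable G X (announcement G X s t) then (1 : ℝ) else 0)
      (Finset.range t : Set ℕ) := fun X t v s s' h => by
    simp only [announcement_congr G X fun i hi => h i (by simpa using hi)]
  have hdep2 : ∀ X t, DependsOn
      (fun s : ℕ → V => if s t ∈ unstable G X (announcement G X s t) then (1 : ℝ) else 0)
      (Finset.range (t + 1) : Set ℕ) := fun X t s s' h => by
    have h1 : s t = s' t := h t (by simp)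
    simp only [h1, announcement_congr G X (t := t) fun i hi => h i (by simp; omega)]
  have hX : ∀ X, ∑ t ∈ Finset.range (m * Fintype.card V),
      ∫ s, ((unstable G X (announcement G X s t)).card : ℝ) ∂(selectionsLaw V)
      ≤ (Δ + 1) * (Fintype.card V : ℝ) ^ 2 := by
    intro X
    have hstep : ∀ t, ∫ s, ((unstable G X (announcement G X s t)).card : ℝ) ∂(selectionsLaw V)
        = Fintype.card V * ∫ s, (if s t ∈ unstable G X (announcement G X s t) then (1 : ℝ) else 0)
          ∂(selectionsLaw V) := by
      intro t
      rw [integral_selection (fun s v => if v ∈ unstable G X (announcement G X s t)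
        then (1 : ℝ) else 0) (hdep' X t), integral_div, mul_div_cancel₀ _ hn.ne']
      simp
    simp only [hstep, ← Finset.mul_sum]
    rw [← integral_finsetSum _ fun t _ => integrable_of_dependsOn_range (hdep2 X t), sq,
      show (Δ + 1 : ℝ) * (Fintype.card V * Fintype.card V)
        = Fintype.card V * ((Δ + 1) * Fintype.card V) by ring]
    refine mul_le_mul_of_nonneg_left ?_ hn.le
    have : ∀ s : ℕ → V, (∑ t ∈ Finset.range (m * Fintype.card V),
        if s t ∈ unstable G X (announcement G X s t) then (1 : ℝ) else 0)
        ≤ (Δ + 1) * Fintype.card V := by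
      intro s
      exact_mod_cast sum_changes_le G X s hΔ (m * Fintype.card V)
    calc _ ≤ ∫ _, ((Δ + 1) * Fintype.card V : ℝ) ∂(selectionsLaw V) :=
          integral_mono (integrable_finsetSum _ fun t _ => integrable_of_dependsOn_range (hdep2 X
              t))
            (integrable_const _) this
      _ = _ := by simp
  by_contra! hcon
  have hsum : ∑ t ∈ Finset.range (m * Fintype.card V),
      ∫ s, ∫ X, ((unstable G X (announcement G X s t)).card : ℝ) ∂(signalsLaw V δ)
        ∂(selectionsLaw V) ≤ (Δ + 1) * (Fintype.card V : ℝ) ^ 2 := by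
    have hswap : ∀ t, ∫ s, ∫ X, ((unstable G X (announcement G X s t)).card : ℝ)
        ∂(signalsLaw V δ) ∂(selectionsLaw V)
        = ∫ X, ∫ s, ((unstable G X (announcement G X s t)).card : ℝ) ∂(selectionsLaw V)
          ∂(signalsLaw V δ) := by
      intro t
      simp only [integral_fintype Integrable.of_finite]
      rw [integral_finsetSum]
      · simp only [smul_eq_mul, integral_const_mul]
      · exact fun X _ => (integrable_of_dependsOn_range (hdep X t)).const_mul _
    simp only [hswap]
    rw [← integral_finsetSum _ fun t _ => Integrable.of_finite]
    calc _ ≤ ∫ _, ((Δ + 1) * (Fintype.card V : ℝ) ^ 2) ∂(signalsLaw V δ) :=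
          integral_mono Integrable.of_finite Integrable.of_finite hX
      _ = _ := by simp
  have hlt : ∑ t ∈ Finset.range (m * Fintype.card V), (Δ + 1) * (Fintype.card V : ℝ) / m
      < ∑ t ∈ Finset.range (m * Fintype.card V),
      ∫ s, ∫ X, ((unstable G X (announcement G X s t)).card : ℝ) ∂(signalsLaw V δ)
        ∂(selectionsLaw V) :=
    Finset.sum_lt_sum_of_nonempty
      (Finset.nonempty_range_iff.2 (Nat.mul_pos hm Fintype.card_pos).ne')
      fun t ht => hcon t (Finset.mem_range.1 ht)
  have : ∑ t ∈ Finset.range (m * Fintype.card V), (Δ + 1) * (Fintype.card V : ℝ) / m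
      = (Δ + 1) * (Fintype.card V : ℝ) ^ 2 := by
    simp only [Finset.sum_const, Finset.card_range, nsmul_eq_mul]
    push_cast
    field_simp
  linarith

/-- In graphs of bounded degree, there is a time at which, with high probability, nearly all nodes
would not change their announcement if selected, and the proportion of nodes announcing Correct is
nearly as large as the probability of a Correct signal. -/
theorem exists_time_nearly_stable (h0 : 0 ≤ δ) (h1 : δ < 1 / 2) (Δ : ℕ) {ε η : ℝ} (hε : 0 < ε)
    (hη : 0 < η) : ∃ n₀ : ℕ, ∀ (V : Type*) [Fintype V] [Nonempty V] [MeasurableSpace V]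
      [DiscreteMeasurableSpace V] (G : SimpleGraph V), (∀ v, {u | G.Adj v u}.ncard ≤ Δ) →
      n₀ ≤ Fintype.card V → ∃ t, (processLaw V δ).real {ω |
        (numCorrect (announcement G ω.1 ω.2 t) : ℝ) ≤ (1 / 2 + δ - 2 * η) * Fintype.card V ∨
        η * Fintype.card V ≤ (unstable G ω.1 (announcement G ω.1 ω.2 t)).card} ≤ ε := by
  -- With `m` this large, the mean number of unstable nodes at some time before `m * card V` is at
  -- most `ε * η / 2 * card V`; `n₀` makes the variance of the number of Correct nodes negligible.
  obtain ⟨m, hm⟩ := exists_nat_gt ((Δ + 1) * 2 / (ε * η))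
  have hm0 : (0 : ℝ) < m := lt_trans (by positivity) hm
  obtain ⟨n₀, hn₀⟩ := exists_nat_gt (Real.exp (3 * Δ * m) * 2 / (ε * η ^ 2))
  refine ⟨n₀, fun V _ _ _ _ G hΔ hV => ?_⟩
  have := isProbabilityMeasure_signalsLaw (V := V) h0 h1.le
  have hn : (0 : ℝ) < Fintype.card V := by exact_mod_cast Fintype.card_pos
  obtain ⟨t, ht, hU⟩ := exists_time_few_unstable h0 h1.le G hΔ (m := m) (by exact_mod_cast hm0)
  refine ⟨t, ?_⟩
  have hcongr : ∀ X (s s' : ℕ → V), (∀ i ∈ (Finset.range t : Set ℕ), s i = s' i) →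
      announcement G X s t = announcement G X s' t := fun X s s' h =>
    announcement_congr G X fun i hi => h i (by simpa using hi)
  have hcongr' : ∀ u (s s' : ℕ → V), (∀ i ∈ (Finset.range t : Set ℕ), s i = s' i) →
      cone G s u t = cone G s' u t := fun u s s' h =>
    cone_congr G u fun i hi => h i (by simpa using hi)
  rw [processLaw_real_eq h0 h1.le (T := t) fun X s s' h => by
    simp only [Set.mem_ofPred_eq, hcongr X s s' h]]
  have hcond : ∀ s : ℕ → V, (signalsLaw V δ).real {X |
      (numCorrect (announcement G X s t) : ℝ) ≤ (1 / 2 + δ - 2 * η) * Fintype.card V ∨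
        η * Fintype.card V ≤ (unstable G X (announcement G X s t)).card}
      ≤ (∑ u, ((cone G s u t).card : ℝ) ^ 2) / (η * Fintype.card V) ^ 2
        + (∫ X, ((unstable G X (announcement G X s t)).card : ℝ) ∂(signalsLaw V δ))
          / (η * Fintype.card V) := by
    intro s
    have hsub : {X | (numCorrect (announcement G X s t) : ℝ)
          ≤ (1 / 2 + δ - 2 * η) * Fintype.card V ∨
        η * Fintype.card V ≤ (unstable G X (announcement G X s t)).card}
        ⊆ {X | (∑ v, correctInd G s t v) X ≤ (∫ X, (∑ v, correctInd G s t v) X ∂(signalsLaw V δ))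
            - η * Fintype.card V}
          ∪ {X | η * Fintype.card V ≤ ((unstable G X (announcement G X s t)).card : ℝ)} := by
      intro X hX
      simp only [Set.mem_union, Set.mem_ofPred_eq] at hX ⊢
      by_cases hlt : η * Fintype.card V ≤ ((unstable G X (announcement G X s t)).card : ℝ)
      · exact Or.inr hlt
      · left
        have hN := hX.resolve_right hlt
        push Not at hlt
        simp only [Finset.sum_apply]
        rw [integral_finsetSum _ fun v _ => Integrable.of_finite]
        -- Nodes without an announcement are unstable, hence few; the others obey the bias bound.
        have hsel : ((Finset.univ.filter fun v => ¬∃ i < t, s i = v).card : ℝ)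
            ≤ η * Fintype.card V :=
          le_trans (by exact_mod_cast card_not_selected_le_unstable G X s t) hlt.le
        have hcard : ((Finset.univ.filter fun v => ∃ i < t, s i = v).card : ℝ)
            + (Finset.univ.filter fun v => ¬∃ i < t, s i = v).card = Fintype.card V := by
          exact_mod_cast Finset.card_filter_add_card_filter_not (s := Finset.univ)
            (fun v => ∃ i < t, s i = v)
        have hmean : (1 / 2 + δ) * ((Finset.univ.filter fun v => ∃ i < t, s i = v).card : ℝ)
            ≤ ∑ v, ∫ X, correctInd G s t v X ∂(signalsLaw V δ) := by
          calc _ = ∑ v ∈ Finset.univ.filter fun v => ∃ i < t, s i = v, (1 / 2 + δ) := by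
                rw [Finset.sum_const, nsmul_eq_mul, mul_comm]
            _ ≤ ∑ v ∈ Finset.univ.filter fun v => ∃ i < t, s i = v,
                ∫ X, correctInd G s t v X ∂(signalsLaw V δ) :=
              Finset.sum_le_sum fun v hv =>
                le_integral_correctInd h0 h1 G s t v (Finset.mem_filter.1 hv).2
            _ ≤ _ := Finset.sum_le_sum_of_subset_of_nonneg (Finset.filter_subset _ _)
                fun v _ _ => integral_nonneg fun X => by
                  simp only [correctInd]; split_ifs <;> simp
        have hXs : ∑ v, correctInd G s t v X = numCorrect (announcement G X s t) := by
          rw [numCorrect_eq_sum]; rfl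
        rw [hXs]
        nlinarith
    refine (measureReal_mono hsub).trans ((measureReal_union_le _ _).trans (add_le_add ?_ ?_))
    · refine (signalsLaw_real_le_of_variance h0 h1.le _ (mul_pos hη hn)
        (by rw [sub_add_cancel])).trans ?_
      gcongr
      exact variance_numCorrect_le h0 h1.le G s t
    · rw [le_div_iff₀ (mul_pos hη hn), mul_comm]
      exact mul_meas_ge_le_integral_of_nonneg
        (Eventually.of_forall fun X => Nat.cast_nonneg _) Integrable.of_finite _
  have hI1 : Integrable (fun s : ℕ → V => (∑ u, ((cone G s u t).card : ℝ) ^ 2)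
      / (η * Fintype.card V) ^ 2) (selectionsLaw V) :=
    integrable_of_dependsOn_range (T := t) fun s s' h => by simp only [hcongr' _ s s' h]
  have hI2 : Integrable (fun s : ℕ → V =>
      (∫ X, ((unstable G X (announcement G X s t)).card : ℝ) ∂(signalsLaw V δ))
          / (η * Fintype.card V)) (selectionsLaw V) :=
    integrable_of_dependsOn_range (T := t) fun s s' h => by simp only [hcongr _ s s' h]
  have hI0 : Integrable (fun s : ℕ → V => (signalsLaw V δ).real {X |
      (numCorrect (announcement G X s t) : ℝ) ≤ (1 / 2 + δ - 2 * η) * Fintype.card V ∨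
        η * Fintype.card V ≤ (unstable G X (announcement G X s t)).card}) (selectionsLaw V) :=
    integrable_of_dependsOn_range (T := t) fun s s' h => by simp only [hcongr _ s s' h]
  have hA : ∫ s, (∑ u, ((cone G s u t).card : ℝ) ^ 2) / (η * Fintype.card V) ^ 2
      ∂(selectionsLaw V) ≤ ε / 2 := by
    have hpow : (1 + 3 * Δ / Fintype.card V : ℝ) ^ t ≤ Real.exp (3 * Δ * m) := by
      calc (1 + 3 * Δ / Fintype.card V : ℝ) ^ t
          ≤ (1 + 3 * Δ / Fintype.card V : ℝ) ^ (m * Fintype.card V) :=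
            pow_le_pow_right₀ (by rw [le_add_iff_nonneg_right]; positivity) ht.le
        _ ≤ Real.exp (3 * Δ / Fintype.card V) ^ (m * Fintype.card V) := by
            gcongr
            rw [add_comm]
            exact Real.add_one_le_exp _
        _ = Real.exp (3 * Δ * m) := by
            rw [← Real.exp_nat_mul]
            congr 1
            push_cast
            field_simp
    rw [integral_div, integral_finsetSum _ fun u _ =>
      integrable_of_dependsOn_range (T := t) fun s s' h => by simp only [hcongr' _ s s' h]]
    have hsum : ∑ u, ∫ s, ((cone G s u t).card : ℝ) ^ 2 ∂(selectionsLaw V)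
        ≤ Fintype.card V * Real.exp (3 * Δ * m) := by
      calc _ ≤ ∑ _u : V, Real.exp (3 * Δ * m) :=
            Finset.sum_le_sum fun u _ => (integral_card_cone_sq_le G hΔ u t).trans hpow
        _ = _ := by simp
    rw [div_le_iff₀ (by positivity)]
    refine hsum.trans ?_
    have hV' : Real.exp (3 * Δ * m) * 2 / (ε * η ^ 2) ≤ Fintype.card V :=
      hn₀.le.trans (by exact_mod_cast hV)
    rw [div_le_iff₀ (by positivity)] at hV'
    nlinarith
  have hB : ∫ s, (∫ X, ((unstable G X (announcement G X s t)).card : ℝ) ∂(signalsLaw V δ))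
      / (η * Fintype.card V) ∂(selectionsLaw V) ≤ ε / 2 := by
    rw [integral_div, div_le_iff₀ (by positivity)]
    refine hU.trans ?_
    rw [div_le_iff₀ hm0]
    rw [div_lt_iff₀ (by positivity)] at hm
    nlinarith
  calc _ ≤ ∫ s, ((∑ u, ((cone G s u t).card : ℝ) ^ 2) / (η * Fintype.card V) ^ 2
        + (∫ X, ((unstable G X (announcement G X s t)).card : ℝ) ∂(signalsLaw V δ))
          / (η * Fintype.card V)) ∂(selectionsLaw V) := integral_mono hI0 (hI1.add hI2) hcond
    _ ≤ ε := by
      rw [integral_add hI1 hI2]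
      linarith

end Core

/-! ### Persistent sets -/

section Persistent

variable {V : Type*}

/-- The nodes of `P` would not lower their announcement below the one in the profile `c`, as long
as no node of `P` has done so: whatever the rest of the graph does, `P` protects itself. -/
def IsPersistent (G : SimpleGraph V) (X : V → Bool) (c : Profile V) (P : Set V) : Prop :=
  ∀ v ∈ P, ∀ c' : Profile V, (∀ u ∈ P, spin (c u) ≤ spin (c' u)) →
    spin (c v) ≤ spin (some (newAnnouncement G X c' v))

lemma IsPersistent.le_announcement {G : SimpleGraph V} {X : V → Bool} {s : ℕ → V} {t : ℕ}
    {P : Set V} (hP : IsPersistent G X (announcement G X s t) P) {t' : ℕ} (ht : t ≤ t') :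
    ∀ v ∈ P, spin (announcement G X s t v) ≤ spin (announcement G X s t' v) := by
  induction t', ht using Nat.le_induction with
  | base => exact fun v _ => le_rfl
  | succ t' _ ih =>
    intro v hv
    rw [announcement]
    by_cases hvs : v = s t'
    · subst hvs
      rw [step_self]
      exact hP _ hv _ ih
    · rw [step_of_ne _ _ _ hvs]
      exact ih v hv

variable [Fintype V]

lemma numCorrect_eq_ncard (c : Profile V) : numCorrect c = {v : V | c v = some true}.ncard := by
  rw [Set.ncard_eq_toFinset_card', numCorrect]
  congr 1
  ext v; simp

/-- A large majority at some time which is mostly held by a persistent set ends in a correct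
majority. -/
lemma IsPersistent.stabilizesInCorrectMajority {G : SimpleGraph V} {X : V → Bool} {s : ℕ → V}
    {t : ℕ} {P : Set V} (hP : IsPersistent G X (announcement G X s t) P)
    (hs : ∀ v, ∀ a, ∃ t ≥ a, s t = v)
    (hcard : Fintype.card V + 2 * Pᶜ.ncard < 2 * numCorrect (announcement G X s t)) :
    StabilizesInCorrectMajority G X s := by
  obtain ⟨t', ht', hstab⟩ := exists_stable G X s hs t
  refine ⟨t', hstab, ?_⟩
  rw [IsCorrectMajority, ← numCorrect_eq_ncard, Nat.card_eq_fintype_card]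
  have hsub : {v : V | announcement G X s t v = some true}
      ⊆ {v : V | announcement G X s t' v = some true} ∪ Pᶜ := by
    intro v hv
    by_cases hvP : v ∈ P
    · left
      have := hP.le_announcement ht' v hvP
      rw [show announcement G X s t v = some true from hv] at this
      exact eq_some_true_of_one_le (by simpa using this)
    · exact Or.inr hvP
  have h1 := (Set.ncard_le_ncard hsub).trans (Set.ncard_union_le _ _)
  rw [← numCorrect_eq_ncard, ← numCorrect_eq_ncard] at h1
  omega

end Persistent

/-! ### Balanced trees by levels -/

section LevelTree

variable {V : Type*}

/-- A balanced `M`-ary tree of height `h`, given by the depth and the parent of each node. The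
parent of the root is a junk value. -/
structure LevelTree (G : SimpleGraph V) (M h : ℕ) where
  /-- the distance from the root -/
  depth : V → ℕ
  /-- the neighbour on the path to the root -/
  parent : V → V
  depth_le : ∀ v, depth v ≤ h
  adj_iff : ∀ v w, G.Adj v w ↔
    (depth v = depth w + 1 ∧ parent v = w) ∨ (depth w = depth v + 1 ∧ parent w = v)
  depth_parent : ∀ v, depth v ≠ 0 → depth (parent v) + 1 = depth v
  ncard_children : ∀ v, depth v < h → {u | depth u = depth v + 1 ∧ parent u = v}.ncard = M
  ncard_root : {v | depth v = 0}.ncard = 1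

lemma eq_of_adj_of_dist_eq {G : SimpleGraph V} (hG : G.IsTree) {r v p q : V}
    (hp : G.Adj p v) (hq : G.Adj q v) (hdp : G.dist r v = G.dist r p + 1)
    (hdq : G.dist r v = G.dist r q + 1) : p = q := by
  obtain ⟨w, hw⟩ := hG.connected.exists_walk_length_eq_dist r p
  obtain ⟨w', hw'⟩ := hG.connected.exists_walk_length_eq_dist r q
  have h1 : (w.concat hp).IsPath := SimpleGraph.Walk.isPath_of_length_eq_dist _ (by simp [hw, hdp])
  have h2 : (w'.concat hq).IsPath :=
    SimpleGraph.Walk.isPath_of_length_eq_dist _ (by simp [hw', hdq])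
  have := (hG.isAcyclic.subsingleton_path r v).elim ⟨_, h1⟩ ⟨_, h2⟩
  simp only [Subtype.mk.injEq] at this
  exact (SimpleGraph.Walk.concat_inj this).1

lemma exists_adj_dist_eq {G : SimpleGraph V} (hG : G.Connected) {r v : V} (hv : G.dist r v ≠ 0) :
    ∃ p, G.Adj p v ∧ G.dist r v = G.dist r p + 1 := by
  obtain ⟨w, hw⟩ := hG.exists_walk_length_eq_dist v r
  cases w with
  | nil => simp at hv
  | @cons _ p _ h w' =>
    refine ⟨p, h.symm, ?_⟩
    rw [SimpleGraph.Walk.length_cons, SimpleGraph.dist_comm] at hw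
    have h1 : G.dist r p ≤ w'.length := by
      rw [SimpleGraph.dist_comm]; exact SimpleGraph.dist_le w'
    have h2 : G.dist r v ≤ G.dist r p + 1 := by
      refine (hG.dist_triangle (v := p)).trans ?_
      rw [SimpleGraph.dist_eq_one_iff_adj.2 h.symm]
    omega

lemma IsBalancedTree.exists_levelTree [Finite V] {G : SimpleGraph V} {M : ℕ}
    (hG : IsBalancedTree G M) : ∃ h, Nonempty (LevelTree G M h) := by
  obtain ⟨hT, r, hM, hleaf⟩ := hG
  have : Nonempty V := ⟨r⟩
  obtain ⟨z, hz⟩ := Finite.exists_max fun v => G.dist r v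
  have hpar : ∀ v, ∃ p, G.dist r v ≠ 0 → G.Adj p v ∧ G.dist r v = G.dist r p + 1 := by
    intro v
    by_cases hv : G.dist r v = 0
    · exact ⟨v, fun h => absurd hv h⟩
    · obtain ⟨p, hp⟩ := exists_adj_dist_eq hT.connected hv
      exact ⟨p, fun _ => hp⟩
  choose par hpar using hpar
  have hz0 : children G r z = ∅ := by
    by_contra hne
    obtain ⟨u, hu⟩ := Set.nonempty_iff_ne_empty.2 hne
    have := hz u
    have := hu.2
    omega
  refine ⟨G.dist r z, ⟨⟨fun v => G.dist r v, par, hz, ?_, ?_, ?_, ?_⟩⟩⟩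
  · intro v w
    constructor
    · intro h
      have huniq : ∀ {a b}, G.Adj a b → G.dist r a = G.dist r b + 1 → par a = b := by
        intro a b hab hd
        have := hpar a (by omega)
        exact eq_of_adj_of_dist_eq hT this.1 hab.symm this.2 hd
      rcases hT.dist_eq_dist_add_one_of_adj r h with h1 | h1
      · exact Or.inl ⟨h1, huniq h h1⟩
      · exact Or.inr ⟨h1, huniq h.symm h1⟩
    · rintro (⟨h1, rfl⟩ | ⟨h1, rfl⟩)
      · exact (hpar v (by omega)).1.symm
      · exact (hpar w (by omega)).1
  · intro v hv
    exact (hpar v hv).2.symm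
  · intro v hv
    have hne : (children G r v).Nonempty := by
      by_contra hemp
      rw [Set.not_nonempty_iff_eq_empty] at hemp
      exact absurd (hleaf v z hemp hz0) hv.ne
    rw [← hM v hne]
    congr 1
    ext u
    simp only [children, Set.mem_ofPred_eq]
    constructor
    · rintro ⟨h1, rfl⟩
      exact ⟨(hpar u (by omega)).1, h1⟩
    · rintro ⟨h1, h2⟩
      have := hpar u (by omega)
      exact ⟨h2, eq_of_adj_of_dist_eq hT this.1 h1 this.2 h2⟩
  · rw [Set.ncard_eq_one]
    refine ⟨r, ?_⟩
    ext v
    simp only [Set.mem_ofPred_eq, Set.mem_singleton_iff]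
    rw [hT.connected.dist_eq_zero_iff, eq_comm]

namespace LevelTree

variable {G : SimpleGraph V} {M h : ℕ} (τ : LevelTree G M h)

lemma adj_parent {v : V} (hv : τ.depth v ≠ 0) : G.Adj v (τ.parent v) :=
  (τ.adj_iff _ _).2 (Or.inl ⟨(τ.depth_parent v hv).symm, rfl⟩)

variable [Fintype V]

/-- The children of a node, as a finite set. -/
noncomputable def childFinset (v : V) : Finset V :=
  Finset.univ.filter fun u => τ.depth u = τ.depth v + 1 ∧ τ.parent u = v

/-- The nodes at a given depth. -/
noncomputable def level (i : ℕ) : Finset V := Finset.univ.filter fun v => τ.depth v = i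

@[simp] lemma mem_childFinset {u v : V} :
    u ∈ τ.childFinset v ↔ τ.depth u = τ.depth v + 1 ∧ τ.parent u = v := by
  simp [childFinset]

@[simp] lemma mem_level {v : V} {i : ℕ} : v ∈ τ.level i ↔ τ.depth v = i := by
  simp [level]

lemma card_childFinset {v : V} (hv : τ.depth v < h) : (τ.childFinset v).card = M := by
  refine Eq.trans ?_ (τ.ncard_children v hv)
  rw [Set.ncard_eq_toFinset_card']
  congr 1
  ext u; simp

lemma card_childFinset_le (v : V) : (τ.childFinset v).card ≤ M := by
  rcases (τ.depth_le v).lt_or_eq with hv | hv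
  · exact (τ.card_childFinset hv).le
  · have : τ.childFinset v = ∅ := by
      ext u
      have := τ.depth_le u
      simp only [mem_childFinset, Finset.notMem_empty, iff_false]
      omega
    simp [this]

lemma nbrs_subset (v : V) : {u | G.Adj v u} ⊆ insert (τ.parent v) (τ.childFinset v : Set V) := by
  intro u hu
  rcases (τ.adj_iff v u).1 hu with h1 | h1
  · exact Or.inl h1.2.symm
  · right
    simpa using h1

lemma degree_le (τ : LevelTree G M h) (v : V) : {u | G.Adj v u}.ncard ≤ M + 1 := by
  refine (Set.ncard_le_ncard (τ.nbrs_subset v)).trans ((Set.ncard_insert_le _ _).trans ?_)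
  rw [Set.ncard_coe_finset]
  exact Nat.add_le_add_right (τ.card_childFinset_le v) 1

/-- The nodes of a set one level below a set `A` are few if each node of `A` has few children in
the set. -/
lemma card_level_succ_le {p : V → Prop} {q : V → Prop} {i b : ℕ}
    (hp : ∀ v, τ.depth v = i + 1 → p v → q (τ.parent v))
    (hb : ∀ w, τ.depth w = i → q w → ((τ.childFinset w).filter p).card ≤ b) :
    ((τ.level (i + 1)).filter p).card ≤ ((τ.level i).filter q).card * b := by
  have hsub : (τ.level (i + 1)).filter p
      ⊆ ((τ.level i).filter q).biUnion fun w => (τ.childFinset w).filter p := by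
    intro v hv
    simp only [Finset.mem_filter, mem_level, Finset.mem_biUnion, mem_childFinset] at hv ⊢
    have := τ.depth_parent v (by omega)
    exact ⟨τ.parent v, ⟨by omega, hp v hv.1 hv.2⟩, ⟨by omega, rfl⟩, hv.2⟩
  refine (Finset.card_le_card hsub).trans (Finset.card_biUnion_le_card_mul _ _ _ fun w hw => ?_)
  simp only [Finset.mem_filter, mem_level] at hw
  exact hb w hw.1 hw.2

lemma card_level {i : ℕ} (hi : i ≤ h) : (τ.level i).card = M ^ i := by
  induction i with
  | zero =>
    rw [pow_zero, ← τ.ncard_root, Set.ncard_eq_toFinset_card']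
    congr 1
    ext u; simp
  | succ i ih =>
    have heq : τ.level (i + 1) = (τ.level i).biUnion τ.childFinset := by
      ext v
      simp only [mem_level, Finset.mem_biUnion, mem_childFinset]
      constructor
      · intro hv
        have := τ.depth_parent v (by omega)
        exact ⟨τ.parent v, by omega, by omega, rfl⟩
      · rintro ⟨w, hw, hv, -⟩
        omega
    rw [heq, Finset.card_biUnion, Finset.sum_congr rfl fun v hv =>
      τ.card_childFinset (v := v) (by rw [mem_level] at hv; omega), Finset.sum_const,
      ih (by omega), smul_eq_mul, pow_succ]
    intro v _ w _ hvw
    rw [Function.onFun, Finset.disjoint_left]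
    intro u hu hu'
    rw [mem_childFinset] at hu hu'
    exact hvw (hu.2.symm.trans hu'.2)

lemma card_eq_sum_card_filter (p : V → Prop) [DecidablePred p] :
    (Finset.univ.filter p).card = ∑ i ∈ Finset.range (h + 1), ((τ.level i).filter p).card := by
  rw [Finset.card_eq_sum_card_fiberwise (f := τ.depth) (t := Finset.range (h + 1))
    fun v _ => by have := τ.depth_le v; simp; omega]
  refine Finset.sum_congr rfl fun i _ => ?_
  congr 1
  ext v
  simp [and_comm]

lemma card_eq (τ : LevelTree G M h) : Fintype.card V = ∑ i ∈ Finset.range (h + 1), M ^ i := by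
  have := τ.card_eq_sum_card_filter fun _ => True
  simp only [Finset.filter_true, Finset.card_univ] at this
  rw [this]
  exact Finset.sum_congr rfl fun i hi => τ.card_level (by
    have := Finset.mem_range.1 hi; omega)

lemma le_height (τ : LevelTree G M h) {K : ℕ} (hM : 1 ≤ M) (hK : K * M ^ K < Fintype.card V) : K ≤
    h := by
  by_contra hlt
  push Not at hlt
  have : Fintype.card V ≤ K * M ^ K := by
    rw [τ.card_eq]
    calc ∑ i ∈ Finset.range (h + 1), M ^ i ≤ ∑ i ∈ Finset.range (h + 1), M ^ K :=
          Finset.sum_le_sum fun i hi => Nat.pow_le_pow_right hM (by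
            have := Finset.mem_range.1 hi; omega)
      _ = (h + 1) * M ^ K := by simp
      _ ≤ K * M ^ K := Nat.mul_le_mul_right _ hlt
  omega

end LevelTree

end LevelTree

/-! ### Cascades down an `M`-ary tree with `M ≥ 2` -/

section Branching

variable {V : Type*}

lemma nbrCount_add_le [Finite V] (G : SimpleGraph V) (c : Profile V) (v : V) :
    nbrCount G c v true + nbrCount G c v false ≤ {u | G.Adj v u}.ncard := by
  rw [nbrCount, nbrCount, ← Set.ncard_union_eq]
  · exact Set.ncard_le_ncard fun u hu => by
      rcases hu with hu | hu <;> exact hu.1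
  · rw [Set.disjoint_left]
    rintro u ⟨-, hu⟩ ⟨-, hu'⟩
    rw [hu] at hu'
    simp at hu'

lemma newAnnouncement_eq_true_of_many [Finite V] {G : SimpleGraph V} {X : V → Bool} {c : Profile V}
    {v : V} (A : Finset V) (hA : ∀ u ∈ A, G.Adj v u ∧ c u = some true)
    (hd : {u | G.Adj v u}.ncard < 2 * A.card) : newAnnouncement G X c v = true := by
  have h1 : A.card ≤ nbrCount G c v true := by
    rw [← Set.ncard_coe_finset, nbrCount]
    exact Set.ncard_le_ncard fun u hu => hA u hu
  have h2 := nbrCount_add_le G c v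
  have h3 : nbrCount G c v false < nbrCount G c v true := by omega
  simp [newAnnouncement, h3]

namespace LevelTree

variable {G : SimpleGraph V} {M h : ℕ} (τ : LevelTree G M h)

/-- The ancestor of `v` at depth `a`; it is `v` itself if `v` is not deeper than `a`. -/
def ancestor (a : ℕ) (v : V) : V := τ.parent^[τ.depth v - a] v

lemma ancestor_parent {a : ℕ} {v : V} (hv : a < τ.depth v) :
    τ.ancestor a (τ.parent v) = τ.ancestor a v := by
  have := τ.depth_parent v (by omega)
  rw [ancestor, ancestor, show τ.depth v - a = (τ.depth (τ.parent v) - a) + 1 by omega,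
    Function.iterate_succ_apply]

lemma ancestor_self {a : ℕ} {v : V} (hv : τ.depth v ≤ a) : τ.ancestor a v = v := by
  rw [ancestor, Nat.sub_eq_zero_of_le hv, Function.iterate_zero_apply]

/-- The nodes below depth `a` which lie in the same branch as some node of `U`. -/
def InBranchOf (a : ℕ) (U : Finset V) (v : V) : Prop :=
  a < τ.depth v ∧ ∃ u ∈ U, a < τ.depth u ∧ τ.ancestor a u = τ.ancestor a v

variable {τ}

lemma InBranchOf.of_parent {a : ℕ} {U : Finset V} {v : V} (hv : τ.depth v ≠ 0)
    (h : τ.InBranchOf a U (τ.parent v)) : τ.InBranchOf a U v := by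
  obtain ⟨h1, u, hu, hau, huv⟩ := h
  have := τ.depth_parent v hv
  exact ⟨by omega, u, hu, hau, huv.trans (τ.ancestor_parent (by omega))⟩

lemma InBranchOf.parent {a : ℕ} {U : Finset V} {v : V} (hv : a < τ.depth (τ.parent v))
    (hv' : a < τ.depth v) (h : τ.InBranchOf a U v) : τ.InBranchOf a U (τ.parent v) := by
  obtain ⟨h1, u, hu, hau, huv⟩ := h
  exact ⟨hv, u, hu, hau, huv.trans (τ.ancestor_parent hv').symm⟩

variable (τ) [Fintype V]

/-- The nodes which could lose Correct if all nodes of depth at most `a` became Incorrect: the loss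
passes from a node to a child announcing Correct, and a node below depth `a` can only be lost if at
most `(M + 1) / 2` of its children announce Correct. -/
inductive Falling (c : Profile V) (a : ℕ) : V → Prop
  | top {v : V} (hv : τ.depth v ≤ a) : Falling c a v
  | down {v : V} (hc : c v = some true)
      (hfew : ((τ.childFinset v).filter fun u => c u = some true).card ≤ (M + 1) / 2)
      (hp : Falling c a (τ.parent v)) : Falling c a v

/-- The nodes which neither lie in a branch with an unstable node nor are falling protect
themselves. -/
lemma isPersistent_not_falling (X : V → Bool) (c : Profile V) (a : ℕ) :
    IsPersistent G X c {v | ¬τ.Falling c a v ∧ ¬τ.InBranchOf a (unstable G X c) v} := by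
  rintro v ⟨hvF, hvB⟩ c' hc'
  have hva : a < τ.depth v := by
    by_contra hle
    exact hvF (.top (by omega))
  have hstab : c v = some (newAnnouncement G X c v) := by
    by_contra hne
    refine hvB ⟨hva, v, ?_, hva, rfl⟩
    rw [← step_eq_iff] at hne
    simpa [unstable] using hne
  have hchild : ∀ u ∈ τ.childFinset v,
      u ∈ {v | ¬τ.Falling c a v ∧ ¬τ.InBranchOf a (unstable G X c) v} := by
    intro u hu
    rw [mem_childFinset] at hu
    obtain ⟨hdu, rfl⟩ := hu
    refine ⟨fun hF => ?_, fun hB => hvB (hB.parent hva (by omega))⟩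
    cases hF with
    | top hd => omega
    | down _ _ hp => exact hvF hp
  rcases hcv : c v with _ | _ | _
  · rw [hcv] at hstab
    simp at hstab
  · rw [spin_some, spin_some]
    exact signalSpin_mono (Bool.false_le _)
  · suffices newAnnouncement G X c' v = true by rw [this]
    by_cases hp : τ.parent v ∈ {v | ¬τ.Falling c a v ∧ ¬τ.InBranchOf a (unstable G X c) v}
    · have hmono : newAnnouncement G X c v ≤ newAnnouncement G X c' v := by
        refine newAnnouncement_mono G v le_rfl fun u hu => hc' u ?_
        rcases (τ.adj_iff v u).1 hu with h1 | h1
        · rw [← h1.2]; exact hp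
        · exact hchild u (by rw [mem_childFinset]; exact h1)
      rw [hcv, Option.some.injEq] at hstab
      rw [← hstab] at hmono
      exact top_le_iff.1 hmono
    · have hpB : ¬τ.InBranchOf a (unstable G X c) (τ.parent v) := fun hB =>
        hvB (hB.of_parent (by omega))
      have hpF : τ.Falling c a (τ.parent v) := by
        by_contra hpF
        exact hp ⟨hpF, hpB⟩
      have hmany : (M + 1) / 2
          < ((τ.childFinset v).filter fun u => c u = some true).card := by
        by_contra hle
        exact hvF (.down hcv (by omega) hpF)
      refine newAnnouncement_eq_true_of_many
        ((τ.childFinset v).filter fun u => c u = some true) ?_ ?_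
      · intro u hu
        rw [Finset.mem_filter] at hu
        refine ⟨(τ.adj_iff v u).2 (Or.inr (τ.mem_childFinset.1 hu.1)), ?_⟩
        have := hc' u (hchild u hu.1)
        rw [hu.2] at this
        exact eq_some_true_of_one_le (by simpa using this)
      · have := τ.degree_le v
        omega

lemma card_inBranchOf_le {a K : ℕ} (hK : a + K = h) (hM : 1 ≤ M) (U : Finset V) :
    (Finset.univ.filter (τ.InBranchOf a U)).card ≤ U.card * (K * M ^ K) := by
  have hz : ∀ z i, ((τ.level (a + i)).filter fun v => τ.ancestor a v = z).card ≤ M ^ i := by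
    intro z i
    induction i with
    | zero =>
      rw [pow_zero, Finset.card_le_one]
      intro v hv w hw
      simp only [add_zero, Finset.mem_filter, mem_level] at hv hw
      rw [τ.ancestor_self hv.1.le] at hv
      rw [τ.ancestor_self hw.1.le] at hw
      rw [hv.2, hw.2]
    | succ i ih =>
      rw [pow_succ]
      refine (τ.card_level_succ_le (i := a + i) (p := fun v => τ.ancestor a v = z)
        (q := fun v => τ.ancestor a v = z) (b := M) ?_ ?_).trans (Nat.mul_le_mul_right _ ih)
      · intro v hv hvz
        rw [τ.ancestor_parent (by omega)]
        exact hvz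
      · exact fun w _ _ => (Finset.card_filter_le _ _).trans (τ.card_childFinset_le w)
  have hz' : ∀ z, (Finset.univ.filter fun v => a < τ.depth v ∧ τ.ancestor a v = z).card
      ≤ K * M ^ K := by
    intro z
    rw [τ.card_eq_sum_card_filter]
    have hsub : Finset.Ioc a h ⊆ Finset.range (h + 1) := by
      intro j hj
      simp only [Finset.mem_Ioc, Finset.mem_range] at hj ⊢
      omega
    rw [← Finset.sum_subset hsub]
    · calc ∑ j ∈ Finset.Ioc a h,
            ((τ.level j).filter fun v => a < τ.depth v ∧ τ.ancestor a v = z).card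
          ≤ ∑ j ∈ Finset.Ioc a h, M ^ K := by
            refine Finset.sum_le_sum fun j hj => ?_
            rw [Finset.mem_Ioc] at hj
            obtain ⟨i, rfl⟩ := Nat.exists_eq_add_of_lt hj.1
            refine (Finset.card_le_card ?_).trans ((hz z (i + 1)).trans
              (Nat.pow_le_pow_right hM (by omega)))
            intro v hv
            simp only [Finset.mem_filter, mem_level] at hv ⊢
            exact ⟨by omega, hv.2.2⟩
        _ = K * M ^ K := by
            rw [Finset.sum_const, Nat.card_Ioc, smul_eq_mul]
            congr 1
            omega
    · intro j _ hj
      rw [Finset.card_eq_zero, Finset.filter_eq_empty_iff]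
      intro v hv h
      rw [mem_level] at hv
      have := τ.depth_le v
      exact hj (Finset.mem_Ioc.2 ⟨by omega, by omega⟩)
  have hsub : Finset.univ.filter (τ.InBranchOf a U)
      ⊆ U.biUnion fun u => Finset.univ.filter fun v =>
        a < τ.depth v ∧ τ.ancestor a v = τ.ancestor a u := by
    intro v hv
    simp only [InBranchOf, Finset.mem_filter, Finset.mem_univ, true_and, Finset.mem_biUnion] at hv ⊢
    obtain ⟨h1, u, hu, -, huv⟩ := hv
    exact ⟨u, hu, h1, huv.symm⟩
  exact (Finset.card_le_card hsub).trans
    (Finset.card_biUnion_le_card_mul _ _ _ fun u _ => hz' _)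

/-- From one level to the next, the number of falling nodes grows by the factor `(M + 1) / 2`
only, which is at most `3 * M / 4`, whereas the number of all nodes grows by the factor `M`. -/
lemma card_level_falling_le (hM : 2 ≤ M) (c : Profile V) {a : ℕ} (ha : a ≤ h) (i : ℕ) :
    (((τ.level (a + i)).filter (τ.Falling c a)).card : ℝ)
      ≤ 4 / 3 * (3 / 4) ^ i * (M : ℝ) ^ (a + i) := by
  have hdown : ∀ v, a < τ.depth v → τ.Falling c a v → c v = some true
      ∧ ((τ.childFinset v).filter fun u => c u = some true).card ≤ (M + 1) / 2
      ∧ τ.Falling c a (τ.parent v) := by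
    intro v hv hF
    cases hF with
    | top hd => omega
    | down h1 h2 h3 => exact ⟨h1, h2, h3⟩
  have hfirst : ((τ.level a).filter (τ.Falling c a)).card ≤ M ^ a :=
    (Finset.card_filter_le _ _).trans (τ.card_level ha).le
  have hM0 : (0 : ℝ) ≤ M := Nat.cast_nonneg _
  induction i with
  | zero =>
    have : (((τ.level a).filter (τ.Falling c a)).card : ℝ) ≤ (M : ℝ) ^ a := by
      exact_mod_cast hfirst
    have h0 : (0 : ℝ) ≤ (M : ℝ) ^ a := by positivity
    simp only [add_zero, pow_zero, mul_one]
    linarith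
  | succ i ih =>
    rcases Nat.eq_zero_or_pos i with rfl | hi
    · have h1 : ((τ.level (a + 1)).filter (τ.Falling c a)).card ≤ M ^ a * M := by
        refine (τ.card_level_succ_le (q := τ.Falling c a) (b := M) ?_ ?_).trans
          (Nat.mul_le_mul_right _ hfirst)
        · exact fun v hv hF => (hdown v (by omega) hF).2.2
        · exact fun w _ _ => (Finset.card_filter_le _ _).trans (τ.card_childFinset_le w)
      have h2 : (((τ.level (a + 1)).filter (τ.Falling c a)).card : ℝ) ≤ (M : ℝ) ^ a * M := by
        exact_mod_cast h1
      simp only [zero_add, pow_one]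
      rw [pow_succ]
      linarith
    · have h1 : ((τ.level (a + (i + 1))).filter (τ.Falling c a)).card
          ≤ ((τ.level (a + i)).filter (τ.Falling c a)).card * ((M + 1) / 2) := by
        refine τ.card_level_succ_le (i := a + i) ?_ ?_
        · exact fun v hv hF => (hdown v (by omega) hF).2.2
        · intro w hw hF
          refine (Finset.card_le_card ?_).trans (hdown w (by omega) hF).2.1
          intro v hv
          rw [Finset.mem_filter, mem_childFinset] at hv
          rw [Finset.mem_filter, mem_childFinset]
          exact ⟨hv.1, (hdown v (by omega) hv.2).1⟩
      have h2 : (((τ.level (a + (i + 1))).filter (τ.Falling c a)).card : ℝ)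
          ≤ ((τ.level (a + i)).filter (τ.Falling c a)).card * (((M + 1) / 2 : ℕ) : ℝ) := by
        exact_mod_cast h1
      have h3 : (((M + 1) / 2 : ℕ) : ℝ) ≤ 3 / 4 * M := by
        have : 4 * ((M + 1) / 2) ≤ 3 * M := by omega
        have : (4 : ℝ) * (((M + 1) / 2 : ℕ) : ℝ) ≤ 3 * M := by exact_mod_cast this
        linarith
      calc _ ≤ _ := h2
        _ ≤ (4 / 3 * (3 / 4) ^ i * (M : ℝ) ^ (a + i)) * (3 / 4 * M) :=
            mul_le_mul ih h3 (Nat.cast_nonneg _) (by positivity)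
        _ = _ := by rw [← add_assoc, pow_succ, pow_succ]; ring

lemma card_falling_le (hM : 2 ≤ M) (c : Profile V) {a K : ℕ} (hK : a + K = h) :
    ((Finset.univ.filter (τ.Falling c a)).card : ℝ) ≤ 4 * (3 / 4) ^ K * Fintype.card V := by
  have hM2 : (2 : ℝ) ≤ M := by exact_mod_cast hM
  have hshallow : ∀ j, (∑ i ∈ Finset.range (j + 1), (M : ℝ) ^ i) ≤ 2 * (M : ℝ) ^ j := by
    intro j
    induction j with
    | zero => simp
    | succ j ih =>
      rw [Finset.sum_range_succ, pow_succ]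
      have : (0 : ℝ) < (M : ℝ) ^ j := by positivity
      nlinarith
  have hsum : ∀ i, a + i ≤ h → (∑ j ∈ Finset.range (a + i + 1),
      (((τ.level j).filter (τ.Falling c a)).card : ℝ)) ≤ 4 * (3 / 4) ^ i * (M : ℝ) ^ (a + i) := by
    intro i hi
    induction i with
    | zero =>
      have hpos : (0 : ℝ) ≤ (M : ℝ) ^ a := by positivity
      calc ∑ j ∈ Finset.range (a + 0 + 1), (((τ.level j).filter (τ.Falling c a)).card : ℝ)
          ≤ ∑ j ∈ Finset.range (a + 1), (M : ℝ) ^ j := by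
            refine Finset.sum_le_sum fun j hj => ?_
            have hj' := Finset.mem_range.1 hj
            exact_mod_cast (Finset.card_filter_le _ _).trans (τ.card_level (i := j) (by omega)).le
        _ ≤ 2 * (M : ℝ) ^ a := hshallow a
        _ ≤ _ := by simp only [add_zero, pow_zero, mul_one]; linarith
    | succ i ih =>
      have h1 := ih (by omega)
      have h2 := τ.card_level_falling_le hM c (a := a) (by omega) (i + 1)
      rw [← add_assoc, Finset.sum_range_succ]
      rw [← add_assoc] at h2
      have hpos : (0 : ℝ) < (3 / 4) ^ i * (M : ℝ) ^ (a + i) := by positivity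
      have e1 : (3 / 4 : ℝ) ^ (i + 1) * (M : ℝ) ^ (a + i + 1)
          = 3 / 4 * M * ((3 / 4) ^ i * (M : ℝ) ^ (a + i)) := by
        rw [pow_succ, pow_succ]; ring
      nlinarith
  have hfinal := hsum K hK.le
  have hcard : (M : ℝ) ^ h ≤ Fintype.card V := by
    have : M ^ h ≤ Fintype.card V := by
      rw [← τ.card_level le_rfl]
      exact Finset.card_le_univ _
    exact_mod_cast this
  rw [τ.card_eq_sum_card_filter]
  rw [hK] at hfinal
  push_cast
  exact hfinal.trans (mul_le_mul_of_nonneg_left hcard (by positivity))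

end LevelTree

/-- For fixed `M ≥ 2`, the process on a large balanced `M`-ary tree stabilizes in a correct
majority with probability close to one. -/
theorem eventually_correctMajority_of_two_le {δ : ℝ} (h0 : 0 < δ) (h1 : δ < 1 / 2) {M : ℕ}
    (hM : 2 ≤ M) {ε : ℝ} (hε : 0 < ε) : ∃ n₀ : ℕ, ∀ (V : Type*) [Fintype V] [Nonempty V]
      [MeasurableSpace V] [DiscreteMeasurableSpace V] (G : SimpleGraph V), IsBalancedTree G M →
      n₀ ≤ Fintype.card V →
      1 - ε ≤ (processLaw V δ).real {ω | StabilizesInCorrectMajority G ω.1 ω.2} := by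
  -- The nodes of the lowest `K` levels matter. The top of the tree costs a proportion of
  -- `4 * (3 / 4) ^ K < δ / 4`, and each unstable node spoils a branch of at most `K * M ^ K` nodes.
  obtain ⟨K, hK⟩ := exists_pow_lt_of_lt_one (show 0 < δ / 16 by linarith)
    (show (3 / 4 : ℝ) < 1 by norm_num)
  have hB : (0 : ℝ) < K * (M : ℝ) ^ K + 2 := by positivity
  obtain ⟨n₀, hn₀⟩ := exists_time_nearly_stable h0.le h1 (M + 1) hε
    (η := δ / (2 * (K * (M : ℝ) ^ K + 2))) (by positivity)
  refine ⟨max n₀ (K * M ^ K + 1), fun V _ _ _ _ G hG hV => ?_⟩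
  obtain ⟨h, ⟨τ⟩⟩ := hG.exists_levelTree
  have := isProbabilityMeasure_processLaw (V := V) h0.le h1.le
  have hn : (0 : ℝ) < Fintype.card V := by exact_mod_cast Fintype.card_pos
  obtain ⟨t, ht⟩ := hn₀ V G τ.degree_le ((le_max_left _ _).trans hV)
  have hKh : K ≤ h := τ.le_height (by omega) (by
    have := (le_max_right _ _).trans hV; omega)
  set η := δ / (2 * (K * (M : ℝ) ^ K + 2)) with hη
  have hηδ : η * (K * (M : ℝ) ^ K + 2) = δ / 2 := by
    rw [hη]; field_simp
  set E := {ω : (V → Bool) × (ℕ → V) |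
        (numCorrect (announcement G ω.1 ω.2 t) : ℝ) ≤ (1 / 2 + δ - 2 * η) * Fintype.card V ∨
        η * Fintype.card V ≤ (unstable G ω.1 (announcement G ω.1 ω.2 t)).card} with hE
  have hcompl : 1 - ε ≤ (processLaw V δ).real Eᶜ := by
    have h2 : (processLaw V δ).real (E ∪ Eᶜ) ≤ _ := measureReal_union_le E Eᶜ
    rw [Set.union_compl_self, probReal_univ] at h2
    linarith
  refine hcompl.trans (processLaw_real_mono h0.le h1.le fun X s hs hω => ?_)
  simp only [hE, Set.mem_compl_iff, Set.mem_ofPred_eq, not_or, not_le] at hω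
  obtain ⟨hN, hU⟩ := hω
  have hP := τ.isPersistent_not_falling X (announcement G X s t) (h - K)
  refine hP.stabilizesInCorrectMajority hs ?_
  have hF := τ.card_falling_le hM (announcement G X s t) (a := h - K) (K := K) (by omega)
  have hI := τ.card_inBranchOf_le (a := h - K) (K := K) (by omega) (by omega)
    (unstable G X (announcement G X s t))
  have hI' : ((Finset.univ.filter (τ.InBranchOf (h - K)
      (unstable G X (announcement G X s t)))).card : ℝ)
      ≤ (unstable G X (announcement G X s t)).card * (K * (M : ℝ) ^ K) := by
    exact_mod_cast hI
  have hPc : ({v | ¬τ.Falling (announcement G X s t) (h - K) v ∧ ¬τ.InBranchOf (h - K)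
      (unstable G X (announcement G X s t)) v}ᶜ : Set V).ncard
      ≤ (Finset.univ.filter (τ.Falling (announcement G X s t) (h - K))).card
        + (Finset.univ.filter (τ.InBranchOf (h - K)
          (unstable G X (announcement G X s t)))).card := by
    rw [← Set.ncard_coe_finset, ← Set.ncard_coe_finset]
    refine (Set.ncard_le_ncard ?_).trans (Set.ncard_union_le _ _)
    intro v hv
    simp only [Set.mem_compl_iff, Set.mem_ofPred_eq, not_and_or, not_not] at hv
    simpa using hv
  have hPc' : (({v | ¬τ.Falling (announcement G X s t) (h - K) v ∧ ¬τ.InBranchOf (h - K)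
      (unstable G X (announcement G X s t)) v}ᶜ : Set V).ncard : ℝ)
      ≤ (Finset.univ.filter (τ.Falling (announcement G X s t) (h - K))).card
        + (Finset.univ.filter (τ.InBranchOf (h - K)
          (unstable G X (announcement G X s t)))).card := by
    exact_mod_cast hPc
  have hKM : (0 : ℝ) ≤ K * (M : ℝ) ^ K := by positivity
  have hloss : (Fintype.card V : ℝ) + 2 * (({v | ¬τ.Falling (announcement G X s t) (h - K) v
      ∧ ¬τ.InBranchOf (h - K) (unstable G X (announcement G X s t)) v}ᶜ : Set V).ncard : ℝ)
      < 2 * numCorrect (announcement G X s t) := by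
    have e1 := mul_le_mul_of_nonneg_right hU.le hKM
    have e2 : η * Fintype.card V * (K * (M : ℝ) ^ K) = (δ / 2 - 2 * η) * Fintype.card V := by
      rw [← hηδ]; ring
    have e3 := mul_le_mul_of_nonneg_right hK.le hn.le
    have e4 := mul_pos h0 hn
    nlinarith
  exact_mod_cast hloss

end Branching

/-! ### Paths -/

section Path

variable {V : Type*}

lemma newAnnouncement_eq_true_of_signal [Finite V] {G : SimpleGraph V} {X : V → Bool}
    {c : Profile V} {v u : V} (hd : {u | G.Adj v u}.ncard ≤ 2) (hu : G.Adj v u)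
    (hc : c u = some true) (hX : X v = true) : newAnnouncement G X c v = true := by
  have h1 : 0 < nbrCount G c v true := by
    rw [nbrCount, Set.ncard_pos]
    exact ⟨u, hu, hc⟩
  have h2 := nbrCount_add_le G c v
  have h3 : ¬nbrCount G c v true < nbrCount G c v false := by omega
  simp [newAnnouncement, h3, hX]

namespace LevelTree

variable {G : SimpleGraph V} {h : ℕ} (τ : LevelTree G 1 h)

/-- The nodes inside an interval of depths which avoids `U` (the unstable nodes) and whose first two
and last two signals are Correct. -/
def IsSealed (X : V → Bool) (U : Finset V) (v : V) : Prop :=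
  ∃ i j, i ≤ τ.depth v ∧ τ.depth v ≤ j ∧ i < j ∧ j ≤ h ∧
    (∀ u ∈ U, τ.depth u < i ∨ j < τ.depth u) ∧
    ∀ u, τ.depth u = i ∨ τ.depth u = i + 1 ∨ τ.depth u + 1 = j ∨ τ.depth u = j → X u = true

/-- A pair of consecutive Correct signals among the `2 * J` nodes following `v`. -/
def PairBelow (J : ℕ) (X : V → Bool) (v : V) : Prop :=
  ∃ i < J, τ.depth v + 2 * i + 2 ≤ h ∧ ∀ u, τ.depth u = τ.depth v + 2 * i + 1 ∨
    τ.depth u = τ.depth v + 2 * i + 2 → X u = true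

/-- A pair of consecutive Correct signals among the `2 * J` nodes preceding `v`. -/
def PairAbove (J : ℕ) (X : V → Bool) (v : V) : Prop :=
  ∃ i < J, 2 * i + 2 ≤ τ.depth v ∧ ∀ u, τ.depth u + 2 * i + 1 = τ.depth v ∨
    τ.depth u + 2 * i + 2 = τ.depth v → X u = true

lemma isSealed_of_pairs {J : ℕ} {X : V → Bool} {U : Finset V} {v : V} (hb : τ.PairBelow J X v)
    (ha : τ.PairAbove J X v)
    (hU : ∀ u ∈ U, τ.depth u + 2 * J < τ.depth v ∨ τ.depth v + 2 * J < τ.depth u) :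
    τ.IsSealed X U v := by
  obtain ⟨k, hk, hkh, hkX⟩ := hb
  obtain ⟨l, hl, hlh, hlX⟩ := ha
  refine ⟨τ.depth v - 2 * l - 2, τ.depth v + 2 * k + 2, by omega, by omega, by omega, hkh, ?_, ?_⟩
  · intro u hu
    rcases hU u hu with h1 | h1 <;> omega
  · rintro u (hu | hu | hu | hu)
    · exact hlX u (by omega)
    · exact hlX u (by omega)
    · exact hkX u (by omega)
    · exact hkX u (by omega)

/-- One of the two pairs of Correct signals next to `v` is missing. -/
def Unpaired (J : ℕ) (X : V → Bool) (v : V) : Prop :=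
  ¬τ.PairBelow J X v ∨ ¬τ.PairAbove J X v

end LevelTree

variable [Fintype V] {δ : ℝ}

lemma le_integral_signal (h0 : 0 ≤ δ) (h1 : δ < 1 / 2) (v : V) :
    1 / 2 + δ ≤ ∫ X, (if X v = true then (1 : ℝ) else 0) ∂(signalsLaw V δ) := by
  rw [integral_signalsLaw h0 h1.le]
  refine le_bitMean_of_monotone_of_odd (by linarith) (by linarith) ?_ ?_ ?_
  · intro X X' h
    have hv : X v ≤ X' v := h v
    revert hv
    simp only
    cases X v <;> cases X' v <;> simp
  · intro X
    split_ifs <;> simp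
  · intro X
    cases hX : X v <;> simp [hX]

/-- Among many disjoint pairs of nodes, one consists of two Correct signals, with high
probability. -/
lemma signalsLaw_no_pair_le (h0 : 0 ≤ δ) (h1 : δ < 1 / 2) {J : ℕ} (hJ : 0 < J) (a b : Fin J → V)
    (hab : ∀ i, a i ≠ b i) (hd : ∀ i j, i ≠ j → Disjoint ({a i, b i} : Finset V) {a j, b j}) :
    (signalsLaw V δ).real {X | ∀ i, ¬(X (a i) = true ∧ X (b i) = true)} ≤ 16 / J := by
  have := isProbabilityMeasure_signalsLaw (V := V) h0 h1.le
  have hJ' : (0 : ℝ) < J := by exact_mod_cast hJ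
  let f : Fin J → (V → Bool) → ℝ := fun i X =>
    (if X (a i) = true then 1 else 0) * (if X (b i) = true then 1 else 0)
  have hf0 : ∀ i X, 0 ≤ f i X := fun i X => by
    simp only [f]; split_ifs <;> simp
  have hf1 : ∀ i X, f i X ≤ 1 := fun i X => by
    simp only [f]; split_ifs <;> simp
  have hone : ∀ v : V, DependsOn (fun X : V → Bool => if X v = true then (1 : ℝ) else 0)
      (({v} : Finset V) : Set V) := fun v X X' h => by
    have : X v = X' v := h v (by simp)
    simp [this]
  have hvar := variance_sum_le h0 h1.le f (fun i => {a i, b i}) (fun i X X' h => by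
    have ha : X (a i) = X' (a i) := h _ (by simp)
    have hb : X (b i) = X' (b i) := h _ (by simp)
    simp [f, ha, hb]) hf0 hf1
  have hcount : (∑ i : Fin J, ∑ j : Fin J,
      if Disjoint ({a i, b i} : Finset V) {a j, b j} then (0 : ℝ) else 1) ≤ J := by
    calc _ ≤ ∑ i : Fin J, ∑ j : Fin J, if i = j then (1 : ℝ) else 0 := by
          refine Finset.sum_le_sum fun i _ => Finset.sum_le_sum fun j _ => ?_
          by_cases hij : i = j
          · simp only [hij, if_true]; split_ifs <;> simp
          · simp [hd i j hij, hij]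
      _ = J := by simp
  have hmean : ∀ i, 1 / 4 ≤ ∫ X, f i X ∂(signalsLaw V δ) := by
    intro i
    have hind := indepFun_of_dependsOn h0 h1.le (S := {a i}) (T := {b i}) (by simp [hab i])
      (hone (a i)) (hone (b i))
    have hmul := hind.integral_mul_eq_mul_integral
      (measurable_of_finite _).aestronglyMeasurable (measurable_of_finite _).aestronglyMeasurable
    have ha := le_integral_signal h0 h1 (a i)
    have hb := le_integral_signal h0 h1 (b i)
    have hfi : ∫ X, f i X ∂(signalsLaw V δ)
      = (∫ X, (if X (a i) = true then (1 : ℝ) else 0) ∂(signalsLaw V δ))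
        * ∫ X, (if X (b i) = true then (1 : ℝ) else 0) ∂(signalsLaw V δ) := hmul
    rw [hfi]
    nlinarith
  have hE : (0 : ℝ) + J / 4 ≤ ∫ X, (∑ i, f i) X ∂(signalsLaw V δ) := by
    simp only [Finset.sum_apply]
    rw [integral_finsetSum _ fun i _ => Integrable.of_finite]
    calc (0 : ℝ) + J / 4 = ∑ _i : Fin J, 1 / 4 := by simp; ring
      _ ≤ _ := Finset.sum_le_sum fun i _ => hmean i
  have hch := signalsLaw_real_le_of_variance h0 h1.le (∑ i, f i) (by positivity) hE
  calc _ ≤ (signalsLaw V δ).real {X | (∑ i, f i) X ≤ 0} := by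
        refine measureReal_mono fun X hX => ?_
        simp only [Set.mem_ofPred_eq, Finset.sum_apply]
        refine (Finset.sum_eq_zero fun i _ => ?_).le
        have := hX i
        simp only [f]
        split_ifs with h2 h3
        · exact absurd ⟨h2, h3⟩ this
        all_goals simp
    _ ≤ J / (J / 4) ^ 2 := hch.trans (by gcongr; exact hvar.trans hcount)
    _ = 16 / J := by field_simp; norm_num

namespace LevelTree

variable {G : SimpleGraph V} {h : ℕ} (τ : LevelTree G 1 h)

lemma depth_injective : Function.Injective τ.depth := by
  intro v w hvw
  have h1 := τ.card_level (τ.depth_le v)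
  rw [one_pow, Finset.card_eq_one] at h1
  obtain ⟨z, hz⟩ := h1
  have hv : v ∈ τ.level (τ.depth v) := τ.mem_level.2 rfl
  have hw : w ∈ τ.level (τ.depth v) := τ.mem_level.2 hvw.symm
  rw [hz, Finset.mem_singleton] at hv hw
  rw [hv, hw]

lemma exists_depth_eq {i : ℕ} (hi : i ≤ h) : ∃ v, τ.depth v = i := by
  have h1 := τ.card_level hi
  rw [one_pow] at h1
  obtain ⟨v, hv⟩ := Finset.card_pos.1 (h1 ▸ Nat.one_pos)
  exact ⟨v, τ.mem_level.1 hv⟩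

lemma adj_of_depth {v w : V} (hvw : τ.depth w = τ.depth v + 1) : G.Adj v w := by
  refine (τ.adj_iff v w).2 (Or.inr ⟨hvw, τ.depth_injective ?_⟩)
  have := τ.depth_parent w (by omega)
  omega

/-- Two adjacent stable nodes with Correct signals announce the same opinion, and if this is
Correct, then they never change it. So such pairs seal off the interval between them. -/
lemma isPersistent_isSealed (X : V → Bool) (c : Profile V) :
    IsPersistent G X c {v | τ.IsSealed X (unstable G X c) v} := by
  rintro v ⟨i, j, hiv, hvj, hij, hjh, hU, hX⟩ c' hc'
  have hin : ∀ u, i ≤ τ.depth u → τ.depth u ≤ j → τ.IsSealed X (unstable G X c) u :=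
    fun u h1 h2 => ⟨i, j, h1, h2, hij, hjh, hU, hX⟩
  have hstab : ∀ u, i ≤ τ.depth u → τ.depth u ≤ j → c u = some (newAnnouncement G X c u) := by
    intro u h1 h2
    by_contra hne
    rw [← step_eq_iff] at hne
    rcases hU u (by simpa [unstable] using hne) with h3 | h3 <;> omega
  have hdeg : ∀ u, {w | G.Adj u w}.ncard ≤ 2 := fun u => τ.degree_le u
  rcases hcv : c v with _ | _ | _
  · have := hstab v hiv hvj
    rw [hcv] at this
    simp at this
  · rw [spin_some, spin_some]
    exact signalSpin_mono (Bool.false_le _)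
  · suffices newAnnouncement G X c' v = true by rw [this]
    have hpair : ∀ w, G.Adj v w → X v = true → X w = true → i ≤ τ.depth w → τ.depth w ≤ j →
        newAnnouncement G X c' v = true := by
      intro w hvw hXv hXw hiw hwj
      have hcw : c w = some true := by
        rw [hstab w hiw hwj, newAnnouncement_eq_true_of_signal (hdeg w) hvw.symm hcv hXw]
      have h1 := hc' w (hin w hiw hwj)
      rw [hcw] at h1
      exact newAnnouncement_eq_true_of_signal (hdeg v) hvw
        (eq_some_true_of_one_le (by simpa using h1)) hXv
    -- The ends of the interval are protected by their partners, the other nodes by both neighbours.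
    rcases hiv.eq_or_lt with hi | hi
    · obtain ⟨w, hw⟩ := τ.exists_depth_eq (i := i + 1) (by omega)
      exact hpair w (τ.adj_of_depth (by omega)) (hX v (Or.inl hi.symm))
        (hX w (Or.inr (Or.inl hw))) (by omega) (by omega)
    rcases hvj.eq_or_lt with hj | hj
    · obtain ⟨w, hw⟩ := τ.exists_depth_eq (i := j - 1) (by omega)
      exact hpair w (τ.adj_of_depth (by omega)).symm (hX v (by omega))
        (hX w (by omega)) (by omega) (by omega)
    · have hmono : newAnnouncement G X c v ≤ newAnnouncement G X c' v := by
        refine newAnnouncement_mono G v le_rfl fun u hu => hc' u (hin u ?_ ?_)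
        · rcases (τ.adj_iff v u).1 hu with h1 | h1 <;> omega
        · rcases (τ.adj_iff v u).1 hu with h1 | h1 <;> omega
      have := hstab v hiv hvj
      rw [hcv, Option.some.injEq] at this
      rw [← this] at hmono
      exact top_le_iff.1 hmono

lemma card_near_le (U : Finset V) (L : ℕ) :
    (Finset.univ.filter fun v => ∃ u ∈ U, τ.depth v ≤ τ.depth u + L ∧
      τ.depth u ≤ τ.depth v + L).card ≤ U.card * (2 * L + 1) := by
  have hsub : (Finset.univ.filter fun v => ∃ u ∈ U, τ.depth v ≤ τ.depth u + L ∧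
      τ.depth u ≤ τ.depth v + L) ⊆ U.biUnion fun u => Finset.univ.filter fun v =>
        τ.depth v ≤ τ.depth u + L ∧ τ.depth u ≤ τ.depth v + L := by
    intro v hv
    simpa using hv
  refine (Finset.card_le_card hsub).trans (Finset.card_biUnion_le_card_mul _ _ _ fun u _ => ?_)
  rw [← Finset.card_image_of_injective _ τ.depth_injective]
  refine (Finset.card_le_card (t := Finset.Icc (τ.depth u - L) (τ.depth u + L)) ?_).trans ?_
  · intro k hk
    simp only [Finset.mem_image, Finset.mem_filter, Finset.mem_univ, true_and] at hk
    obtain ⟨v, hv, rfl⟩ := hk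
    rw [Finset.mem_Icc]
    omega
  · rw [Nat.card_Icc]
    omega

lemma signalsLaw_not_pairBelow_le (h0 : 0 ≤ δ) (h1 : δ < 1 / 2) {J : ℕ} (hJ : 0 < J) {v : V}
    (hv : τ.depth v + 2 * J ≤ h) :
    (signalsLaw V δ).real {X | ¬τ.PairBelow J X v} ≤ 16 / J := by
  have := isProbabilityMeasure_signalsLaw (V := V) h0 h1.le
  have hex : ∀ i : Fin J, ∃ a b, τ.depth a = τ.depth v + 2 * i + 1 ∧
      τ.depth b = τ.depth v + 2 * i + 2 := by
    intro i
    have := i.2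
    obtain ⟨a, ha⟩ := τ.exists_depth_eq (i := τ.depth v + 2 * i + 1) (by omega)
    obtain ⟨b, hb⟩ := τ.exists_depth_eq (i := τ.depth v + 2 * i + 2) (by omega)
    exact ⟨a, b, ha, hb⟩
  choose a b ha hb using hex
  refine le_trans (measureReal_mono ?_) (signalsLaw_no_pair_le h0 h1 hJ a b ?_ ?_)
  · intro X hX i hXi
    have := i.2
    refine hX ⟨i, i.2, by omega, ?_⟩
    rintro u (hu | hu)
    · rw [τ.depth_injective (hu.trans (ha i).symm)]; exact hXi.1
    · rw [τ.depth_injective (hu.trans (hb i).symm)]; exact hXi.2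
  · intro i hi
    have := ha i
    have := hb i
    rw [hi] at *
    omega
  · intro i j hij
    have hne : (i : ℕ) ≠ j := fun h => hij (Fin.ext h)
    have hval : ∀ {x y : V}, τ.depth x ≠ τ.depth y → x ≠ y := fun h h' => h (by rw [h'])
    have := ha i; have := hb i; have := ha j; have := hb j
    simp only [Finset.disjoint_insert_left, Finset.disjoint_singleton_left, Finset.mem_insert,
      Finset.mem_singleton, not_or]
    exact ⟨⟨hval (by omega), hval (by omega)⟩, hval (by omega), hval (by omega)⟩

lemma signalsLaw_not_pairAbove_le (h0 : 0 ≤ δ) (h1 : δ < 1 / 2) {J : ℕ} (hJ : 0 < J) {v : V}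
    (hv : 2 * J ≤ τ.depth v) :
    (signalsLaw V δ).real {X | ¬τ.PairAbove J X v} ≤ 16 / J := by
  have := isProbabilityMeasure_signalsLaw (V := V) h0 h1.le
  have hvh := τ.depth_le v
  have hex : ∀ i : Fin J, ∃ a b, τ.depth a + 2 * i + 1 = τ.depth v ∧
      τ.depth b + 2 * i + 2 = τ.depth v := by
    intro i
    have := i.2
    obtain ⟨a, ha⟩ := τ.exists_depth_eq (i := τ.depth v - 2 * i - 1) (by omega)
    obtain ⟨b, hb⟩ := τ.exists_depth_eq (i := τ.depth v - 2 * i - 2) (by omega)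
    exact ⟨a, b, by omega, by omega⟩
  choose a b ha hb using hex
  refine le_trans (measureReal_mono ?_) (signalsLaw_no_pair_le h0 h1 hJ a b ?_ ?_)
  · intro X hX i hXi
    have := i.2
    have hai := ha i
    have hbi := hb i
    refine hX ⟨i, i.2, by omega, ?_⟩
    rintro u (hu | hu)
    · rw [τ.depth_injective (show τ.depth u = τ.depth (a i) by omega)]; exact hXi.1
    · rw [τ.depth_injective (show τ.depth u = τ.depth (b i) by omega)]; exact hXi.2
  · intro i hi
    have := ha i
    have := hb i
    rw [hi] at *
    omega
  · intro i j hij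
    have hne : (i : ℕ) ≠ j := fun h => hij (Fin.ext h)
    have hval : ∀ {x y : V}, τ.depth x ≠ τ.depth y → x ≠ y := fun h h' => h (by rw [h'])
    have := ha i; have := hb i; have := ha j; have := hb j
    simp only [Finset.disjoint_insert_left, Finset.disjoint_singleton_left, Finset.mem_insert,
      Finset.mem_singleton, not_or]
    exact ⟨⟨hval (by omega), hval (by omega)⟩, hval (by omega), hval (by omega)⟩

/-- If a property of a node fails with probability at most `p`, except for few nodes, then the
expected number of nodes where it fails is small. -/
lemma integral_card_filter_le (h0 : 0 ≤ δ) (h1 : δ < 1 / 2) (Q : (V → Bool) → V → Prop)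
    (D : Finset V) {p : ℝ} (hp : 0 ≤ p)
    (hQ : ∀ v ∉ D, (signalsLaw V δ).real {X | Q X v} ≤ p) :
    ∫ X, ((Finset.univ.filter (Q X)).card : ℝ) ∂(signalsLaw V δ)
      ≤ Fintype.card V * p + D.card := by
  have := isProbabilityMeasure_signalsLaw (V := V) h0 h1.le
  have hcard : ∀ X, ((Finset.univ.filter (Q X)).card : ℝ)
      = ∑ v, {X | Q X v}.indicator (fun _ => (1 : ℝ)) X := by
    intro X
    simp [Set.indicator_apply]
  simp only [hcard]
  rw [integral_finsetSum _ fun v _ => Integrable.of_finite]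
  calc ∑ v, ∫ X, {X | Q X v}.indicator (fun _ => (1 : ℝ)) X ∂(signalsLaw V δ)
      ≤ ∑ v, (p + if v ∈ D then 1 else 0) := by
        refine Finset.sum_le_sum fun v _ => ?_
        rw [integral_indicator_const _ (Set.toFinite _).measurableSet, smul_eq_mul, mul_one]
        split_ifs with hv
        · have : (signalsLaw V δ).real {X | Q X v} ≤ 1 := measureReal_le_one
          linarith
        · simpa using hQ v hv
    _ = _ := by simp [Finset.sum_add_distrib]

end LevelTree

/-- On a long path, the process stabilizes in a correct majority with probability close to one. -/
theorem eventually_correctMajority_of_path (h0 : 0 < δ) (h1 : δ < 1 / 2) {ε : ℝ} (hε : 0 < ε) :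
    ∃ n₀ : ℕ, ∀ (V : Type*) [Fintype V] [Nonempty V]
      [MeasurableSpace V] [DiscreteMeasurableSpace V] (G : SimpleGraph V), IsBalancedTree G 1 →
      n₀ ≤ Fintype.card V →
      1 - ε ≤ (processLaw V δ).real {ω | StabilizesInCorrectMajority G ω.1 ω.2} := by
  -- The choice of `J` makes a node unpaired with probability at most `32 / J`; an unstable node can
  -- break the seals of the at most `4 * J + 1` nodes within distance `2 * J`.
  obtain ⟨J, hJ⟩ := exists_nat_gt (512 / (δ * ε))
  have hJ0 : (0 : ℝ) < J := lt_trans (by positivity) hJ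
  obtain ⟨n₀, hn₀⟩ := exists_time_nearly_stable h0.le h1 (1 + 1) (half_pos hε)
    (η := δ / (2 * (4 * J + 3))) (by positivity)
  obtain ⟨n₁, hn₁⟩ := exists_nat_gt (64 * J / (δ * ε))
  refine ⟨max n₀ n₁, fun V _ _ _ _ G hG hV => ?_⟩
  obtain ⟨h, ⟨τ⟩⟩ := hG.exists_levelTree
  have := isProbabilityMeasure_processLaw (V := V) h0.le h1.le
  have := isProbabilityMeasure_signalsLaw (V := V) h0.le h1.le
  have hn : (0 : ℝ) < Fintype.card V := by exact_mod_cast Fintype.card_pos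
  have hJn : 0 < J := by exact_mod_cast hJ0
  obtain ⟨t, ht⟩ := hn₀ V G τ.degree_le ((le_max_left _ _).trans hV)
  set η := δ / (2 * (4 * (J : ℝ) + 3)) with hη
  have hηδ : η * (4 * J + 3) = δ / 2 := by
    rw [hη]; field_simp
  set E := {ω : (V → Bool) × (ℕ → V) |
        (numCorrect (announcement G ω.1 ω.2 t) : ℝ) ≤ (1 / 2 + δ - 2 * η) * Fintype.card V ∨
        η * Fintype.card V ≤ (unstable G ω.1 (announcement G ω.1 ω.2 t)).card} with hE
  let F := {ω : (V → Bool) × (ℕ → V) |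
    δ / 4 * Fintype.card V ≤ ((Finset.univ.filter (τ.Unpaired J ω.1)).card : ℝ)}
  have hF : (processLaw V δ).real F ≤ ε / 2 := by
    rw [processLaw_real_eq h0.le h1.le (T := 0) fun X s s' _ => rfl]
    simp only [F, Set.mem_ofPred_eq, integral_const, probReal_univ, one_smul]
    -- Near the two ends of the path there is no room for the pairs.
    have hD : ((Finset.univ.filter fun v => h < τ.depth v + 2 * J ∨ τ.depth v < 2 * J).card : ℝ)
        ≤ 4 * J := by
      have hle : (Finset.univ.filter fun v => h < τ.depth v + 2 * J ∨ τ.depth v < 2 * J).card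
          ≤ 4 * J := by
        rw [← Finset.card_image_of_injective _ τ.depth_injective]
        refine (Finset.card_le_card
          (t := Finset.Ico (h + 1 - 2 * J) (h + 1) ∪ Finset.range (2 * J)) ?_).trans ?_
        · intro k hk
          simp only [Finset.mem_image, Finset.mem_filter, Finset.mem_univ, true_and] at hk
          obtain ⟨v, hv, rfl⟩ := hk
          have := τ.depth_le v
          simp only [Finset.mem_union, Finset.mem_Ico, Finset.mem_range]
          omega
        · refine (Finset.card_union_le _ _).trans ?_
          rw [Nat.card_Ico, Finset.card_range]
          omega
      exact_mod_cast hle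
    have hmean := LevelTree.integral_card_filter_le h0.le h1 (τ.Unpaired J)
      (Finset.univ.filter fun v => h < τ.depth v + 2 * J ∨ τ.depth v < 2 * J)
      (p := 32 / J) (by positivity) (by
        intro v hv
        simp only [Finset.mem_filter, Finset.mem_univ, true_and, not_or, not_lt] at hv
        have hb := τ.signalsLaw_not_pairBelow_le h0.le h1 hJn hv.1
        have ha := τ.signalsLaw_not_pairAbove_le h0.le h1 hJn hv.2
        calc (signalsLaw V δ).real {X | τ.Unpaired J X v}
            ≤ (signalsLaw V δ).real ({X | ¬τ.PairBelow J X v} ∪ {X | ¬τ.PairAbove J X v}) :=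
              measureReal_mono fun X hX => hX
          _ ≤ 16 / J + 16 / J := (measureReal_union_le _ _).trans (add_le_add hb ha)
          _ = 32 / J := by ring)
    have hmarkov := mul_meas_ge_le_integral_of_nonneg (μ := signalsLaw V δ)
      (f := fun X => ((Finset.univ.filter (τ.Unpaired J X)).card : ℝ))
      (Eventually.of_forall fun X => Nat.cast_nonneg _) Integrable.of_finite
      (δ / 4 * Fintype.card V)
    have hpos : 0 < δ / 4 * Fintype.card V := by positivity
    have e1 : Fintype.card V * (32 / J) ≤ δ * ε / 16 * Fintype.card V := by
      have : 32 / (J : ℝ) ≤ δ * ε / 16 := by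
        rw [div_le_iff₀ hJ0]
        rw [div_lt_iff₀ (by positivity)] at hJ
        linarith
      nlinarith
    have e2 : 4 * (J : ℝ) ≤ δ * ε / 16 * Fintype.card V := by
      have hV1 : (n₁ : ℝ) ≤ Fintype.card V := by exact_mod_cast (le_max_right _ _).trans hV
      rw [div_lt_iff₀ (by positivity)] at hn₁
      have := mul_le_mul_of_nonneg_right hV1 (by positivity : 0 ≤ δ * ε)
      linarith
    refine le_of_mul_le_mul_left (hmarkov.trans (hmean.trans ?_)) hpos
    linarith
  have hcompl : 1 - ε ≤ (processLaw V δ).real (E ∪ F)ᶜ := by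
    have h2 : (processLaw V δ).real ((E ∪ F) ∪ (E ∪ F)ᶜ) ≤ _ :=
      measureReal_union_le (E ∪ F) (E ∪ F)ᶜ
    have h3 : (processLaw V δ).real (E ∪ F) ≤ _ := measureReal_union_le E F
    rw [Set.union_compl_self, probReal_univ] at h2
    linarith
  refine hcompl.trans (processLaw_real_mono h0.le h1.le fun X s hs hω => ?_)
  simp only [hE, F, Set.mem_compl_iff, Set.mem_union, Set.mem_ofPred_eq, not_or, not_le] at hω
  obtain ⟨⟨hN, hU⟩, hQ⟩ := hω
  have hP := τ.isPersistent_isSealed X (announcement G X s t)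
  refine hP.stabilizesInCorrectMajority hs ?_
  have hI := τ.card_near_le (unstable G X (announcement G X s t)) (2 * J)
  have hPc : ({v | τ.IsSealed X (unstable G X (announcement G X s t)) v}ᶜ : Set V).ncard
      ≤ (Finset.univ.filter (τ.Unpaired J X)).card
        + (unstable G X (announcement G X s t)).card * (2 * (2 * J) + 1) := by
    refine le_trans ?_ (Nat.add_le_add_left hI _)
    rw [← Set.ncard_coe_finset, ← Set.ncard_coe_finset]
    refine (Set.ncard_le_ncard ?_).trans (Set.ncard_union_le _ _)
    intro v hv
    by_contra hcon
    simp only [Finset.coe_filter, Finset.mem_univ, true_and, Set.mem_union, Set.mem_ofPred_eq,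
      not_or, not_exists, not_and, LevelTree.Unpaired, not_not] at hcon
    refine hv (τ.isSealed_of_pairs hcon.1.1 hcon.1.2 fun u hu => ?_)
    have := hcon.2 u hu
    omega
  have hPc' : (({v | τ.IsSealed X (unstable G X (announcement G X s t)) v}ᶜ : Set V).ncard : ℝ)
      ≤ (Finset.univ.filter (τ.Unpaired J X)).card
        + (unstable G X (announcement G X s t)).card * (2 * (2 * J) + 1) := by
    exact_mod_cast hPc
  have hloss : (Fintype.card V : ℝ)
      + 2 * (({v | τ.IsSealed X (unstable G X (announcement G X s t)) v}ᶜ : Set V).ncard : ℝ)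
      < 2 * numCorrect (announcement G X s t) := by
    have e1 := mul_le_mul_of_nonneg_right hU.le (by positivity : (0 : ℝ) ≤ 2 * (2 * J) + 1)
    have e2 : η * Fintype.card V * (2 * (2 * J) + 1) = (δ / 2 - 2 * η) * Fintype.card V := by
      rw [← hηδ]; ring
    have e4 := mul_pos h0 hn
    nlinarith
  exact_mod_cast hloss

end Path

/-! ### Trees of large arity -/

section Leaves

variable {V : Type*}

lemma LevelTree.eq_parent_of_adj_leaf {G : SimpleGraph V} {M h : ℕ} (τ : LevelTree G M h) {u w : V}
    (hu : τ.depth u = h) (hw : G.Adj u w) : w = τ.parent u := by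
  rcases (τ.adj_iff u w).1 hw with h1 | h1
  · exact h1.2.symm
  · have := τ.depth_le w
    omega

/-- The indicator that `u` is not selected in the first `t` steps. -/
noncomputable def unselected (t : ℕ) (u : V) (s : ℕ → V) : ℝ :=
  if ∀ i ∈ Finset.range t, s i ≠ u then 1 else 0

lemma unselected_dependsOn {t T : ℕ} (ht : t ≤ T) (u : V) :
    DependsOn (unselected t u) (Finset.range T : Set ℕ) := by
  intro s s' h
  have : (∀ i ∈ Finset.range t, s i ≠ u) ↔ ∀ i ∈ Finset.range t, s' i ≠ u := by
    refine forall₂_congr fun i hi => ?_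
    rw [h i (by simp only [Finset.coe_range, Set.mem_Iio]; have := Finset.mem_range.1 hi; omega)]
  simp only [unselected, this]

lemma announcement_mem_dependsOn {G : SimpleGraph V} (P : Profile V → Prop) (X : V → Bool) (t : ℕ) :
    DependsOn (fun s : ℕ → V => P (announcement G X s t)) (Finset.range t : Set ℕ) := by
  intro s s' h
  have := announcement_congr G X (s := s) (s' := s') (t := t) fun i hi => h i (by simpa using hi)
  simp only [this]

variable [Fintype V]

lemma newAnnouncement_eq_signal {G : SimpleGraph V} {X : V → Bool} {c : Profile V} {v : V}
    (h : ∀ u, G.Adj v u → c u = none) : newAnnouncement G X c v = X v := by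
  have hf : field G c v = 0 := Finset.sum_eq_zero fun u _ => by
    split_ifs with hu
    · rw [h u hu, spin_none]
    · rfl
  rw [newAnnouncement_eq, pull, hf]
  cases X v <;> simp

namespace LevelTree

variable {G : SimpleGraph V} {M h : ℕ} (τ : LevelTree G M h)

/-- The sum of the spins of the children of `v`. -/
noncomputable def childSpin (c : Profile V) (v : V) : ℤ := ∑ u ∈ τ.childFinset v, spin (c u)

/-- A parent of leaves which announces Correct, with a margin of at least two among its children.
It never changes its mind again, as its children can only join it. -/
def IsLocked (c : Profile V) (v : V) : Prop :=
  τ.depth v + 1 = h ∧ c v = some true ∧ 2 ≤ τ.childSpin c v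

lemma childSpin_mono {c c' : Profile V} {v : V}
    (h : ∀ u ∈ τ.childFinset v, spin (c u) ≤ spin (c' u)) : τ.childSpin c v ≤ τ.childSpin c' v :=
  Finset.sum_le_sum h

lemma childSpin_sub_one_le_field (c : Profile V) (v : V) :
    τ.childSpin c v - 1 ≤ field G c v := by
  have h1 : field G c v = ∑ u ∈ Finset.univ.filter (G.Adj v), spin (c u) := by
    rw [field, Finset.sum_filter]
  have hsub : τ.childFinset v ⊆ Finset.univ.filter (G.Adj v) := fun u hu => by
    rw [Finset.mem_filter]
    exact ⟨Finset.mem_univ _, (τ.adj_iff v u).2 (Or.inr (τ.mem_childFinset.1 hu))⟩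
  have hdiff : (Finset.univ.filter (G.Adj v) \ τ.childFinset v).card ≤ 1 := by
    rw [Finset.card_le_one]
    intro a ha b hb
    have : ∀ a ∈ Finset.univ.filter (G.Adj v) \ τ.childFinset v, a = τ.parent v := by
      intro a ha
      simp only [Finset.mem_sdiff, Finset.mem_filter, Finset.mem_univ, true_and,
        mem_childFinset] at ha
      rcases (τ.adj_iff v a).1 ha.1 with h1 | h1
      · exact h1.2.symm
      · exact absurd h1 ha.2
    rw [this a ha, this b hb]
  rw [h1, ← Finset.sum_sdiff hsub, childSpin]
  have : -1 ≤ ∑ u ∈ Finset.univ.filter (G.Adj v) \ τ.childFinset v, spin (c u) := by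
    calc (-1 : ℤ) ≤ -((Finset.univ.filter (G.Adj v) \ τ.childFinset v).card : ℤ) := by
          have : ((Finset.univ.filter (G.Adj v) \ τ.childFinset v).card : ℤ) ≤ 1 := by
            exact_mod_cast hdiff
          linarith
      _ = ∑ u ∈ Finset.univ.filter (G.Adj v) \ τ.childFinset v, (-1 : ℤ) := by simp
      _ ≤ _ := Finset.sum_le_sum fun u _ => neg_one_le_spin _
  linarith

lemma newAnnouncement_of_childSpin (X : V → Bool) {c : Profile V} {v : V}
    (h2 : 2 ≤ τ.childSpin c v) : newAnnouncement G X c v = true := by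
  have := τ.childSpin_sub_one_le_field c v
  rw [newAnnouncement_eq, decide_eq_true_iff, pull]
  cases X v <;> simp <;> omega

lemma newAnnouncement_leaf (X : V → Bool) {c : Profile V} {u : V} (hu : τ.depth u = h)
    (hu0 : τ.depth u ≠ 0) (hc : c (τ.parent u) = some true) : newAnnouncement G X c u = true := by
  have hpos : (0 : ℤ) < field G c u := by
    have : field G c u = ∑ w, if w = τ.parent u then 1 else 0 := by
      refine Finset.sum_congr rfl fun w _ => ?_
      by_cases hw : w = τ.parent u
      · subst hw
        rw [if_pos (τ.adj_parent hu0), if_pos rfl, hc]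
        rfl
      · rw [if_neg hw, if_neg fun h => hw (τ.eq_parent_of_adj_leaf hu h)]
    rw [this]
    simp
  rw [newAnnouncement_eq, decide_eq_true_iff, pull]
  cases X u <;> simp <;> omega

lemma isPersistent_isLocked (X : V → Bool) (c : Profile V) : IsPersistent G X c
    {v | τ.IsLocked c v ∨ ∃ w, τ.IsLocked c w ∧ v ∈ τ.childFinset w} := by
  rintro v hv c' hc'
  suffices newAnnouncement G X c' v = true by
    rw [this]
    exact spin_le_one _
  rcases hv with hv | ⟨w, hw, hvw⟩
  · refine τ.newAnnouncement_of_childSpin X (hv.2.2.trans (τ.childSpin_mono fun u hu => ?_))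
    exact hc' u (Or.inr ⟨v, hv, hu⟩)
  · have h1 := hc' w (Or.inl hw)
    rw [hw.2.1] at h1
    rw [mem_childFinset] at hvw
    have := hw.1
    refine τ.newAnnouncement_leaf X (by omega) (by omega) ?_
    rw [hvw.2]
    exact eq_some_true_of_one_le (by simpa using h1)

lemma IsLocked.later {τ : LevelTree G M h} {X : V → Bool} {s : ℕ → V} {t t' : ℕ} (ht : t ≤ t')
    {v : V} (hv : τ.IsLocked (announcement G X s t) v) :
    τ.IsLocked (announcement G X s t') v := by
  have h1 := (τ.isPersistent_isLocked X (announcement G X s t)).le_announcement ht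
  refine ⟨hv.1, ?_, hv.2.2.trans (τ.childSpin_mono fun u hu => h1 u (Or.inr ⟨v, hv, hu⟩))⟩
  have h2 := h1 v (Or.inl hv)
  rw [hv.2.1] at h2
  exact eq_some_true_of_one_le (by simpa using h2)

/-- Until its parent is selected, a selected leaf announces its signal. -/
lemma announcement_leaf (X : V → Bool) (s : ℕ → V) {u : V} (hu : τ.depth u = h) {t : ℕ}
    (hp : ∀ i < t, s i ≠ τ.parent u) :
    announcement G X s t u = if ∃ i < t, s i = u then some (X u) else none := by
  induction t with
  | zero => simp [announcement]
  | succ t ih =>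
    have ih' := ih fun i hi => hp i (by omega)
    rw [announcement]
    by_cases hut : u = s t
    · rw [if_pos ⟨t, Nat.lt_succ_self t, hut.symm⟩, ← hut, step_self, newAnnouncement_eq_signal]
      intro w hw
      rw [τ.eq_parent_of_adj_leaf hu hw, announcement_eq_none_iff]
      exact fun i hi => hp i (by omega)
    · rw [step_of_ne _ _ _ hut, ih']
      congr 1
      refine propext ⟨fun ⟨i, hi, hiu⟩ => ⟨i, by omega, hiu⟩, fun ⟨i, hi, hiu⟩ => ⟨i, ?_, hiu⟩⟩
      rcases Nat.lt_succ_iff_lt_or_eq.1 hi with h1 | rfl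
      · exact h1
      · exact absurd hiu.symm hut

/-- The children of `v` selected before the first selection of `v`. -/
noncomputable def earlyChildren (s : ℕ → V) (v : V) : Finset V :=
  (τ.childFinset v).filter fun u => ∃ t, s t = u ∧ ∀ i ≤ t, s i ≠ v

/-- If the signals of the early children have a margin of at least two, then `v` is locked from its
first selection on. -/
lemma isLocked_of_earlyChildren (X : V → Bool) (s : ℕ → V) {v : V} (hv : τ.depth v + 1 = h) {t : ℕ}
    (hsel : ∃ i < t, s i = v) (hX : 2 ≤ ∑ u ∈ τ.earlyChildren s v, signalSpin (X u)) :
    τ.IsLocked (announcement G X s t) v := by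
  have hfirst : ∃ i, s i = v := ⟨_, hsel.choose_spec.2⟩
  have hlt : Nat.find hfirst < t :=
    lt_of_le_of_lt (Nat.find_min' hfirst hsel.choose_spec.2) hsel.choose_spec.1
  have hmin : ∀ i < Nat.find hfirst, s i ≠ v := fun i hi => Nat.find_min hfirst hi
  have hs : s (Nat.find hfirst) = v := Nat.find_spec hfirst
  generalize Nat.find hfirst = k at *
  have hchild : ∀ u ∈ τ.childFinset v, spin (announcement G X s k u)
      = if u ∈ τ.earlyChildren s v then signalSpin (X u) else 0 := by
    intro u hu
    have hu' := τ.mem_childFinset.1 hu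
    rw [τ.announcement_leaf X s (by omega) (by rw [hu'.2]; exact hmin)]
    have hiff : (∃ i < k, s i = u) ↔ u ∈ τ.earlyChildren s v := by
      rw [earlyChildren, Finset.mem_filter]
      constructor
      · rintro ⟨i, hi, hiu⟩
        exact ⟨hu, i, hiu, fun j hj => hmin j (by omega)⟩
      · rintro ⟨-, i, hiu, hi⟩
        refine ⟨i, ?_, hiu⟩
        by_contra hle
        exact hi k (by omega) hs
    by_cases hmem : u ∈ τ.earlyChildren s v
    · rw [if_pos hmem, if_pos (hiff.2 hmem), spin_some]
    · rw [if_neg hmem, if_neg fun h => hmem (hiff.1 h), spin_none]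
  have hsum : τ.childSpin (announcement G X s k) v
      = ∑ u ∈ τ.earlyChildren s v, signalSpin (X u) := by
    rw [childSpin, Finset.sum_congr rfl hchild, ← Finset.sum_filter]
    congr 1
    ext u
    rw [Finset.mem_filter]
    exact ⟨fun h => h.2, fun h => ⟨(Finset.mem_filter.1 h).1, h⟩⟩
  have hlock : τ.IsLocked (announcement G X s (k + 1)) v := by
    refine ⟨hv, ?_, ?_⟩
    · rw [announcement, hs, step_self, τ.newAnnouncement_of_childSpin X (by rw [hsum]; exact hX)]
    · rw [← hsum] at hX
      refine hX.trans (τ.childSpin_mono fun u hu => ?_)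
      have hu' := τ.mem_childFinset.1 hu
      rw [announcement, hs, step_of_ne]
      rintro rfl
      omega
  exact hlock.later (by omega)

/-- If most parents of leaves are locked, the process ends in a correct majority. -/
lemma stabilizesInCorrectMajority_of_locked (hM : 4 ≤ M) (hh : 1 ≤ h) {X : V → Bool} {s : ℕ → V}
    {t : ℕ} (hs : ∀ v, ∀ a, ∃ t ≥ a, s t = v)
    (hlock : 4 * ((τ.level (h - 1)).filter
      fun v => ¬τ.IsLocked (announcement G X s t) v).card ≤ M ^ (h - 1)) :
    StabilizesInCorrectMajority G X s := by
  obtain ⟨t', ht', hstab⟩ := exists_stable G X s hs t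
  refine ⟨t', hstab, ?_⟩
  rw [IsCorrectMajority, ← numCorrect_eq_ncard, Nat.card_eq_fintype_card]
  set D := (τ.level (h - 1)).filter fun v => τ.IsLocked (announcement G X s t) v with hD
  have hDcard : 4 * D.card ≥ 3 * M ^ (h - 1) := by
    have : D.card + ((τ.level (h - 1)).filter
        fun v => ¬τ.IsLocked (announcement G X s t) v).card = (τ.level (h - 1)).card :=
      Finset.card_filter_add_card_filter_not _
    rw [τ.card_level (by omega)] at this
    omega
  have hsub : D.biUnion τ.childFinset
      ⊆ Finset.univ.filter fun v => announcement G X s t' v = some true := by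
    intro u hu
    rw [Finset.mem_biUnion] at hu
    obtain ⟨v, hv, huv⟩ := hu
    rw [hD, Finset.mem_filter, mem_level] at hv
    rw [mem_childFinset] at huv
    rw [Finset.mem_filter]
    refine ⟨Finset.mem_univ _, ?_⟩
    have h1 := hstab u
    rw [step_eq_iff] at h1
    rw [h1, τ.newAnnouncement_leaf X (by omega) (by omega)]
    rw [huv.2]
    exact (hv.2.later ht').2.1
  have hcard : D.card * M ≤ numCorrect (announcement G X s t') := by
    rw [numCorrect]
    refine le_trans (le_of_eq ?_) (Finset.card_le_card hsub)
    rw [Finset.card_biUnion, Finset.sum_congr rfl fun v hv => τ.card_childFinset (v := v) (by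
      rw [hD, Finset.mem_filter, mem_level] at hv; omega), Finset.sum_const, smul_eq_mul]
    intro v _ w _ hvw
    rw [Function.onFun, Finset.disjoint_left]
    intro u hu hu'
    rw [mem_childFinset] at hu hu'
    exact hvw (hu.2.symm.trans hu'.2)
  -- The children of at least three quarters of the parents of leaves announce Correct, and for
  -- `M ≥ 4` at least three quarters of the nodes are leaves: together these are more than one half.
  have hn : 3 * Fintype.card V ≤ 4 * M ^ h := by
    rw [τ.card_eq]
    have : ∀ k, 3 * ∑ i ∈ Finset.range (k + 1), M ^ i ≤ 4 * M ^ k := by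
      intro k
      induction k with
      | zero => simp
      | succ k ih =>
        rw [Finset.sum_range_succ, mul_add, pow_succ]
        have : 4 * M ^ k ≤ M ^ k * M := by rw [mul_comm]; exact Nat.mul_le_mul_left _ hM
        omega
    exact this h
  have hpow : M ^ h = M ^ (h - 1) * M := by
    rw [← pow_succ]; congr 1; omega
  have h3 : 3 * M ^ h ≤ 4 * (D.card * M) := by
    rw [hpow]
    calc 3 * (M ^ (h - 1) * M) = (3 * M ^ (h - 1)) * M := by ring
      _ ≤ (4 * D.card) * M := Nat.mul_le_mul_right _ hDcard
      _ = _ := by ring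
  have hpos : 0 < M ^ h := Nat.pow_pos (by omega)
  omega

end LevelTree

variable {δ : ℝ}

/-- The signals of many nodes have a margin of at least two, with high probability. -/
lemma signalsLaw_margin_le (h0 : 0 < δ) (h1 : δ < 1 / 2) (A : Finset V) {k : ℝ} (hk : 2 ≤ δ * k)
    (hA : k ≤ A.card) :
    (signalsLaw V δ).real {X | ∑ u ∈ A, signalSpin (X u) < 2} ≤ 4 / (δ ^ 2 * k) := by
  have := isProbabilityMeasure_signalsLaw (V := V) h0.le h1.le
  let f : A → (V → Bool) → ℝ := fun u X => if X u = true then 1 else 0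
  have hk0 : 0 < k := by
    by_contra hle
    push Not at hle
    nlinarith
  have hApos : (0 : ℝ) < A.card := hk0.trans_le hA
  have hvar := variance_sum_le h0.le h1.le f (fun u => {u.1}) (fun u X X' h => by
      have : X u = X' u := h _ (by simp)
      simp [f, this])
    (fun u X => by simp only [f]; split_ifs <;> simp)
    (fun u X => by simp only [f]; split_ifs <;> simp)
  have hcount : (∑ i : A, ∑ j : A, if Disjoint ({i.1} : Finset V) {j.1} then (0 : ℝ) else 1)
      = A.card := by
    simp
  have hr : 0 < δ * A.card / 2 := by positivity
  have hE : (A.card / 2 + 1 : ℝ) + δ * A.card / 2 ≤ ∫ X, (∑ u, f u) X ∂(signalsLaw V δ) := by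
    simp only [Finset.sum_apply]
    rw [integral_finsetSum _ fun i _ => Integrable.of_finite]
    have hkA : 2 ≤ δ * A.card := hk.trans (mul_le_mul_of_nonneg_left hA h0.le)
    calc (A.card / 2 + 1 : ℝ) + δ * A.card / 2 ≤ A.card * (1 / 2 + δ) := by linarith
      _ = ∑ _u : A, (1 / 2 + δ) := by simp; ring
      _ ≤ _ := Finset.sum_le_sum fun u _ => le_integral_signal h0.le h1 u.1
  have hch := signalsLaw_real_le_of_variance h0.le h1.le (∑ u, f u) hr hE
  calc _ ≤ (signalsLaw V δ).real {X | (∑ u, f u) X ≤ (A.card / 2 + 1 : ℝ)} := by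
        refine measureReal_mono fun X hX => ?_
        simp only [Set.mem_ofPred_eq, Finset.sum_apply] at hX ⊢
        have hX' : ∑ u ∈ A, (signalSpin (X u) : ℝ) ≤ 2 := by exact_mod_cast hX.le
        have hspin : ∀ u, (signalSpin (X u) : ℝ) = 2 * (if X u = true then (1 : ℝ) else 0) - 1 := by
          intro u
          cases X u <;> norm_num
        simp only [hspin, Finset.sum_sub_distrib, ← Finset.mul_sum, Finset.sum_const,
          nsmul_eq_mul, mul_one] at hX'
        have hcoe : ∑ u : A, f u X = ∑ u ∈ A, if X u = true then (1 : ℝ) else 0 :=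
          Finset.sum_coe_sort A fun u => if X u = true then (1 : ℝ) else 0
        rw [hcoe]
        linarith
    _ ≤ A.card / (δ * A.card / 2) ^ 2 := hch.trans (by gcongr; exact hvar.trans hcount.le)
    _ = 4 / (δ ^ 2 * A.card) := by field_simp; norm_num
    _ ≤ 4 / (δ ^ 2 * k) := by gcongr

/-- Here `β` plays the role of the probability of not being selected by time `t₀`. Given the
selections, a parent `v` of leaves fails to be locked at time `t₁` only if it is selected before
`t₀` or not at all, or if unusually few of its children are selected before `t₀`, or if the early
children have atypical signals. -/
lemma LevelTree.signalsLaw_not_isLocked_le {G : SimpleGraph V} {M h : ℕ} (τ : LevelTree G M h)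
    (h0 : 0 < δ) (h1 : δ < 1 / 2) {v : V} (hv : τ.depth v + 1 = h)
    {k β : ℝ} (hk0 : 0 < k) (hk : 2 ≤ δ * k) (hkβ : 2 * k ≤ M * (1 - β)) (t₀ t₁ : ℕ) (s : ℕ → V) :
    (signalsLaw V δ).real {X | ¬τ.IsLocked (announcement G X s t₁) v}
      ≤ 4 / (δ ^ 2 * k) + unselected t₁ v s + (1 - unselected t₀ v s)
        + ((∑ u ∈ τ.childFinset v, unselected t₀ u s) - M * β) ^ 2 / k ^ 2 := by
  have := isProbabilityMeasure_signalsLaw (V := V) h0.le h1.le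
  have hp1 : (signalsLaw V δ).real {X | ¬τ.IsLocked (announcement G X s t₁) v} ≤ 1 :=
    measureReal_le_one
  have hA : 0 ≤ 4 / (δ ^ 2 * k) := by positivity
  have hu : ∀ t, 0 ≤ unselected t v s ∧ unselected t v s ≤ 1 := fun t => by
    rw [unselected]; split_ifs <;> simp
  set Y := ∑ u ∈ τ.childFinset v, unselected t₀ u s with hY
  have hD : 0 ≤ (Y - M * β) ^ 2 / k ^ 2 := by positivity
  by_cases hsel : ∃ i < t₁, s i = v
  swap
  · have : unselected t₁ v s = 1 := if_pos fun i hi hiv => hsel ⟨i, Finset.mem_range.1 hi, hiv⟩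
    linarith [hu t₀]
  by_cases hearly : ∀ i ∈ Finset.range t₀, s i ≠ v
  swap
  · have : unselected t₀ v s = 0 := if_neg hearly
    linarith [hu t₁]
  by_cases hcard : k ≤ (τ.earlyChildren s v).card
  · have hm := signalsLaw_margin_le h0 h1 (τ.earlyChildren s v) hk hcard
    have hle : (signalsLaw V δ).real {X | ¬τ.IsLocked (announcement G X s t₁) v}
        ≤ (signalsLaw V δ).real {X | ∑ u ∈ τ.earlyChildren s v, signalSpin (X u) < 2} := by
      refine measureReal_mono fun X hX => ?_
      rw [Set.mem_ofPred_eq, ← not_le]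
      exact fun h2 => hX (τ.isLocked_of_earlyChildren X s hv hsel h2)
    linarith [hu t₀, hu t₁]
  -- Every child selected before `t₀` is early, as `v` itself is not selected before `t₀`.
  · have hsub : (M : ℝ) - Y ≤ (τ.earlyChildren s v).card := by
      have hM : (M : ℝ) = ∑ _u ∈ τ.childFinset v, (1 : ℝ) := by
        rw [Finset.sum_const, τ.card_childFinset (by omega), nsmul_eq_mul, mul_one]
      rw [hM, hY, ← Finset.sum_sub_distrib, earlyChildren, Finset.card_filter, Nat.cast_sum]
      refine Finset.sum_le_sum fun u _ => ?_
      by_cases hu' : ∀ i ∈ Finset.range t₀, s i ≠ u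
      · rw [unselected, if_pos hu', sub_self]
        exact Nat.cast_nonneg _
      · rw [unselected, if_neg hu', if_pos]
        · simp
        · push Not at hu'
          obtain ⟨i, hi, hiu⟩ := hu'
          refine ⟨i, hiu, fun j hj => hearly j ?_⟩
          rw [Finset.mem_range] at hi ⊢
          omega
    have hdev : k ≤ Y - M * β := by linarith
    have : 1 ≤ (Y - M * β) ^ 2 / k ^ 2 := by
      rw [one_le_div (by positivity)]
      exact pow_le_pow_left₀ hk0.le hdev 2
    linarith [hu t₀, hu t₁]

variable [Nonempty V] [MeasurableSpace V] [DiscreteMeasurableSpace V]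

lemma integral_avoid (t : ℕ) (A : Set V) :
    ∫ s, (if ∀ i ∈ Finset.range t, s i ∉ A then (1 : ℝ) else 0) ∂(selectionsLaw V)
      = (1 - A.ncard / Fintype.card V) ^ t := by
  have h := selectionsLaw_avoid (Finset.range t) A
  rw [Finset.card_range] at h
  have hdep : DependsOn (fun s : ℕ → V => ∀ i ∈ Finset.range t, s i ∉ A)
      (Finset.range t : Set ℕ) := fun s s' h => by
    refine propext (forall₂_congr fun i hi => ?_)
    rw [h i (Finset.mem_coe.2 hi)]
  have hmeas : MeasurableSet {s : ℕ → V | ∀ i ∈ Finset.range t, s i ∉ A} :=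
    measurableSet_setOfPred.2 (measurable_of_dependsOn_range hdep)
  rw [← h, ← integral_indicator_one hmeas]
  refine integral_congr_ae (Eventually.of_forall fun s => ?_)
  simp [Set.indicator_apply]

lemma integral_unselected (t : ℕ) (u : V) :
    ∫ s, unselected t u s ∂(selectionsLaw V) = (1 - 1 / Fintype.card V) ^ t := by
  have := integral_avoid t ({u} : Set V)
  simpa [unselected] using this

lemma integral_unselected_mul_le (t : ℕ) {u w : V} (huw : u ≠ w) :
    ∫ s, unselected t u s * unselected t w s ∂(selectionsLaw V)
      ≤ ((1 - 1 / Fintype.card V) ^ t) ^ 2 := by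
  have h := integral_avoid t ({u, w} : Set V)
  rw [Set.ncard_pair huw] at h
  have heq : ∀ s : ℕ → V, unselected t u s * unselected t w s
      = if ∀ i ∈ Finset.range t, s i ∉ ({u, w} : Set V) then (1 : ℝ) else 0 := by
    intro s
    by_cases h1 : ∀ i ∈ Finset.range t, s i ≠ u
    · by_cases h2 : ∀ i ∈ Finset.range t, s i ≠ w
      · have h3 : ∀ i ∈ Finset.range t, s i ∉ ({u, w} : Set V) := fun i hi => by
          simp [h1 i hi, h2 i hi]
        rw [unselected, unselected, if_pos h1, if_pos h2, if_pos h3, one_mul]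
      · have h3 : ¬∀ i ∈ Finset.range t, s i ∉ ({u, w} : Set V) := fun h => h2 fun i hi hiw =>
          h i hi (by simp [hiw])
        rw [unselected, unselected, if_pos h1, if_neg h2, if_neg h3, mul_zero]
    · have h3 : ¬∀ i ∈ Finset.range t, s i ∉ ({u, w} : Set V) := fun h => h1 fun i hi hiw =>
        h i hi (by simp [hiw])
      rw [unselected, if_neg h1, if_neg h3, zero_mul]
  have h' : ∫ s, unselected t u s * unselected t w s ∂(selectionsLaw V)
      = (1 - (2 : ℕ) / Fintype.card V) ^ t := by
    simp only [heq]
    convert h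
  rw [h', ← pow_mul, mul_comm t 2, pow_mul]
  have hn : (2 : ℝ) ≤ Fintype.card V := by
    have : Nontrivial V := ⟨u, w, huw⟩
    exact_mod_cast Fintype.one_lt_card
  have hn0 : (0 : ℝ) < Fintype.card V := by linarith
  refine pow_le_pow_left₀ ?_ ?_ t
  · rw [sub_nonneg, div_le_one hn0]
    exact_mod_cast hn
  · have : 0 ≤ (1 / (Fintype.card V : ℝ)) ^ 2 := sq_nonneg _
    push_cast
    rw [show (2 : ℝ) / Fintype.card V = 2 * (1 / Fintype.card V) by ring]
    nlinarith

/-- The variance of the number of unselected nodes in a set is at most the size of the set, since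
the nodes are negatively correlated. -/
lemma integral_sq_unselected_le (t : ℕ) (C : Finset V) :
    ∫ s, ((∑ u ∈ C, unselected t u s) - (C.card : ℝ) * (1 - 1 / (Fintype.card V : ℝ)) ^ t) ^ 2
      ∂(selectionsLaw V) ≤ (C.card : ℝ) := by
  set β : ℝ := (1 - 1 / (Fintype.card V : ℝ)) ^ t with hβ
  have hn1 : (1 : ℝ) ≤ Fintype.card V := by exact_mod_cast Nat.succ_le_of_lt Fintype.card_pos
  have hq : 0 ≤ 1 - 1 / (Fintype.card V : ℝ) := by
    rw [sub_nonneg, div_le_one (by linarith)]; exact hn1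
  have hβ0 : 0 ≤ β := pow_nonneg hq t
  have hβ1 : β ≤ 1 := pow_le_one₀ hq (by
    have : 0 ≤ 1 / (Fintype.card V : ℝ) := by positivity
    linarith)
  have hdep := fun u : V => unselected_dependsOn (le_refl t) u
  have hexp : ∀ s : ℕ → V, ((∑ u ∈ C, unselected t u s) - C.card * β) ^ 2
      = (∑ u ∈ C, ∑ w ∈ C, unselected t u s * unselected t w s)
        + (-(2 * C.card * β)) * (∑ u ∈ C, unselected t u s) + (C.card * β) ^ 2 := by
    intro s
    rw [← Finset.sum_mul_sum]
    ring
  have hi1 : ∀ u : V, Integrable (unselected t u) (selectionsLaw V) := fun u =>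
    integrable_of_dependsOn_range (hdep u)
  have hi2 : ∀ u w : V, Integrable (fun s => unselected t u s * unselected t w s)
      (selectionsLaw V) := fun u w => integrable_of_dependsOn_range (T := t) fun s s' h => by
    simp only [hdep u h, hdep w h]
  simp only [hexp]
  rw [integral_add, integral_add, integral_const_mul, integral_finsetSum, integral_finsetSum]
  · simp only [integral_unselected, integral_const, probReal_univ, one_smul, Finset.sum_const,
      nsmul_eq_mul]
    have hpair : ∑ u ∈ C, ∫ s, ∑ w ∈ C, unselected t u s * unselected t w s ∂(selectionsLaw V)
        ≤ ∑ u ∈ C, ∑ w ∈ C, (β ^ 2 + if u = w then β else 0) := by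
      refine Finset.sum_le_sum fun u _ => ?_
      rw [integral_finsetSum _ fun w _ => hi2 u w]
      refine Finset.sum_le_sum fun w _ => ?_
      by_cases huw : u = w
      · subst huw
        have : ∀ s : ℕ → V, unselected t u s * unselected t u s = unselected t u s := by
          intro s
          simp only [unselected]
          split_ifs <;> simp
        simp only [this, if_true]
        rw [integral_unselected, ← hβ]
        have := sq_nonneg β
        linarith
      · simp only [huw, if_false, add_zero]
        exact integral_unselected_mul_le t huw
    have hval : ∑ u ∈ C, ∑ w ∈ C, (β ^ 2 + if u = w then β else 0)
        = (C.card * β) ^ 2 + C.card * β := by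
      simp only [Finset.sum_add_distrib, Finset.sum_const, nsmul_eq_mul, Finset.sum_ite_eq]
      rw [Finset.sum_congr rfl fun u hu => if_pos hu]
      simp only [Finset.sum_const, nsmul_eq_mul]
      ring
    rw [hval] at hpair
    have hc : (0 : ℝ) ≤ C.card := Nat.cast_nonneg _
    nlinarith
  · exact fun u _ => hi1 u
  · exact fun u _ => integrable_finsetSum _ fun w _ => hi2 u w
  · exact integrable_finsetSum _ fun u _ => integrable_finsetSum _ fun w _ => hi2 u w
  · exact (integrable_finsetSum _ fun u _ => hi1 u).const_mul _
  · exact (integrable_finsetSum _ fun u _ => integrable_finsetSum _ fun w _ => hi2 u w).add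
      ((integrable_finsetSum _ fun u _ => hi1 u).const_mul _)
  · exact integrable_const _

lemma exists_pow_mem_Icc {q ρ : ℝ} (hq0 : 0 ≤ q) (hq1 : q < 1) (hρ : 0 < ρ) (hρ1 : ρ < 1)
    (hq : 1 - ρ ≤ q) : ∃ t, 1 - 2 * ρ ≤ q ^ t ∧ q ^ t ≤ 1 - ρ := by
  have hex : ∃ t, q ^ t ≤ 1 - ρ := (exists_pow_lt_of_lt_one (by linarith) hq1).imp fun _ => le_of_lt
  refine ⟨Nat.find hex, ?_, Nat.find_spec hex⟩
  have hmin := fun m => Nat.find_min hex (m := m)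
  have hspec := Nat.find_spec hex
  generalize Nat.find hex = t at *
  rcases t with _ | t
  · rw [pow_zero] at hspec
    linarith
  · have h1 := hmin t (Nat.lt_succ_self t)
    rw [not_le] at h1
    rw [pow_succ]
    nlinarith

namespace LevelTree

variable {G : SimpleGraph V} {M h : ℕ} (τ : LevelTree G M h)

/-- The expectation of the bound of `signalsLaw_not_isLocked_le` over the selections. -/
lemma integral_not_isLocked_bound_le {v : V} (hv : τ.depth v + 1 = h) {k : ℝ} (A : ℝ)
    (t₀ t₁ : ℕ) :
    Integrable (fun s => A + unselected t₁ v s + (1 - unselected t₀ v s)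
        + ((∑ u ∈ τ.childFinset v, unselected t₀ u s)
          - M * (1 - 1 / (Fintype.card V : ℝ)) ^ t₀) ^ 2 / k ^ 2) (selectionsLaw V) ∧
    ∫ s, (A + unselected t₁ v s + (1 - unselected t₀ v s)
        + ((∑ u ∈ τ.childFinset v, unselected t₀ u s)
          - M * (1 - 1 / (Fintype.card V : ℝ)) ^ t₀) ^ 2 / k ^ 2) ∂(selectionsLaw V)
      ≤ A + (1 - 1 / (Fintype.card V : ℝ)) ^ t₁ + (1 - (1 - 1 / (Fintype.card V : ℝ)) ^ t₀)
        + M / k ^ 2 := by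
  have hi : ∀ (t : ℕ) (u : V), Integrable (unselected t u) (selectionsLaw V) := fun t u =>
    integrable_of_dependsOn_range (unselected_dependsOn (le_refl t) u)
  have hi2 : Integrable (fun s => ((∑ u ∈ τ.childFinset v, unselected t₀ u s)
      - M * (1 - 1 / (Fintype.card V : ℝ)) ^ t₀) ^ 2 / k ^ 2) (selectionsLaw V) :=
    integrable_of_dependsOn_range (T := t₀) fun s s' h => by
      simp only [fun u : V => unselected_dependsOn (le_refl t₀) u h]
  have hc : ∀ c : ℝ, Integrable (fun _ : ℕ → V => c) (selectionsLaw V) := integrable_const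
  have hs1 := (hc A).add (hi t₁ v)
  have hs2 := (hc 1).sub (hi t₀ v)
  refine ⟨(hs1.add hs2).add hi2, ?_⟩
  have hsq := integral_sq_unselected_le t₀ (τ.childFinset v)
  rw [τ.card_childFinset (by omega)] at hsq
  have e1 := integral_add (hs1.add hs2) hi2
  have e2 := integral_add hs1 hs2
  have e3 := integral_add (hc A) (hi t₁ v)
  have e4 := integral_sub (hc 1) (hi t₀ v)
  simp only [Pi.add_apply, Pi.sub_apply] at e1 e2 e3 e4
  rw [e1, e2, e3, e4, integral_unselected, integral_unselected, integral_div]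
  simp only [integral_const, probReal_univ, one_smul]
  gcongr

end LevelTree

/-- If the arity is large, then with high probability almost all parents of leaves are locked
eventually: most are not selected for a while, in which many of their children announce their
signals. -/
theorem eventually_correctMajority_of_large_arity {δ : ℝ} (h0 : 0 < δ) (h1 : δ < 1 / 2) {ε : ℝ}
    (hε : 0 < ε) :
    ∃ M₀ : ℕ, ∀ (V : Type*) [Fintype V] [Nonempty V] [MeasurableSpace V]
      [DiscreteMeasurableSpace V] (G : SimpleGraph V) (M : ℕ), IsBalancedTree G M → M₀ ≤ M →
      2 ≤ Fintype.card V →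
      1 - ε ≤ (processLaw V δ).real {ω | StabilizesInCorrectMajority G ω.1 ω.2} := by
  -- A parent of leaves is selected before time `t₀` with a probability in `[ρ, 2 * ρ]`, and remains
  -- unselected until `t₁` with probability at most `ρ`; about `ρ * M` of its children are selected
  -- before `t₀`. In all, it fails to be locked with probability at most `5 * ρ`.
  obtain ⟨ρ, hρ0, hρ⟩ : ∃ ρ : ℝ, 0 < ρ ∧ ρ ≤ 1 / 2 ∧ 20 * ρ ≤ ε :=
    ⟨min (1 / 2) (ε / 20), by positivity, min_le_left _ _, by
      linarith [min_le_right (1 / 2 : ℝ) (ε / 20)]⟩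
  obtain ⟨hρ1, hρε⟩ := hρ
  obtain ⟨a, ha⟩ := exists_nat_gt (8 / (δ ^ 2 * ρ ^ 2))
  obtain ⟨b, hb⟩ := exists_nat_gt (4 / ρ ^ 3)
  obtain ⟨c, hc⟩ := exists_nat_gt (4 / (δ * ρ))
  obtain ⟨d, hd⟩ := exists_nat_gt (1 / ρ)
  refine ⟨4 + a + b + c + d, fun V _ _ _ _ G M hG hMM hV => ?_⟩
  obtain ⟨h, ⟨τ⟩⟩ := hG.exists_levelTree
  have := isProbabilityMeasure_signalsLaw (V := V) h0.le h1.le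
  have := isProbabilityMeasure_processLaw (V := V) h0.le h1.le
  have hcast : (4 + a + b + c + d : ℝ) ≤ M := by exact_mod_cast hMM
  have hM0 : (0 : ℝ) < M := by
    have : (0 : ℝ) ≤ a + b + c + d := by positivity
    linarith
  have hb0 : ∀ x : ℕ, (0 : ℝ) ≤ x := fun x => Nat.cast_nonneg x
  have ha' : 8 / (δ ^ 2 * ρ ^ 2) ≤ M := by linarith [hb0 a, hb0 b, hb0 c, hb0 d]
  have hb' : 4 / ρ ^ 3 ≤ M := by linarith [hb0 a, hb0 b, hb0 c, hb0 d]
  have hc' : 4 / (δ * ρ) ≤ M := by linarith [hb0 a, hb0 b, hb0 c, hb0 d]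
  have hd' : 1 / ρ ≤ M := by linarith [hb0 a, hb0 b, hb0 c, hb0 d]
  have hh : 1 ≤ h := by
    by_contra hlt
    have : h = 0 := by omega
    subst this
    rw [τ.card_eq] at hV
    simp at hV
  have hMn : M ≤ Fintype.card V := by
    rw [τ.card_eq]
    calc M = M ^ 1 := (pow_one M).symm
      _ ≤ _ := Finset.single_le_sum (f := fun i => M ^ i) (fun _ _ => Nat.zero_le _)
        (Finset.mem_range.2 (by omega))
  have hn : (M : ℝ) ≤ Fintype.card V := by exact_mod_cast hMn
  have hn0 : (0 : ℝ) < Fintype.card V := hM0.trans_le hn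
  have hnρ : 1 / (Fintype.card V : ℝ) ≤ ρ := by
    rw [div_le_iff₀ hn0]
    rw [div_le_iff₀ hρ0] at hd'
    nlinarith
  have hn1 : 0 < 1 / (Fintype.card V : ℝ) := by positivity
  set q : ℝ := 1 - 1 / (Fintype.card V : ℝ) with hq
  have hq0 : 0 ≤ q := by linarith
  obtain ⟨t₀, ht₀, ht₀'⟩ := exists_pow_mem_Icc hq0 (by linarith) hρ0 (by linarith)
    (by linarith : 1 - ρ ≤ q)
  obtain ⟨t₁, ht₁⟩ := exists_pow_lt_of_lt_one hρ0 (by linarith : q < 1)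
  set k : ℝ := M * ρ / 2 with hk
  have hk0 : 0 < k := by positivity
  have hkδ : 2 ≤ δ * k := by
    rw [div_le_iff₀ (by positivity)] at hc'
    rw [hk]; linarith
  have hkβ : 2 * k ≤ M * (1 - q ^ t₀) := by
    rw [hk]
    have := mul_le_mul_of_nonneg_left (by linarith : ρ ≤ 1 - q ^ t₀) hM0.le
    linarith
  have hA : 4 / (δ ^ 2 * k) ≤ ρ := by
    rw [div_le_iff₀ (by positivity)] at ha' ⊢
    rw [hk]
    linarith
  have hD : M / k ^ 2 ≤ ρ := by
    rw [div_le_iff₀ (by positivity)] at hb' ⊢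
    rw [hk]
    nlinarith
  let L := τ.level (h - 1)
  have hL : (L.card : ℝ) = (M : ℝ) ^ (h - 1) := by
    exact_mod_cast τ.card_level (by omega : h - 1 ≤ h)
  have hL0 : (0 : ℝ) < L.card := by rw [hL]; positivity
  let bad : (V → Bool) → (ℕ → V) → ℕ := fun X s =>
    (L.filter fun v => ¬τ.IsLocked (announcement G X s t₁) v).card
  let E : Set ((V → Bool) × (ℕ → V)) := {ω | (L.card : ℝ) / 4 ≤ bad ω.1 ω.2}
  have hdepE : ∀ X, DependsOn (fun s => (X, s) ∈ E) (Finset.range t₁ : Set ℕ) := fun X =>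
    announcement_mem_dependsOn (G := G) (fun c => (L.card : ℝ) / 4
      ≤ (L.filter fun v => ¬τ.IsLocked c v).card) X t₁
  let g : V → (ℕ → V) → ℝ := fun v s => 4 / (δ ^ 2 * k) + unselected t₁ v s
    + (1 - unselected t₀ v s) + ((∑ u ∈ τ.childFinset v, unselected t₀ u s) - M * q ^ t₀) ^ 2 / k ^
        2
  have hmemL : ∀ v ∈ L, τ.depth v + 1 = h := fun v hv => by
    have := τ.mem_level.1 hv
    omega
  have hg := fun v hv => τ.integral_not_isLocked_bound_le (hmemL v hv) (k := k)
    (4 / (δ ^ 2 * k)) t₀ t₁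
  have hmarkov : ∀ s, (signalsLaw V δ).real {X | (X, s) ∈ E} ≤ (4 / L.card) * ∑ v ∈ L, g v s := by
    intro s
    have hm := mul_meas_ge_le_integral_of_nonneg (μ := signalsLaw V δ)
      (f := fun X => (bad X s : ℝ)) (Eventually.of_forall fun X => Nat.cast_nonneg _)
      Integrable.of_finite (L.card / 4)
    have hint : ∫ X, (bad X s : ℝ) ∂(signalsLaw V δ) ≤ ∑ v ∈ L, g v s := by
      have : ∀ X, (bad X s : ℝ) = ∑ v ∈ L,
          ({X | ¬τ.IsLocked (announcement G X s t₁) v} : Set (V → Bool)).indicator 1 X := by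
        intro X
        simp only [bad, Finset.card_filter, Nat.cast_sum, Set.indicator_apply, Set.mem_ofPred_eq,
          Pi.one_apply, Nat.cast_ite, Nat.cast_one, Nat.cast_zero]
      simp only [this]
      rw [integral_finsetSum _ fun _ _ => Integrable.of_finite]
      refine Finset.sum_le_sum fun v hv => ?_
      rw [integral_indicator_one (DiscreteMeasurableSpace.forall_measurableSet _)]
      exact τ.signalsLaw_not_isLocked_le h0 h1 (hmemL v hv) hk0 hkδ hkβ t₀ t₁ s
    have hm' : (L.card : ℝ) / 4 * (signalsLaw V δ).real {X | (X, s) ∈ E} ≤ ∑ v ∈ L, g v s :=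
      hm.trans hint
    rw [div_mul_eq_mul_div, le_div_iff₀ hL0]
    linarith
  have hE : (processLaw V δ).real E ≤ ε := by
    rw [processLaw_real_eq h0.le h1.le hdepE]
    have hgi : Integrable (fun s => (4 / L.card : ℝ) * ∑ v ∈ L, g v s) (selectionsLaw V) :=
      (integrable_finsetSum _ fun v hv => (hg v hv).1).const_mul _
    refine (integral_mono_of_nonneg (Eventually.of_forall fun s => measureReal_nonneg) hgi
      (Eventually.of_forall hmarkov)).trans ?_
    rw [integral_const_mul, integral_finsetSum _ fun v hv => (hg v hv).1]
    have hsum : ∑ v ∈ L, ∫ s, g v s ∂(selectionsLaw V) ≤ ∑ _v ∈ L, 5 * ρ :=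
      Finset.sum_le_sum fun v hv => (hg v hv).2.trans (by linarith)
    rw [Finset.sum_const, nsmul_eq_mul] at hsum
    calc 4 / (L.card : ℝ) * ∑ v ∈ L, ∫ s, g v s ∂(selectionsLaw V)
        ≤ 4 / (L.card : ℝ) * (L.card * (5 * ρ)) := by gcongr
      _ = 20 * ρ := by field_simp; norm_num
      _ ≤ ε := hρε
  have hcompl : 1 - ε ≤ (processLaw V δ).real Eᶜ := by
    have h2 : (processLaw V δ).real (E ∪ Eᶜ) ≤ _ := measureReal_union_le E Eᶜ
    rw [Set.union_compl_self, probReal_univ] at h2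
    linarith
  refine hcompl.trans (processLaw_real_mono h0.le h1.le fun X s hs hω => ?_)
  simp only [E, Set.mem_compl_iff, Set.mem_ofPred_eq, not_le] at hω
  refine τ.stabilizesInCorrectMajority_of_locked (by omega) hh hs (t := t₁) ?_
  have hω' : 4 * (bad X s : ℝ) ≤ (M : ℝ) ^ (h - 1) := by linarith
  exact_mod_cast hω'

end Leaves

/-! ### Uniformity in the arity -/

lemma IsBalancedTree.arity_ne_zero {V : Type*} [Fintype V] {G : SimpleGraph V} {M : ℕ}
    (hG : IsBalancedTree G M) (hV : 2 ≤ Fintype.card V) : M ≠ 0 := by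
  rintro rfl
  obtain ⟨h, ⟨τ⟩⟩ := hG.exists_levelTree
  rw [τ.card_eq, Finset.sum_range_succ'] at hV
  simp at hV

universe u

/-- The thresholds of the finitely many small arities are bounded by their sum. -/
theorem eventually_correctMajority {δ : ℝ} (h0 : 0 < δ) (h1 : δ < 1 / 2) {ε : ℝ} (hε : 0 < ε) :
    ∃ n₀ : ℕ, ∀ (V : Type u) [Fintype V] [Nonempty V] [MeasurableSpace V]
      [DiscreteMeasurableSpace V] (G : SimpleGraph V) (M : ℕ), IsBalancedTree G M →
      n₀ ≤ Fintype.card V →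
      1 - ε ≤ (processLaw V δ).real {ω | StabilizesInCorrectMajority G ω.1 ω.2} := by
  obtain ⟨M₀, hM₀⟩ := eventually_correctMajority_of_large_arity.{u} h0 h1 hε
  have hsmall : ∀ M : ℕ, M ≠ 0 → ∃ n₀ : ℕ, ∀ (V : Type u) [Fintype V] [Nonempty V]
      [MeasurableSpace V] [DiscreteMeasurableSpace V] (G : SimpleGraph V), IsBalancedTree G M →
      n₀ ≤ Fintype.card V →
      1 - ε ≤ (processLaw V δ).real {ω | StabilizesInCorrectMajority G ω.1 ω.2} := by
    intro M hM
    rcases (by omega : M = 1 ∨ 2 ≤ M) with rfl | h2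
    · exact eventually_correctMajority_of_path h0 h1 hε
    · exact eventually_correctMajority_of_two_le h0 h1 h2 hε
  choose! n₁ hn₁ using hsmall
  refine ⟨2 + ∑ M ∈ Finset.range M₀, n₁ M, fun V _ _ _ _ G M hG hV => ?_⟩
  have hM := hG.arity_ne_zero (by omega)
  rcases lt_or_ge M M₀ with hlt | hge
  · have hle : n₁ M ≤ ∑ M ∈ Finset.range M₀, n₁ M :=
      Finset.single_le_sum (fun _ _ => Nat.zero_le _) (Finset.mem_range.2 hlt)
    exact hn₁ M hM V G hG (by omega)
  · exact hM₀ V G M hG hge (by omega)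

/-- The failure probabilities on the balanced trees with `n` nodes. -/
def failureProbs (δ : ℝ) (n : ℕ) : Set ℝ :=
  {x | ∃ (V : Type u) (_ : Fintype V) (_ : Nonempty V) (_ : MeasurableSpace V)
    (_ : DiscreteMeasurableSpace V) (G : SimpleGraph V) (M : ℕ), IsBalancedTree G M ∧
    Fintype.card V = n ∧
    x = 1 - (processLaw V δ).real {ω | StabilizesInCorrectMajority G ω.1 ω.2}}

lemma failureProbs_subset_Icc {δ : ℝ} (h0 : 0 ≤ δ) (h1 : δ ≤ 1 / 2) (n : ℕ) :
    failureProbs.{u} δ n ⊆ Set.Icc 0 1 := by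
  rintro x ⟨V, _, _, _, _, G, M, -, -, rfl⟩
  have := isProbabilityMeasure_processLaw (V := V) h0 h1
  exact ⟨sub_nonneg.2 measureReal_le_one, sub_le_self _ measureReal_nonneg⟩

end MajorityDynamics

theorem theorem5p9 (δ : ℝ) (hδ₀ : 0 < δ) (hδ₁ : δ < 1 / 2) :
    ∃ f : ℕ → ℝ, Tendsto f atTop (𝓝 0) ∧
      ∀ (V : Type*) [Fintype V] [Nonempty V] [MeasurableSpace V] [DiscreteMeasurableSpace V]
        (G : SimpleGraph V) (M : ℕ), MajorityDynamics.IsBalancedTree G M →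
        1 - f (Fintype.card V) ≤ (MajorityDynamics.processLaw V δ).real
          {ω | MajorityDynamics.StabilizesInCorrectMajority G ω.1 ω.2} := by
  have hIcc := MajorityDynamics.failureProbs_subset_Icc hδ₀.le hδ₁.le
  -- If no balanced tree has `n` nodes, the supremum is that of the empty set, which is `0`.
  refine ⟨fun n => sSup (MajorityDynamics.failureProbs δ n), ?_, fun V _ _ _ _ G M hG => ?_⟩
  · rw [Metric.tendsto_atTop]
    intro ε hε
    obtain ⟨n₀, hn₀⟩ := MajorityDynamics.eventually_correctMajority hδ₀ hδ₁ (half_pos hε)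
    refine ⟨n₀, fun n hn => ?_⟩
    rw [Real.dist_0_eq_abs, abs_of_nonneg (Real.sSup_nonneg fun x hx => (hIcc n hx).1)]
    refine lt_of_le_of_lt (Real.sSup_le ?_ (half_pos hε).le) (half_lt_self hε)
    rintro x ⟨V, _, _, _, _, G, M, hG, rfl, rfl⟩
    linarith [hn₀ V G M hG hn]
  · have := le_csSup ⟨1, fun x hx => (hIcc _ hx).2⟩
      (show _ ∈ MajorityDynamics.failureProbs δ (Fintype.card V) from
        ⟨V, inferInstance, inferInstance, inferInstance, inferInstance, G, M, hG, rfl, rfl⟩)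
    linarith
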